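/- Let $f$ be a $C^2$ diffeomorphism of $\mathbb T^3=\mathbb R^3/\mathbb Z^3$ that is (strongly) partially hyperbolic: there are a continuous $Df$-invariant splitting $T\mathbb T^3=E^s\oplus E^c\oplus E^u$ into line bundles and a Riemannian metric such that, with $\lambda^*_x=\|Df(x)|_{E^*}\|$, one has $\lambda^s_x<1<\lambda^u_x$ and $\lambda^s_x<\lambda^c_x<\lambda^u_x$ for all $x$. Let $\mathcal W^s$ be the stable foliation, i.e. the foliation tangent to $E^s$, with its leafwise distance $d_s$. For each $x\in\mathbb T^3$ let $D_x$ be a $C^1$ disc through $x$ with $T_xD_x=E^c(x)\oplus E^u(x)$ (for instance a local center-unstable leaf, if these exist). For $y\in\mathcal W^s(x)$ let $H^s_{x,y}$ be the local stable holonomy from a neighbourhood of $x$ in $D_x$ to $D_y$: $H^s_{x,y}(x)=y$, and $H^s_{x,y}(z)$ is the point of $D_y\cap\mathcal W^s(z)$ near $y$ whose leafwise distance from $z$ is close to $d_s(x,y)$. Assume that all the $H^s_{x,y}$ are $C^1$ near $x$, and let $\alpha^s(x,y)$ be the unoriented angle between the lines $DH^s_{x,y}(x)E^u(x)$ and $E^u(y)$.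 Let $\mu$ be an ergodic $f$-invariant Borel probability measure. Let $\xi^s$ be a measurable partition (a join of a sequence of finite Borel partitions) subordinate to $\mathcal W^s$, that is: for $\mu$-a.e. $x$ the atom $\xi^s(x)$ is a subset of $\mathcal W^s(x)$ of leafwise diameter less than $1$ that contains a neighbourhood of $x$ in $\mathcal W^s(x)$; $f\xi^s$ refines $\xi^s$ (mod $0$); and $\bigvee_{n\ge 0}f^n\xi^s$ is (mod $0$) the partition into points. Let $\{\mu^s_x\}_x$ be a system of conditional measures of $\mu$ relative to $\xi^s$. Then exactly one of the following holds: 1. for $\mu$-almost every $x$, $\mu^s_x\{y\in\xi^s(x):\alpha^s(x,y)=0\}=1$; 2. for $\mu$-almost every $x$, $\mu^s_x\{y\in\xi^s(x):\alpha^s(x,y)=0\}=0$. -/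

import Mathlib

open MeasureTheory Filter Topology

noncomputable section

namespace ZeroOne

/-- `ℝ³` with its Euclidean structure; it is also every tangent space of the torus. -/
abbrev E3 : Type := EuclideanSpace ℝ (Fin 3)

/-- `ℝ²`, the parameter space of two-dimensional discs. -/
abbrev E2 : Type := EuclideanSpace ℝ (Fin 2)

/-- The torus `𝕋³ = ℝ³ / ℤ³`. -/
abbrev T3 : Type := Fin 3 → UnitAddCircle

/-- The covering projection `ℝ³ → 𝕋³`. -/
def proj (v : E3) : T3 := fun i => ((v i : ℝ) : UnitAddCircle)

/-- The representative in `(-1/2, 1/2]³` of a point of the torus: a local inverse at `0` of the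
covering projection. -/
def chartLog (x : T3) : E3 :=
  WithLp.toLp 2 fun i => ((AddCircle.equivIoc (1 : ℝ) (-1 / 2) (x i) : Set.Ioc (-1 / 2 : ℝ) _) : ℝ)

/-- A self-map of the torus is of class `C²` if it has a `C²` lift to `ℝ³`. -/
def IsC2 (f : T3 → T3) : Prop :=
  ∃ F : E3 → E3, ContDiff ℝ 2 F ∧ ∀ v, proj (F v) = f (proj v)

/-- The derivative `Df(x) : ℝ³ → ℝ³`, in the charts `v ↦ x + v` and `w ↦ f x + w`. -/
def tderiv (f : T3 → T3) (x : T3) : E3 →L[ℝ] E3 :=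
  fderiv ℝ (fun v : E3 => chartLog (f (x + proj v) - f x)) 0

/-- A (continuous) Riemannian metric on the torus. -/
structure RiemMetric where
  /-- the inner product on the tangent space at each point -/
  inner : T3 → E3 →L[ℝ] E3 →L[ℝ] ℝ
  continuous_inner : Continuous inner
  symm : ∀ x v w, inner x v w = inner x w v
  pos : ∀ x v, v ≠ 0 → 0 < inner x v v

/-- The norm on the tangent space at `x`. -/
def RiemMetric.norm (g : RiemMetric) (x : T3) (v : E3) : ℝ := Real.sqrt (g.inner x v v)

/-- The unoriented angle at `x` between two lines `L` and `L'`. -/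
def RiemMetric.lineAngle (g : RiemMetric) (x : T3) (L L' : Submodule ℝ E3) : ℝ :=
  sInf {θ : ℝ | ∃ v ∈ L, ∃ w ∈ L', v ≠ 0 ∧ w ≠ 0 ∧
    θ = Real.arccos (g.inner x v w / (g.norm x v * g.norm x w))}

/-- A continuous field of lines (a continuous line subbundle of the tangent bundle). -/
def IsContinuousLineField (L : T3 → Submodule ℝ E3) : Prop :=
  ∀ x, ∃ U ∈ 𝓝 x, ∃ v : T3 → E3, ContinuousOn v U ∧
    ∀ y ∈ U, v y ≠ 0 ∧ L y = Submodule.span ℝ {v y}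

/-- The norm of `Df(x)` restricted to the line `L x`. -/
def rate (g : RiemMetric) (f : T3 → T3) (L : T3 → Submodule ℝ E3) (x : T3) : ℝ :=
  sSup {r : ℝ | ∃ v ∈ L x, v ≠ 0 ∧ r = g.norm (f x) (tderiv f x v) / g.norm x v}

/-- `f` is a `C²` (strongly) partially hyperbolic diffeomorphism of the torus with splitting
`Es ⊕ Ec ⊕ Eu` into line bundles, and the metric `g` is adapted to the splitting. -/
structure IsPartiallyHyperbolic (f : T3 ≃ₜ T3) (g : RiemMetric)
    (Es Ec Eu : T3 → Submodule ℝ E3) : Prop where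
  c2 : IsC2 f
  c2_symm : IsC2 f.symm
  continuous_s : IsContinuousLineField Es
  continuous_c : IsContinuousLineField Ec
  continuous_u : IsContinuousLineField Eu
  /-- three lines that span `ℝ³` are in direct sum -/
  span : ∀ x, Es x ⊔ Ec x ⊔ Eu x = ⊤
  invariant_s : ∀ x, (Es x).map (tderiv f x).toLinearMap = Es (f x)
  invariant_c : ∀ x, (Ec x).map (tderiv f x).toLinearMap = Ec (f x)
  invariant_u : ∀ x, (Eu x).map (tderiv f x).toLinearMap = Eu (f x)
  contraction : ∀ x, rate g f Es x < 1
  expansion : ∀ x, 1 < rate g f Eu x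
  domination_sc : ∀ x, rate g f Es x < rate g f Ec x
  domination_cu : ∀ x, rate g f Ec x < rate g f Eu x

/-- `c` is a lift to `ℝ³` of a `C¹` curve in the torus, everywhere tangent to the line field `L`,
whose restriction to `[0, 1]` goes from `x` to `y`. -/
structure IsLeafCurve (L : T3 → Submodule ℝ E3) (x y : T3) (c : ℝ → E3) : Prop where
  contDiff : ContDiff ℝ 1 c
  tangent : ∀ t, deriv c t ∈ L (proj (c t))
  source : proj (c 0) = x
  target : proj (c 1) = y

/-- The leaf through `x` of the foliation tangent to `L`. -/
def leaf (L : T3 → Submodule ℝ E3) (x : T3) : Set T3 :=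
  {y | ∃ c, IsLeafCurve L x y c}

/-- The length of (the restriction to `[0, 1]` of the projection of) a curve. -/
def curveLength (g : RiemMetric) (c : ℝ → E3) : ℝ :=
  ∫ t in (0 : ℝ)..1, g.norm (proj (c t)) (deriv c t)

/-- The leafwise distance; meaningful for `y ∈ leaf L x`. -/
def leafDist (g : RiemMetric) (L : T3 → Submodule ℝ E3) (x y : T3) : ℝ :=
  sInf {r : ℝ | ∃ c, IsLeafCurve L x y c ∧ r = curveLength g c}

/-- The ball of radius `r` about `x` in the leaf through `x`. -/
def leafBall (g : RiemMetric) (L : T3 → Submodule ℝ E3) (x : T3) (r : ℝ) : Set T3 :=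
  {y | y ∈ leaf L x ∧ leafDist g L x y < r}

/-- A family of (lifted, parametrized, local) `C¹` discs, `D x` passing through `x` and tangent at
`x` to `Ec x ⊕ Eu x`. Local center-unstable leaves are such discs wherever they exist. -/
structure IsDiscFamily (Ec Eu : T3 → Submodule ℝ E3) (D : T3 → E2 → E3) : Prop where
  contDiffAt : ∀ x, ContDiffAt ℝ 1 (D x) 0
  center : ∀ x, proj (D x 0) = x
  tangent : ∀ x, LinearMap.range (fderiv ℝ (D x) 0).toLinearMap = Ec x ⊔ Eu x

/-- `h` is, in the parameters of the discs `φ` and `ψ`, the local holonomy along the leaves of `L`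
from `φ` to `ψ`, near the center of `φ`: it sends the center `x` to the center `y`, and a
point `z` to a point `z'` of `ψ` in the leaf of `z`, near `y`, with leafwise distance from `z`
close to the one between `x` and `y`. -/
structure IsHolonomy (g : RiemMetric) (L : T3 → Submodule ℝ E3) (φ ψ : E2 → E3) (h : E2 → E2) :
    Prop where
  map_zero : h 0 = 0
  continuousAt : ContinuousAt h 0
  mem_leaf : ∀ᶠ p in 𝓝 (0 : E2), proj (ψ (h p)) ∈ leaf L (proj (φ p))
  dist_tendsto : Tendsto (fun p => leafDist g L (proj (φ p)) (proj (ψ (h p)))) (𝓝 0)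
    (𝓝 (leafDist g L (proj (φ 0)) (proj (ψ 0))))

/-- The stable holonomies between the discs of the family `D` are (locally defined and) `C¹`. -/
def HasC1Holonomies (g : RiemMetric) (Es : T3 → Submodule ℝ E3) (D : T3 → E2 → E3) : Prop :=
  ∀ x, ∀ y ∈ leaf Es x, ∃ h, IsHolonomy g Es (D x) (D y) h ∧ ContDiffAt ℝ 1 h 0

/-- The local stable holonomy `H^s_{x,y}` from `D x` to `D y`, in the parameters of the discs. -/
def holonomy (g : RiemMetric) (Es : T3 → Submodule ℝ E3) (D : T3 → E2 → E3) (x y : T3) : E2 → E2 :=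
  Classical.epsilon (IsHolonomy g Es (D x) (D y))

/-- The image `DH^s_{x,y}(x) E` of a subspace `E` of the tangent space of `D x` at `x`. -/
def holonomyImage (g : RiemMetric) (Es : T3 → Submodule ℝ E3) (D : T3 → E2 → E3) (x y : T3)
    (E : Submodule ℝ E3) : Submodule ℝ E3 :=
  (E.comap (fderiv ℝ (D x) 0).toLinearMap).map
    ((fderiv ℝ (D y) 0).comp (fderiv ℝ (holonomy g Es D x y) 0)).toLinearMap

/-- The angle function `α^s(x,y) = ∠(DH^s_{x,y}(x) E^u(x), E^u(y))`. -/
def alpha (g : RiemMetric) (Es Eu : T3 → Submodule ℝ E3) (D : T3 → E2 → E3) (x y : T3) : ℝ :=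
  g.lineAngle y (holonomyImage g Es D x y (Eu x)) (Eu y)

/-- The atom `ξ(x)` of a partition. -/
def atom (ξ : Setoid T3) (x : T3) : Set T3 := {y | ξ x y}

/-- A partition is measurable if it is the join of a sequence of finite Borel partitions (the
fibres of measurable maps to finite sets). -/
def IsMeasurablePartition (ξ : Setoid T3) : Prop :=
  ∃ (k : ℕ → ℕ) (q : (n : ℕ) → T3 → Fin (k n)), (∀ n, Measurable (q n)) ∧
    ∀ x y, ξ x y ↔ ∀ n, q n x = q n y

/-- The measurable partition `ξ` is subordinate to the (uniformly contracted) foliation tangent to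
`L`. The atom at `x` of the partition `f ^ n ξ` is `f ^ n (ξ (f ^ (-n) x))`. -/
structure IsSubordinate (f : T3 ≃ₜ T3) (g : RiemMetric) (L : T3 → Submodule ℝ E3)
    (μ : Measure T3) (ξ : Setoid T3) : Prop where
  measurable : IsMeasurablePartition ξ
  subset_leaf : ∀ᵐ x ∂μ, atom ξ x ⊆ leaf L x
  diam_lt : ∀ᵐ x ∂μ, ∃ δ < 1, ∀ y ∈ atom ξ x, ∀ z ∈ atom ξ x, leafDist g L y z ≤ δ
  contains_nhds : ∀ᵐ x ∂μ, ∃ ε > 0, leafBall g L x ε ⊆ atom ξ x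
  /-- `f ξ` refines `ξ` (mod 0) -/
  decreasing : ∃ N : Set T3, μ N = 0 ∧ ∀ x ∉ N, f '' atom ξ (f.symm x) \ N ⊆ atom ξ x
  /-- the join of the partitions `f ^ n ξ`, `n ≥ 0`, is (mod 0) the partition into points -/
  generating : ∃ N : Set T3, μ N = 0 ∧
    ∀ x ∉ N, (⋂ n : ℕ, f^[n] '' atom ξ (f.symm^[n] x)) \ N ⊆ {x}

/-- `μs` is a system of conditional measures of `μ` relative to the partition `ξ`. -/
structure IsConditionalSystem (μ : Measure T3) (ξ : Setoid T3) (μs : T3 → Measure T3) : Prop where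
  isProbability : ∀ᵐ x ∂μ, IsProbabilityMeasure (μs x)
  atom_full : ∀ᵐ x ∂μ, μs x (atom ξ x) = 1
  const_on_atoms : ∃ N : Set T3, μ N = 0 ∧ ∀ x ∉ N, ∀ y ∉ N, y ∈ atom ξ x → μs y = μs x
  aemeasurable : ∀ A : Set T3, MeasurableSet A → AEMeasurable (fun x => μs x A) μ
  disintegration : ∀ A : Set T3, MeasurableSet A → μ A = ∫⁻ x, μs x A ∂μ

end ZeroOne

end

noncomputable section

namespace ZeroOne

/-! ### The covering projection -/

/-! Call `y` related to `x` if `y` lies on the stable leaf of `x` and the derivative of the holonomy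
carries `E^u(x)` to `E^u(y)`. Derivatives of holonomies compose and commute with `Df`, and `Df`
preserves `E^u`; so this relation `R` is symmetric, transitive and invariant under `f`. The theorem
is a zero-one law for such relations (`ae_one_or_zero_of_invariant_relation`).

Let `K x` be the mass that the conditional measure at `x` gives to the class of `x`. Draw `x` from
`μ`, then `y` from the conditional measure on the atom of `x`. Given `x` and the atom of `f ^ n ξ`
containing `y`, the conditional probability of `R x y` is the conditional mass of the class of `x`
in that atom. The atoms shrink to points, so by Lévy's theorem this probability tends to the
indicator of `R x y`. If `R x y` holds, the class of `x` is the class of `y`, and invariance turns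
the mass into `K (f ^ (-n) y)`. Hence `K (f ^ (-n) y) → 1` for almost every pair in `R`; as `x` and
`y` are exchangeable, the same limit holds at almost every point where `K > 0`. The set where this
limit holds is invariant. By ergodicity it is null, and then `K = 0` almost everywhere, or it is
full, and then `K = 1` almost everywhere because the integral of `K ∘ f ^ (-n)` does not depend on
`n`.

The geometric half makes `R` accessible. On `ℝ³` the three line fields have global unit sections `X
0`, `X 1`, `X 2` (stable, center, unstable). A cone argument (`HypFrame.exists_unique_radius`) shows
that curves tangent to `X 0` are unique, so there is a flow `φ` whose orbits project injectively
onto the stable leaves, with time as arc length (`eq_zero_of_proj_flow_eq`, `leafDist_eq`). A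
holonomy between discs is this flow at a variable time. Modulo the flow direction its derivative is
a map `A` that does not depend on the discs (`IsTransDeriv`): one `C¹` holonomy produces `A`
(`exists_isTransDeriv`), and `A` then gives the derivative of every holonomy between discs of the
family with the same end points (`hasFDerivAt_holonomy`). The angle vanishes exactly when `A (X 2
v)` has no `X 1` component (`alpha_eq_zero_iff`). Expressed through `φ` alone, this condition is
Borel (`measurableSet_angleRel`), although the discs need not depend measurably on their centers. -/

lemma proj_add (v w : E3) : proj (v + w) = proj v + proj w := by
  ext i; simp [proj]

lemma proj_sub (v w : E3) : proj (v - w) = proj v - proj w := by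
  ext i; simp [proj]

lemma continuous_proj : Continuous proj := by
  refine continuous_pi fun i => ?_
  exact (AddCircle.continuous_mk' (1 : ℝ)).comp (by fun_prop)

lemma proj_surjective : Function.Surjective proj := by
  intro x
  choose v hv using fun i => QuotientAddGroup.mk_surjective (x i)
  exact ⟨WithLp.toLp 2 v, funext hv⟩

lemma proj_eq_zero_iff {k : E3} : proj k = 0 ↔ ∀ i, ∃ n : ℤ, k i = n := by
  rw [funext_iff]
  refine forall_congr' fun i => ?_
  simp only [proj, Pi.zero_apply, AddCircle.coe_eq_zero_iff]
  simp [eq_comm]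

lemma proj_eq_iff {v w : E3} : proj v = proj w ↔ proj (v - w) = 0 := by
  rw [proj_sub, sub_eq_zero]

lemma proj_add_of_lattice (v : E3) {k : E3} (hk : proj k = 0) : proj (v + k) = proj v := by
  rw [proj_add, hk, add_zero]

lemma abs_coord_le_norm (v : E3) (i : Fin 3) : |v i| ≤ ‖v‖ := by
  simpa using PiLp.norm_apply_le v i

lemma eq_zero_of_proj_eq_zero {k : E3} (hk : proj k = 0) (h : ‖k‖ < 1) : k = 0 := by
  ext i
  obtain ⟨n, hn⟩ := proj_eq_zero_iff.1 hk i
  have h1 : |(n : ℝ)| < 1 := by rw [← hn]; exact (abs_coord_le_norm k i).trans_lt h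
  have h2 : |n| < 1 := by exact_mod_cast h1
  simp [hn, Int.abs_lt_one_iff.1 h2]

lemma chartLog_proj {u : E3} (hu : ‖u‖ < 1 / 2) : chartLog (proj u) = u := by
  ext i
  have h : |u i| < 1 / 2 := (abs_coord_le_norm u i).trans_lt hu
  rw [abs_lt] at h
  have hm : u i ∈ Set.Ioc (-1 / 2 : ℝ) (-1 / 2 + 1) := ⟨by linarith [h.1], by linarith [h.2]⟩
  have := AddCircle.equivIoc_coe_eq (p := (1 : ℝ)) (a := (-1 / 2 : ℝ)) hm
  simp only [chartLog, proj]
  rw [this]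

/-- Distinct lattice points are at distance at least one, so a continuous lattice-valued map is
locally constant. -/
lemma eq_of_forall_proj_eq_zero {Y : Type*} [TopologicalSpace Y] [PreconnectedSpace Y] {u : Y → E3}
    (hu : Continuous u) (h : ∀ v, proj (u v) = 0) (v w : Y) : u v = u w := by
  have : IsLocallyConstant u := by
    rw [IsLocallyConstant.iff_eventually_eq]
    intro x
    have := hu.continuousAt (x := x)
    filter_upwards [this.eventually (Metric.ball_mem_nhds (u x) one_pos)] with y hy
    have hy' : ‖u y - u x‖ < 1 := by rwa [← dist_eq_norm]
    have := eq_zero_of_proj_eq_zero (k := u y - u x) (by rw [proj_sub, h, h, sub_zero]) hy'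
    exact sub_eq_zero.1 this
  exact this.apply_eq_of_preconnectedSpace v w

/-! ### Lifts of maps of the torus -/

lemma lift_add_lattice {f : T3 → T3} {F : E3 → E3} (hF : Continuous F)
    (hl : ∀ v, proj (F v) = f (proj v)) {k : E3} (hk : proj k = 0) (v w : E3) :
    F (v + k) - F v = F (w + k) - F w :=
  eq_of_forall_proj_eq_zero (u := fun v => F (v + k) - F v) (by fun_prop)
    (fun v => by rw [proj_sub, hl, hl, proj_add_of_lattice v hk, sub_self]) v w

/-- Near `0` the displacement of the lift is shorter than `1/2`, and there `chartLog` inverts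
`proj`. This transfers all differentiation to the lift. -/
lemma tderiv_eq_fderiv_lift {f : T3 → T3} {F : E3 → E3} (hF : Continuous F)
    (hl : ∀ v, proj (F v) = f (proj v)) (v : E3) : tderiv f (proj v) = fderiv ℝ F v := by
  have h0 : Tendsto (fun u : E3 => F (v + u) - F v) (𝓝 0) (𝓝 0) := by
    have : Continuous fun u : E3 => F (v + u) - F v := by fun_prop
    simpa using this.tendsto 0
  have h1 : (fun u : E3 => chartLog (f (proj v + proj u) - f (proj v))) =ᶠ[𝓝 0]
      fun u => F (v + u) - F v := by
    filter_upwards [h0.eventually (Metric.ball_mem_nhds 0 (by norm_num : (0 : ℝ) < 1 / 2))]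
      with u hu
    rw [← proj_add, ← hl, ← hl, ← proj_sub, chartLog_proj (by simpa using hu)]
  rw [tderiv, h1.fderiv_eq, fderiv_sub_const, fderiv_comp_add_left, add_zero]

/-! ### Functions on `ℝ³` that are periodic under twice the lattice -/

/-- Periodicity under the sublattice `2ℤ³`. -/
def IsDoublePeriodic {V : Type*} (Φ : E3 → V) : Prop :=
  ∀ k, proj k = 0 → ∀ v, Φ (v + (k + k)) = Φ v

/-- Each coordinate is brought into `[0, 2)`, so the norm is at most `√12`. -/
lemma exists_lattice_near (v : E3) : ∃ k, proj k = 0 ∧ ‖v + (k + k)‖ ≤ 4 := by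
  refine ⟨WithLp.toLp 2 fun i => ((-⌊v i / 2⌋ : ℤ) : ℝ), proj_eq_zero_iff.2 fun i => ⟨_, rfl⟩, ?_⟩
  rw [EuclideanSpace.norm_eq]
  have hb : ∀ i, ‖(v + (WithLp.toLp 2 (fun i => ((-⌊v i / 2⌋ : ℤ) : ℝ)) +
      WithLp.toLp 2 (fun i => ((-⌊v i / 2⌋ : ℤ) : ℝ))) : E3) i‖ ^ 2 ≤ 4 := by
    intro i
    have h1 := Int.floor_le (v i / 2)
    have h2 := Int.lt_floor_add_one (v i / 2)
    simp only [PiLp.add_apply, Real.norm_eq_abs, sq_abs]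
    push_cast
    nlinarith
  refine (Real.sqrt_le_sqrt (Finset.sum_le_sum fun i _ => hb i)).trans ?_
  rw [Real.sqrt_le_left (by norm_num)]
  norm_num

lemma IsDoublePeriodic.uniformContinuous {V : Type*} [NormedAddCommGroup V] {Φ : E3 → V}
    (hp : IsDoublePeriodic Φ) (hc : Continuous Φ) : UniformContinuous Φ := by
  -- One point is moved into the ball of radius `4`; the other then lies within distance `1` of it.
  have hK : UniformContinuousOn Φ (Metric.closedBall 0 5) :=
    (isCompact_closedBall _ _).uniformContinuousOn_of_continuous hc.continuousOn
  rw [Metric.uniformContinuousOn_iff] at hK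
  rw [Metric.uniformContinuous_iff]
  intro ε hε
  obtain ⟨δ, hδ, h⟩ := hK ε hε
  refine ⟨min δ 1, by positivity, fun {v w} hvw => ?_⟩
  obtain ⟨k, hk, hv⟩ := exists_lattice_near v
  rw [← hp k hk v, ← hp k hk w]
  have hd : dist (v + (k + k)) (w + (k + k)) < min δ 1 := by simpa using hvw
  refine h _ ?_ _ ?_ (hd.trans_le (min_le_left _ _))
  · simp only [mem_closedBall_zero_iff]; linarith
  · simp only [mem_closedBall_zero_iff]
    have h1 : dist (w + (k + k)) (v + (k + k)) < 1 := by
      rw [dist_comm]; exact hd.trans_le (min_le_right _ _)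
    rw [dist_eq_norm] at h1
    have := norm_le_norm_add_norm_sub' (w + (k + k)) (v + (k + k))
    linarith

lemma IsDoublePeriodic.exists_bound {V : Type*} [NormedAddCommGroup V] {Φ : E3 → V}
    (hp : IsDoublePeriodic Φ) (hc : Continuous Φ) : ∃ C, ∀ v, ‖Φ v‖ ≤ C := by
  obtain ⟨C, hC⟩ := (isCompact_closedBall (0 : E3) 4).exists_bound_of_continuousOn hc.continuousOn
  refine ⟨C, fun v => ?_⟩
  obtain ⟨k, hk, hv⟩ := exists_lattice_near v
  rw [← hp k hk v]
  exact hC _ (by simpa using hv)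

lemma IsDoublePeriodic.exists_pos_le {Φ : E3 → ℝ}
    (hp : IsDoublePeriodic Φ) (hc : Continuous Φ) (h : ∀ v, 0 < Φ v) :
    ∃ η > 0, ∀ v, η ≤ Φ v := by
  obtain ⟨w, -, hw⟩ := (isCompact_closedBall (0 : E3) 4).exists_isMinOn
    ⟨0, by simp⟩ hc.continuousOn
  refine ⟨Φ w, h w, fun v => ?_⟩
  obtain ⟨k, hk, hv⟩ := exists_lattice_near v
  rw [← hp k hk v]
  exact hw (by simpa using hv)

end ZeroOne

end

noncomputable section

namespace ZeroOne

/-! ### Orienting a line field on the universal cover -/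

/-- Orthogonal projections do not depend on the chosen local generators, so they encode the line
field by one globally defined continuous function. -/
lemma IsContinuousLineField.continuous_starProjection {L : T3 → Submodule ℝ E3}
    (hL : IsContinuousLineField L) :
    Continuous fun v : E3 => (L (proj v)).starProjection := by
  rw [continuous_iff_continuousAt]
  intro v
  obtain ⟨U, hU, a, ha, h⟩ := hL (proj v)
  have hU' : proj ⁻¹' U ∈ 𝓝 v := continuous_proj.continuousAt hU
  have hac : ContinuousAt (fun w : E3 => a (proj w)) v :=
    (ha.continuousAt hU).comp continuous_proj.continuousAt
  have h0 : ‖a (proj v)‖ ^ 2 ≠ 0 := by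
    have := (h _ (mem_of_mem_nhds hU)).1
    simpa using this
  have hc : ContinuousAt (fun w : E3 => (‖a (proj w)‖ ^ 2)⁻¹ •
      (innerSL ℝ (a (proj w))).smulRight (a (proj w))) v := by
    refine ((hac.norm.pow 2).inv₀ h0).smul ?_
    have h1 : ContinuousAt (fun w : E3 => innerSL ℝ (a (proj w))) v :=
      (innerSL ℝ : E3 →L⋆[ℝ] E3 →L[ℝ] ℝ).continuous.continuousAt.comp hac
    exact ((ContinuousLinearMap.smulRightL ℝ E3 E3).continuous.continuousAt.comp h1).clm_apply hac
  refine hc.congr ?_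
  filter_upwards [hU'] with w hw
  ext1 u
  obtain ⟨-, h2⟩ := h (proj w) hw
  have h3 : (L (proj w)).starProjection u = (Submodule.span ℝ {a (proj w)}).starProjection u := by
    congr!
  rw [h3, Submodule.starProjection_singleton]
  simp [smul_smul, div_eq_inv_mul]

lemma norm_radial_sub_le {a b r : ℝ} (ha : 0 ≤ a) (hab : a ≤ b) (hr : b - a ≤ r) (v : E3) :
    ‖(b / max b ‖v‖) • v - (a / max a ‖v‖) • v‖ ≤ r := by
  rw [← sub_smul, norm_smul, Real.norm_eq_abs]
  have hn := norm_nonneg v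
  rcases eq_or_lt_of_le hn with h0 | h0
  · rw [← h0]; simp; linarith
  have key : ∀ c : ℝ, 0 ≤ c → c / max c ‖v‖ * ‖v‖ = min c ‖v‖ := by
    intro c hc
    rcases le_total c ‖v‖ with h | h
    · rw [max_eq_right h, min_eq_left h]; field_simp
    · rw [max_eq_left h, min_eq_right h, div_self (by linarith), one_mul]
  rw [← abs_of_pos h0, ← abs_mul, abs_of_pos h0, sub_mul, key a ha, key b (ha.trans hab),
    abs_of_nonneg (sub_nonneg.2 (min_le_min_right _ hab))]
  rcases le_total b ‖v‖ with h | h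
  · rw [min_eq_left h, min_eq_left (hab.trans h)]; exact hr
  · rw [min_eq_right h]
    rcases le_total a ‖v‖ with h' | h'
    · rw [min_eq_left h']; linarith
    · rw [min_eq_right h']; linarith

/-- A vector of the line at `0` is transported outwards along rays. `ρ j` is the radial retraction
onto the ball of radius `j * r`, and `Y (j + 1)` projects `Y j` to the line over `ρ (j + 1)`.
Consecutive projections differ by less than one in norm, so the vector never becomes zero. Once `j *
r ≥ ‖v‖` nothing changes any more, and the final value lies in the line at `v`. -/
lemma IsContinuousLineField.exists_section {L : T3 → Submodule ℝ E3}
    (hL : IsContinuousLineField L) :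
    ∃ X : E3 → E3, Continuous X ∧ ∀ v, X v ≠ 0 ∧ L (proj v) = Submodule.span ℝ {X v} := by
  set P : E3 → E3 →L[ℝ] E3 := fun v => (L (proj v)).starProjection with hP
  have hPc : Continuous P := hL.continuous_starProjection
  have hPp : IsDoublePeriodic P := fun k hk v => by
    have : proj (v + (k + k)) = proj v := proj_add_of_lattice v (by rw [proj_add, hk, add_zero])
    simp only [hP, this]
  obtain ⟨δ, hδ, hPδ⟩ := Metric.uniformContinuous_iff.1 (hPp.uniformContinuous hPc) 1 one_pos
  set r := δ / 2 with hr
  have hr0 : 0 < r := by positivity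
  have hline : ∀ v, ∃ a, a ≠ 0 ∧ L (proj v) = Submodule.span ℝ {a} := fun v => by
    obtain ⟨U, hU, a, -, h⟩ := hL (proj v)
    exact ⟨_, h _ (mem_of_mem_nhds hU)⟩
  obtain ⟨a₀, ha₀, hL₀⟩ := hline 0
  let ρ : ℕ → E3 → E3 := fun j v => ((j * r) / max (j * r) ‖v‖) • v
  have hρc : ∀ j, Continuous (ρ (j + 1)) := fun j => by
    have hpos : 0 < ((j + 1 : ℕ) : ℝ) * r := by positivity
    refine Continuous.smul (Continuous.div continuous_const
      (continuous_const.max continuous_norm) fun v => ?_) continuous_id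
    exact (lt_max_of_lt_left hpos).ne'
  let Y : ℕ → E3 → E3 := fun j => Nat.rec (fun _ => a₀) (fun j Yj v => P (ρ (j + 1) v) (Yj v)) j
  have hY : ∀ j v, Y (j + 1) v = P (ρ (j + 1) v) (Y j v) := fun j v => rfl
  have hYc : ∀ j, Continuous (Y j) := by
    intro j
    induction j with
    | zero => exact continuous_const
    | succ j ih =>
      have : Y (j + 1) = fun v => P (ρ (j + 1) v) (Y j v) := rfl
      rw [this]
      exact (hPc.comp (hρc j)).clm_apply ih
  have hY0 : ∀ j v, Y j v ≠ 0 ∧ Y j v ∈ L (proj (ρ j v)) := by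
    intro j v
    induction j with
    | zero =>
      refine ⟨ha₀, ?_⟩
      have : ρ 0 v = 0 := by simp [ρ]
      rw [this, hL₀]
      exact Submodule.mem_span_singleton_self _
    | succ j ih =>
      refine ⟨fun h0 => ?_, ?_⟩
      · rw [hY] at h0
        have h1 : P (ρ j v) (Y j v) = Y j v := Submodule.starProjection_eq_self_iff.2 ih.2
        have h2 : dist (ρ (j + 1) v) (ρ j v) < δ := by
          rw [dist_eq_norm]
          refine (norm_radial_sub_le (by positivity) (by push_cast; nlinarith) (r := r) ?_ v).trans_lt
            (by rw [hr]; linarith)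
          push_cast; linarith
        have h3 := hPδ h2
        rw [dist_eq_norm] at h3
        have h4 : ‖Y j v‖ ≤ ‖P (ρ (j + 1) v) - P (ρ j v)‖ * ‖Y j v‖ := by
          have := (P (ρ (j + 1) v) - P (ρ j v)).le_opNorm (Y j v)
          rwa [sub_apply, h0, h1, zero_sub, norm_neg] at this
        have h5 : 0 < ‖Y j v‖ := norm_pos_iff.2 ih.1
        nlinarith
      · rw [hY]
        exact Submodule.starProjection_apply_mem _ _
  have hρv : ∀ (j : ℕ) v, 0 < j → ‖v‖ ≤ j * r → ρ j v = v := fun j v hj h => by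
    have hpos : 0 < (j : ℝ) * r := by positivity
    simp only [ρ]
    rw [max_eq_left h, div_self hpos.ne', one_smul]
  have hstab : ∀ v (n m : ℕ), 0 < n → ‖v‖ ≤ n * r → n ≤ m → Y m v = Y n v := by
    intro v n m hn h hnm
    induction m, hnm using Nat.le_induction with
    | base => rfl
    | succ m hm ih =>
      have hm' : ‖v‖ ≤ m * r := h.trans (by gcongr)
      have h1 : ‖v‖ ≤ (m + 1 : ℕ) * r := h.trans (by gcongr; omega)
      rw [hY, hρv _ _ (Nat.succ_pos _) h1, ← ih]
      have := (hY0 m v).2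
      rw [hρv _ _ (by omega) hm'] at this
      exact Submodule.starProjection_eq_self_iff.2 this
  -- The added one keeps the index positive, as `hρv` and `hstab` require, even at `v = 0`.
  let N : E3 → ℕ := fun v => ⌈‖v‖ / r⌉₊ + 1
  have hN : ∀ (v : E3) (n : ℕ), ‖v‖ / r ≤ n → ‖v‖ ≤ n * r := fun v n h => by
    rwa [div_le_iff₀ hr0] at h
  have hNv : ∀ v, ‖v‖ ≤ N v * r := fun v => hN v _ ((Nat.le_ceil _).trans (by simp [N]))
  refine ⟨fun v => Y (N v) v, ?_, fun v => ?_⟩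
  · rw [continuous_iff_continuousAt]
    intro v
    set n := ⌈(‖v‖ + 1) / r⌉₊ + 1
    refine ((hYc n).continuousAt (x := v)).congr ?_
    filter_upwards [Metric.ball_mem_nhds v one_pos] with w hw
    have hw' : ‖w‖ ≤ ‖v‖ + 1 := by
      rw [mem_ball_iff_norm] at hw
      have := norm_le_norm_add_norm_sub' w v
      linarith
    refine hstab w (N w) n (Nat.succ_pos _) (hNv w) ?_
    simp only [N, n]
    gcongr
  · have h1 := hY0 (N v) v
    rw [hρv _ _ (Nat.succ_pos _) (hNv v)] at h1
    refine ⟨h1.1, ?_⟩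
    obtain ⟨a, ha, hLa⟩ := hline v
    rw [hLa] at h1 ⊢
    obtain ⟨c, hc⟩ := Submodule.mem_span_singleton.1 h1.2
    have hc0 : c ≠ 0 := by rintro rfl; exact h1.1 (by rw [← hc, zero_smul])
    beta_reduce
    rw [← hc, Submodule.span_singleton_smul_eq (IsUnit.mk0 c hc0)]

/-! ### The norm of a Riemannian metric -/

lemma RiemMetric.inner_self_nonneg (g : RiemMetric) (x : T3) (v : E3) : 0 ≤ g.inner x v v := by
  rcases eq_or_ne v 0 with rfl | h
  · simp
  · exact (g.pos x v h).le

lemma RiemMetric.norm_smul (g : RiemMetric) (x : T3) (a : ℝ) (v : E3) :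
    g.norm x (a • v) = |a| * g.norm x v := by
  simp only [RiemMetric.norm, map_smul, smul_apply, smul_eq_mul]
  rw [← mul_assoc, Real.sqrt_mul (mul_self_nonneg a), Real.sqrt_mul_self_eq_abs]

lemma RiemMetric.norm_pos (g : RiemMetric) (x : T3) {v : E3} (h : v ≠ 0) : 0 < g.norm x v :=
  Real.sqrt_pos.2 (g.pos x v h)

lemma RiemMetric.continuous_norm (g : RiemMetric) {Y : Type*} [TopologicalSpace Y] {p : Y → T3}
    {u : Y → E3} (hp : Continuous p) (hu : Continuous u) : Continuous fun y => g.norm (p y) (u y) :=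
  (((g.continuous_inner.comp hp).clm_apply hu).clm_apply hu).sqrt

/-- A continuous unit section of a line field on the universal cover. -/
structure IsUnitSection (g : RiemMetric) (L : T3 → Submodule ℝ E3) (X : E3 → E3) : Prop where
  continuous : Continuous X
  norm_eq_one : ∀ v, g.norm (proj v) (X v) = 1
  span_eq : ∀ v, L (proj v) = Submodule.span ℝ {X v}

lemma IsContinuousLineField.exists_unitSection {L : T3 → Submodule ℝ E3}
    (hL : IsContinuousLineField L) (g : RiemMetric) : ∃ X, IsUnitSection g L X := by
  obtain ⟨X, hX, h⟩ := hL.exists_section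
  have hpos := fun v => g.norm_pos (proj v) (h v).1
  refine ⟨fun v => (g.norm (proj v) (X v))⁻¹ • X v, ?_, fun v => ?_, fun v => ?_⟩
  · exact ((g.continuous_norm continuous_proj hX).inv₀ fun v => (hpos v).ne').smul hX
  · rw [g.norm_smul, abs_of_pos (inv_pos.2 (hpos v)), inv_mul_cancel₀ (hpos v).ne']
  · rw [(h v).2, Submodule.span_singleton_smul_eq (IsUnit.mk0 _ (inv_ne_zero (hpos v).ne'))]

namespace IsUnitSection

variable {g : RiemMetric} {L : T3 → Submodule ℝ E3} {X : E3 → E3}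

lemma ne_zero (hX : IsUnitSection g L X) (v : E3) : X v ≠ 0 := by
  intro h
  have := hX.norm_eq_one v
  rw [h] at this
  simp [RiemMetric.norm] at this

lemma mem (hX : IsUnitSection g L X) (v : E3) : X v ∈ L (proj v) := by
  rw [hX.span_eq]; exact Submodule.mem_span_singleton_self _

/-- The two vectors are unit vectors of the same line, hence equal or opposite; each alternative is
closed, and `ℝ³` is connected. -/
lemma exists_sign (hX : IsUnitSection g L X) {k : E3} (hk : proj k = 0) :
    ∃ σ : ℝ, |σ| = 1 ∧ ∀ v, X (v + k) = σ • X v := by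
  have h1 : ∀ v, X (v + k) = X v ∨ X (v + k) = -X v := by
    intro v
    have hm := hX.mem (v + k)
    rw [proj_add_of_lattice v hk, hX.span_eq v] at hm
    obtain ⟨c, hc⟩ := Submodule.mem_span_singleton.1 hm
    have hn := hX.norm_eq_one (v + k)
    rw [← hc, proj_add_of_lattice v hk, g.norm_smul, hX.norm_eq_one, mul_one] at hn
    rcases abs_eq (zero_le_one' ℝ) |>.1 hn with h | h
    · left; rw [← hc, h, one_smul]
    · right; rw [← hc, h, neg_one_smul]
  have hc1 : Continuous fun v => X (v + k) := hX.continuous.comp (by fun_prop)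
  have hA : IsClosed {v | X (v + k) = X v} := isClosed_eq hc1 hX.continuous
  have hB : IsClosed {v | X (v + k) = -X v} := isClosed_eq hc1 hX.continuous.neg
  have hAB : {v | X (v + k) = X v}ᶜ = {v | X (v + k) = -X v} := by
    ext v
    simp only [Set.mem_compl_iff, Set.mem_ofPred_eq]
    refine ⟨fun h => (h1 v).resolve_left h, fun h h' => hX.ne_zero v ?_⟩
    rw [h] at h'
    ext i
    have := congrArg (fun u : E3 => u i) h'
    simp only [PiLp.neg_apply] at this
    simp only [PiLp.zero_apply]
    linarith
  have hcl : IsClopen {v | X (v + k) = X v} :=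
    ⟨hA, by rw [← isClosed_compl_iff, hAB]; exact hB⟩
  rcases isClopen_iff.1 hcl with h | h
  · refine ⟨-1, by simp, fun v => ?_⟩
    have : v ∈ {v | X (v + k) = X v}ᶜ := by rw [h]; simp
    rw [hAB] at this
    rw [neg_one_smul]; exact this
  · refine ⟨1, by simp, fun v => ?_⟩
    have : v ∈ {v | X (v + k) = X v} := by rw [h]; trivial
    rw [one_smul]; exact this

/-- A line field may be non-orientable on the torus, and then some lattice translations reverse `X`.
Translating twice squares the sign; this is why periodicity is required only under `2ℤ³`. -/
lemma isDoublePeriodic (hX : IsUnitSection g L X) : IsDoublePeriodic X := by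
  intro k hk v
  obtain ⟨σ, hσ, h⟩ := hX.exists_sign hk
  rw [← add_assoc, h, h, smul_smul, ← abs_mul_abs_self, hσ]
  simp

end IsUnitSection

end ZeroOne

end

noncomputable section

namespace ZeroOne

/-! ### Hyperbolic frames -/

/-- A frame `X` of `ℝ³` with dual coframe `θ`, invariant under `F` with multipliers `m`, uniformly
continuous and bounded, whose first direction is uniformly contracted and dominated by the others. -/
structure HypFrame (F : E3 → E3) (X : Fin 3 → E3 → E3) (θ : Fin 3 → E3 → E3 →L[ℝ] ℝ)
    (m : Fin 3 → E3 → ℝ) : Prop where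
  contDiff : ContDiff ℝ 1 F
  uc_fderiv : UniformContinuous (fderiv ℝ F)
  uc_X : ∀ i, UniformContinuous (X i)
  uc_θ : ∀ i, UniformContinuous (θ i)
  uc_m : ∀ i, UniformContinuous (m i)
  bound : ∃ C, 0 < C ∧ ∀ i v, ‖X i v‖ ≤ C ∧ ‖θ i v‖ ≤ C
  sum_eq : ∀ v u, ∑ i, θ i v u • X i v = u
  dual : ∀ i j v, θ i v (X j v) = if i = j then 1 else 0
  fderiv_X : ∀ i v, fderiv ℝ F v (X i v) = m i v • X i (F v)
  multiplier_ne_zero : ∀ v, m 0 v ≠ 0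
  contraction : ∃ r, 0 < r ∧ r < 1 ∧ ∀ v, |m 0 v| ≤ r
  domination : ∃ η > 0, ∀ v, |m 0 v| + η ≤ |m 1 v|
  domination' : ∀ v, |m 1 v| ≤ |m 2 v|

/-- The linear map sending the standard basis to the vectors `X i v`. -/
def frameMap (X : Fin 3 → E3 → E3) (v : E3) : E3 →L[ℝ] E3 :=
  ∑ i, (EuclideanSpace.proj (𝕜 := ℝ) i).smulRight (X i v)

lemma frameMap_apply (X : Fin 3 → E3 → E3) (v u : E3) : frameMap X v u = ∑ i, u i • X i v := by
  simp [frameMap]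

lemma continuous_frameMap {X : Fin 3 → E3 → E3} (hX : ∀ i, Continuous (X i)) :
    Continuous (frameMap X) := by
  unfold frameMap
  refine continuous_finsetSum _ fun i _ => ?_
  exact ((ContinuousLinearMap.smulRightL ℝ E3 E3) (EuclideanSpace.proj i)).continuous.comp (hX i)

lemma isUnit_frameMap {X : Fin 3 → E3 → E3} {v : E3}
    (h : ⊤ ≤ Submodule.span ℝ (Set.range fun i => X i v)) : IsUnit (frameMap X v) := by
  have hs : Function.Surjective (frameMap X v).toLinearMap := by
    rw [← LinearMap.range_eq_top, eq_top_iff]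
    refine h.trans (Submodule.span_le.2 ?_)
    rintro _ ⟨i, rfl⟩
    refine ⟨EuclideanSpace.single i 1, ?_⟩
    change frameMap X v _ = _
    rw [frameMap_apply]
    simp
  have hi := LinearMap.injective_iff_surjective.2 hs
  rw [ContinuousLinearMap.isUnit_iff_bijective]
  exact ⟨hi, hs⟩

/-- The coordinate functionals of a frame. -/
def coframe (X : Fin 3 → E3 → E3) (i : Fin 3) (v : E3) : E3 →L[ℝ] ℝ :=
  (EuclideanSpace.proj (𝕜 := ℝ) i).comp (Ring.inverse (frameMap X v))

lemma continuous_coframe {X : Fin 3 → E3 → E3} (hX : ∀ i, Continuous (X i))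
    (h : ∀ v, IsUnit (frameMap X v)) (i : Fin 3) : Continuous (coframe X i) := by
  have h1 : Continuous fun v => Ring.inverse (frameMap X v) := by
    rw [continuous_iff_continuousAt]
    intro v
    have := NormedRing.inverse_continuousAt (h v).unit
    exact ContinuousAt.comp (f := frameMap X) (g := Ring.inverse) this
      (continuous_frameMap hX).continuousAt
  exact ((ContinuousLinearMap.compL ℝ E3 E3 ℝ) (EuclideanSpace.proj i)).continuous.comp h1

lemma sum_coframe {X : Fin 3 → E3 → E3} {v : E3} (h : IsUnit (frameMap X v)) (u : E3) :
    ∑ i, coframe X i v u • X i v = u := by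
  have := congrArg (fun A : E3 →L[ℝ] E3 => A u) (Ring.mul_inverse_cancel _ h)
  change frameMap X v (Ring.inverse (frameMap X v) u) = u at this
  rw [frameMap_apply] at this
  exact this

lemma coframe_apply_frame {X : Fin 3 → E3 → E3} {v : E3} (h : IsUnit (frameMap X v)) (i j : Fin 3) :
    coframe X i v (X j v) = if i = j then 1 else 0 := by
  have h2 : frameMap X v (EuclideanSpace.single j 1) = X j v := by
    rw [frameMap_apply]; simp
  have := congrArg (fun A : E3 →L[ℝ] E3 => A (EuclideanSpace.single j 1))
    (Ring.inverse_mul_cancel _ h)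
  change Ring.inverse (frameMap X v) (frameMap X v _) = EuclideanSpace.single j 1 at this
  rw [h2] at this
  simp only [coframe, ContinuousLinearMap.comp_apply, this]
  simp

/-- All nonzero vectors of a line are stretched by the same ratio, so the supremum runs over a
singleton. -/
lemma rate_eq {g : RiemMetric} {L : T3 → Submodule ℝ E3} {X : E3 → E3} (hX : IsUnitSection g L X)
    {f : T3 → T3} {v w : E3} (hw : proj w = f (proj v)) {a : ℝ}
    (h : tderiv f (proj v) (X v) = a • X w) : rate g f L (proj v) = |a| := by
  have : {r : ℝ | ∃ u ∈ L (proj v), u ≠ 0 ∧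
      r = g.norm (f (proj v)) (tderiv f (proj v) u) / g.norm (proj v) u} = {|a|} := by
    have key : ∀ c : ℝ, c ≠ 0 → g.norm (f (proj v)) (tderiv f (proj v) (c • X v)) /
        g.norm (proj v) (c • X v) = |a| := fun c hc => by
      rw [map_smul, h, smul_smul, ← hw, g.norm_smul, g.norm_smul, hX.norm_eq_one, hX.norm_eq_one,
        mul_one, mul_one, abs_mul, mul_div_cancel_left₀ _ (abs_ne_zero.2 hc)]
    ext r
    simp only [Set.mem_ofPred_eq, Set.mem_singleton_iff]
    constructor
    · rintro ⟨u, hu, hu0, rfl⟩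
      rw [hX.span_eq] at hu
      obtain ⟨c, rfl⟩ := Submodule.mem_span_singleton.1 hu
      exact key c (by rintro rfl; simp at hu0)
    · rintro rfl
      refine ⟨(1 : ℝ) • X v, by rw [one_smul]; exact hX.mem v, by simpa using hX.ne_zero v, ?_⟩
      rw [key 1 one_ne_zero]
  rw [rate, this, csSup_singleton]

/-- The three line fields of a splitting, as a family. -/
abbrev splitting (Es Ec Eu : T3 → Submodule ℝ E3) : Fin 3 → T3 → Submodule ℝ E3 := ![Es, Ec, Eu]

section

variable {f : T3 ≃ₜ T3} {g : RiemMetric} {Es Ec Eu : T3 → Submodule ℝ E3}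

lemma IsPartiallyHyperbolic.isUnit_frameMap (hf : IsPartiallyHyperbolic f g Es Ec Eu)
    {X : Fin 3 → E3 → E3} (hX : ∀ i, IsUnitSection g (splitting Es Ec Eu i) (X i)) (v : E3) :
    IsUnit (frameMap X v) := by
  refine ZeroOne.isUnit_frameMap ?_
  rw [← hf.span (proj v)]
  have hs : ∀ i, splitting Es Ec Eu i (proj v) ≤ Submodule.span ℝ (Set.range fun i => X i v) := by
    intro i
    rw [(hX i).span_eq, Submodule.span_singleton_le_iff_mem]
    exact Submodule.subset_span ⟨i, rfl⟩
  exact sup_le (sup_le (hs 0) (hs 1)) (hs 2)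

/-- Frame, coframe and multipliers are periodic under `2ℤ³`; compactness therefore makes continuity
uniform and turns the pointwise contraction and stable-center domination into uniform gaps. -/
lemma IsPartiallyHyperbolic.hypFrame (hf : IsPartiallyHyperbolic f g Es Ec Eu)
    {X : Fin 3 → E3 → E3} (hX : ∀ i, IsUnitSection g (splitting Es Ec Eu i) (X i))
    {F : E3 → E3} (hF : ContDiff ℝ 1 F) (hl : ∀ v, proj (F v) = f (proj v)) :
    HypFrame F X (coframe X) fun i v => coframe X i (F v) (fderiv ℝ F v (X i v)) := by
  have hu := hf.isUnit_frameMap hX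
  have hXc := fun i => (hX i).continuous
  have hXp := fun i => (hX i).isDoublePeriodic
  have hθc := continuous_coframe hXc hu
  have hθp : ∀ i, IsDoublePeriodic (coframe X i) := fun i k hk v => by
    simp only [coframe, frameMap, hXp _ k hk v]
  have hFc := hF.continuous
  have hDc : Continuous (fderiv ℝ F) := hF.continuous_fderiv one_ne_zero
  have hDk : ∀ k, proj k = 0 → ∀ v, fderiv ℝ F (v + k) = fderiv ℝ F v := fun k hk v => by
    rw [← tderiv_eq_fderiv_lift hFc hl, ← tderiv_eq_fderiv_lift hFc hl, proj_add_of_lattice v hk]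
  have hDp : IsDoublePeriodic (fderiv ℝ F) := fun k hk v =>
    hDk _ (by rw [proj_add, hk, add_zero]) v
  -- The displacement of `F` under a lattice translation is a lattice vector independent of the base
  -- point, so a doubled translation goes to a doubled translation.
  have hFk : ∀ k, proj k = 0 → ∃ k', proj k' = 0 ∧ ∀ v, F (v + (k + k)) = F v + (k' + k') := by
    intro k hk
    have h := lift_add_lattice hFc hl hk
    refine ⟨F (0 + k) - F 0, ?_, fun v => ?_⟩
    · rw [proj_sub, hl, hl, proj_add_of_lattice 0 hk, sub_self]
    · have h1 := h v 0
      have h2 := h (v + k) 0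
      rw [← add_assoc]
      rw [sub_eq_iff_eq_add] at h1 h2
      rw [h2, h1]
      abel
  have hFp : ∀ {V : Type} (Φ : E3 → V), IsDoublePeriodic Φ → IsDoublePeriodic fun v => Φ (F v) := by
    intro V Φ hΦ k hk v
    obtain ⟨k', hk', h⟩ := hFk k hk
    simp only [h]
    exact hΦ k' hk' _
  set m : Fin 3 → E3 → ℝ := fun i v => coframe X i (F v) (fderiv ℝ F v (X i v)) with hm
  have hmc : ∀ i, Continuous (m i) := fun i =>
    ((hθc i).comp hFc).clm_apply (hDc.clm_apply (hXc i))
  have hmp : ∀ i, IsDoublePeriodic (m i) := fun i k hk v => by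
    simp only [hm]
    have := hFp _ (hθp i) k hk v
    beta_reduce at this
    rw [this, hDp k hk v, hXp i k hk v]
  have hinv : ∀ i v, fderiv ℝ F v (X i v) ∈ splitting Es Ec Eu i (proj (F v)) := by
    intro i v
    have h0 := (hX i).mem v
    rw [hl, ← tderiv_eq_fderiv_lift hFc hl]
    fin_cases i
    · have h1 := Submodule.mem_map_of_mem (f := (tderiv f (proj v)).toLinearMap) h0
      exact (hf.invariant_s (proj v)).le h1
    · have h1 := Submodule.mem_map_of_mem (f := (tderiv f (proj v)).toLinearMap) h0
      exact (hf.invariant_c (proj v)).le h1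
    · have h1 := Submodule.mem_map_of_mem (f := (tderiv f (proj v)).toLinearMap) h0
      exact (hf.invariant_u (proj v)).le h1
  have hfX : ∀ i v, fderiv ℝ F v (X i v) = m i v • X i (F v) := by
    intro i v
    have h0 := hinv i v
    rw [(hX i).span_eq] at h0
    obtain ⟨c, hc⟩ := Submodule.mem_span_singleton.1 h0
    simp only [hm]
    rw [← hc, map_smul, coframe_apply_frame (hu _)]
    simp
  have hrate : ∀ i v, rate g f (splitting Es Ec Eu i) (proj v) = |m i v| := fun i v =>
    rate_eq (hX i) (hl v) (by rw [tderiv_eq_fderiv_lift hFc hl]; exact hfX i v)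
  refine
    { contDiff := hF
      uc_fderiv := hDp.uniformContinuous hDc
      uc_X := fun i => (hXp i).uniformContinuous (hXc i)
      uc_θ := fun i => (hθp i).uniformContinuous (hθc i)
      uc_m := fun i => (hmp i).uniformContinuous (hmc i)
      bound := ?_
      sum_eq := fun v u => sum_coframe (hu v) u
      dual := fun i j v => coframe_apply_frame (hu v) i j
      fderiv_X := hfX
      multiplier_ne_zero := fun v h0 => ?_
      contraction := ?_
      domination := ?_
      domination' := fun v => ?_ }
  rotate_left
  -- The derivative maps `Es` onto the whole line `Es` at the image; a zero multiplier would make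
  -- that image trivial.
  · have h1 := (hX 0).mem (F v)
    simp only [splitting, Matrix.cons_val_zero] at h1
    rw [hl, ← hf.invariant_s] at h1
    obtain ⟨u, hu, hu'⟩ := h1
    have h2 : Es (proj v) = Submodule.span ℝ {X 0 v} := (hX 0).span_eq v
    rw [SetLike.mem_coe, h2] at hu
    obtain ⟨c, rfl⟩ := Submodule.mem_span_singleton.1 hu
    change tderiv f (proj v) (c • X 0 v) = _ at hu'
    rw [map_smul, tderiv_eq_fderiv_lift hFc hl, hfX, h0, zero_smul, smul_zero] at hu'
    exact (hX 0).ne_zero _ hu'.symm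
  rotate_right
  · choose A hA using fun i => (hXp i).exists_bound (hXc i)
    choose B hB using fun i => (hθp i).exists_bound (hθc i)
    refine ⟨1 + ∑ i, (|A i| + |B i|), by positivity, fun i v => ?_⟩
    have h1 : |A i| + |B i| ≤ ∑ i, (|A i| + |B i|) :=
      Finset.single_le_sum (f := fun i => |A i| + |B i|) (fun i _ => by positivity)
        (Finset.mem_univ i)
    have := hA i v
    have := hB i v
    have := le_abs_self (A i)
    have := le_abs_self (B i)
    have := abs_nonneg (A i)
    have := abs_nonneg (B i)
    constructor <;> linarith
  · obtain ⟨η, hη, h⟩ := IsDoublePeriodic.exists_pos_le (Φ := fun v => 1 - |m 0 v|)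
      (fun k hk v => by simp only [hmp 0 k hk v]) (by have := hmc 0; fun_prop)
      (fun v => by
        have := hf.contraction (proj v)
        have h0 := hrate 0 v
        simp only [splitting, Matrix.cons_val_zero] at h0
        rw [h0] at this
        linarith)
    refine ⟨max (1 - η) (1 / 2), by positivity, by simp; constructor <;> linarith, fun v => ?_⟩
    have := h v
    exact le_max_of_le_left (by linarith)
  · obtain ⟨η, hη, h⟩ := IsDoublePeriodic.exists_pos_le (Φ := fun v => |m 1 v| - |m 0 v|)
      (fun k hk v => by simp only [hmp _ k hk v])
      (by have := hmc 0; have := hmc 1; fun_prop)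
      (fun v => by
        have := hf.domination_sc (proj v)
        have h0 := hrate 0 v
        have h1 := hrate 1 v
        simp only [splitting, Matrix.cons_val_zero, Matrix.cons_val_one] at h0 h1
        rw [h0, h1] at this
        linarith)
    refine ⟨η, hη, fun v => ?_⟩
    have := h v
    linarith
  · have := hf.domination_cu (proj v)
    have h1 := hrate 1 v
    have h2 := hrate 2 v
    simp only [splitting, Matrix.cons_val_one, Matrix.cons_val] at h1 h2
    rw [h1, h2] at this
    exact this.le

end

end ZeroOne

end

noncomputable section

namespace ZeroOne

/-! ### Uniqueness of the curves tangent to the contracted direction -/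

namespace HypFrame

variable {F : E3 → E3} {X : Fin 3 → E3 → E3} {θ : Fin 3 → E3 → E3 →L[ℝ] ℝ} {m : Fin 3 → E3 → ℝ}

lemma coframe_fderiv (h : HypFrame F X θ m) (i : Fin 3) (v u : E3) :
    θ i (F v) (fderiv ℝ F v u) = m i v * θ i v u := by
  conv_lhs => rw [← h.sum_eq v u]
  simp only [map_sum, map_smul, h.fderiv_X, h.dual, smul_eq_mul]
  simp [mul_comm]

lemma hasFDerivAt (h : HypFrame F X θ m) (v : E3) : HasFDerivAt F (fderiv ℝ F v) v :=
  (h.contDiff.differentiable one_ne_zero v).hasFDerivAt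

lemma norm_le_sum (h : HypFrame F X θ m) {C : ℝ} (hC : ∀ i v, ‖X i v‖ ≤ C) (v u : E3) :
    ‖u‖ ≤ (|θ 0 v u| + |θ 1 v u| + |θ 2 v u|) * C := by
  conv_lhs => rw [← h.sum_eq v u]
  refine (norm_sum_le _ _).trans ?_
  rw [Fin.sum_univ_three]
  simp only [norm_smul, Real.norm_eq_abs, add_mul]
  gcongr <;> exact hC _ _

/-- As long as the image curve stays within `r` of the orbit of `c 0`, its multiplier exceeds the
one on that orbit by at most `η`, which bounds its next displacement. The products are at most one,
so the curve never leaves the radius and the induction closes. -/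
lemma norm_iterate_sub_le (h : HypFrame F X θ m) {C η r : ℝ} (hC0 : 0 ≤ C)
    (hC : ∀ v, ‖X 0 v‖ ≤ C) (hη0 : 0 ≤ η) (hη : ∀ v, |m 0 v| + η ≤ 1)
    (hr : ∀ v w, ‖v - w‖ ≤ r → |m 0 v - m 0 w| ≤ η) {c : ℝ → E3} {a : ℝ → ℝ} {t A : ℝ}
    (hc : ∀ s, HasDerivAt c (a s • X 0 (c s)) s) (ha : ∀ s ∈ Set.uIcc 0 t, |a s| ≤ A)
    (hA : C * A * |t| ≤ r) (n : ℕ) :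
    ∀ s ∈ Set.uIcc 0 t, ‖F^[n] (c s) - F^[n] (c 0)‖ ≤
      C * A * |t| * ∏ k ∈ Finset.range n, (|m 0 (F^[k] (c 0))| + η) := by
  have hA0 : 0 ≤ A := (abs_nonneg _).trans (ha 0 Set.left_mem_uIcc)
  have hQ0 : ∀ n, 0 ≤ ∏ k ∈ Finset.range n, (|m 0 (F^[k] (c 0))| + η) := fun n =>
    Finset.prod_nonneg fun k _ => by positivity
  have hQ1 : ∀ n, ∏ k ∈ Finset.range n, (|m 0 (F^[k] (c 0))| + η) ≤ 1 := fun n =>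
    Finset.prod_le_one (fun k _ => by positivity) fun k _ => hη _
  have hder : ∀ n s, HasDerivAt (fun s => F^[n] (c s))
      ((a s * ∏ k ∈ Finset.range n, m 0 (F^[k] (c s))) • X 0 (F^[n] (c s))) s := by
    intro n s
    induction n with
    | zero => simpa using hc s
    | succ n ih =>
      have := (h.hasFDerivAt (F^[n] (c s))).comp_hasDerivAt s ih
      simp only [Function.iterate_succ_apply']
      rw [Finset.prod_range_succ, ← mul_assoc]
      rw [map_smul, h.fderiv_X, smul_smul] at this
      exact this
  have step : ∀ n, (∀ s ∈ Set.uIcc 0 t, |∏ k ∈ Finset.range n, m 0 (F^[k] (c s))| ≤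
      ∏ k ∈ Finset.range n, (|m 0 (F^[k] (c 0))| + η)) →
      ∀ s ∈ Set.uIcc 0 t, ‖F^[n] (c s) - F^[n] (c 0)‖ ≤
      C * A * |t| * ∏ k ∈ Finset.range n, (|m 0 (F^[k] (c 0))| + η) := by
    intro n hn s hs
    have := (convex_uIcc 0 t).norm_image_sub_le_of_norm_hasDerivWithin_le
      (f := fun s => F^[n] (c s)) (C := A * (∏ k ∈ Finset.range n, (|m 0 (F^[k] (c 0))| + η)) * C)
      (fun s _ => (hder n s).hasDerivWithinAt) (fun s hs => ?_) Set.left_mem_uIcc hs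
    · refine this.trans ?_
      have hst : ‖s - 0‖ ≤ |t| := by
        rw [Real.norm_eq_abs]
        simpa using Set.abs_sub_left_of_mem_uIcc hs
      calc _ ≤ A * (∏ k ∈ Finset.range n, (|m 0 (F^[k] (c 0))| + η)) * C * |t| := by
            have := hQ0 n
            gcongr
        _ = _ := by ring
    · rw [norm_smul, Real.norm_eq_abs, abs_mul]
      exact mul_le_mul (mul_le_mul (ha s hs) (hn s hs) (abs_nonneg _) hA0) (hC _) (norm_nonneg _)
        (mul_nonneg hA0 (hQ0 n))
  refine step n ?_
  induction n with
  | zero => simp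
  | succ n ih =>
    intro s hs
    rw [Finset.prod_range_succ, Finset.prod_range_succ, abs_mul]
    refine mul_le_mul (ih s hs) ?_ (abs_nonneg _) (hQ0 n)
    have h1 : ‖F^[n] (c s) - F^[n] (c 0)‖ ≤ r :=
      (step n ih s hs).trans ((mul_le_of_le_one_right (by positivity) (hQ1 n)).trans hA)
    have h2 := hr _ _ h1
    have h3 := abs_sub_abs_le_abs_sub (m 0 (F^[n] (c s))) (m 0 (F^[n] (c 0)))
    linarith

/-- The size of the part of a vector transverse to the contracted direction. -/
def transSize (θ : Fin 3 → E3 → E3 →L[ℝ] ℝ) (v u : E3) : ℝ := max |θ 1 v u| |θ 2 v u|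

lemma transSize_nonneg (θ : Fin 3 → E3 → E3 →L[ℝ] ℝ) (v u : E3) : 0 ≤ transSize θ v u :=
  (abs_nonneg _).trans (le_max_left _ _)

/-- Replacing `F p - F q` by the derivative at `x` costs at most `η` times the transverse size in
each coordinate. The transverse part thus grows at least by `|m 1| - η`, while the stable part is at
most `|m 0| + η` times the old transverse size; the gap between the multipliers keeps the difference
in the cone. -/
lemma cone_step (h : HypFrame F X θ m) {C ε r η : ℝ} (hC0 : 0 ≤ C) (hε : 0 ≤ ε)
    (hC : ∀ i v, ‖X i v‖ ≤ C ∧ ‖θ i v‖ ≤ C)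
    (hr : ∀ v w, ‖v - w‖ ≤ r → ‖fderiv ℝ F v - fderiv ℝ F w‖ ≤ ε)
    (hη : C * (ε * (3 * C)) ≤ η) (hdom : ∀ v, |m 0 v| + 2 * η ≤ |m 1 v|)
    {x p q : E3} (hp : ‖p - x‖ ≤ r) (hq : ‖q - x‖ ≤ r)
    (hcone : |θ 0 x (p - q)| ≤ transSize θ x (p - q)) :
    |θ 0 (F x) (F p - F q)| ≤ transSize θ (F x) (F p - F q) ∧
      (|m 1 x| - η) * transSize θ x (p - q) ≤ transSize θ (F x) (F p - F q) := by
  set N := transSize θ x (p - q) with hN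
  have hN0 : 0 ≤ N := transSize_nonneg _ _ _
  have h1 : |θ 1 x (p - q)| ≤ N := le_max_left _ _
  have h2 : |θ 2 x (p - q)| ≤ N := le_max_right _ _
  have hd : ‖p - q‖ ≤ 3 * C * N := by
    refine (h.norm_le_sum (fun i v => (hC i v).1) x (p - q)).trans ?_
    calc _ ≤ (N + N + N) * C := by gcongr
      _ = _ := by ring
  have he : ‖F p - F q - fderiv ℝ F x (p - q)‖ ≤ ε * ‖p - q‖ :=
    (convex_closedBall x r).norm_image_sub_le_of_norm_hasFDerivWithin_le'
      (fun v _ => (h.hasFDerivAt v).hasFDerivWithinAt)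
      (fun v hv => hr v x (by simpa [dist_eq_norm] using hv))
      (by simpa [dist_eq_norm] using hq) (by simpa [dist_eq_norm] using hp)
  have hi : ∀ i, |θ i (F x) (F p - F q) - m i x * θ i x (p - q)| ≤ η * N := by
    intro i
    rw [← h.coframe_fderiv, ← map_sub, ← Real.norm_eq_abs]
    refine ((θ i (F x)).le_opNorm _).trans ?_
    calc _ ≤ C * (ε * (3 * C * N)) :=
          mul_le_mul (hC i _).2 (he.trans (by gcongr)) (norm_nonneg _) hC0
      _ = C * (ε * (3 * C)) * N := by ring
      _ ≤ η * N := by gcongr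
  have hlow : (|m 1 x| - η) * N ≤ transSize θ (F x) (F p - F q) := by
    have key : ∀ i, |m 1 x| ≤ |m i x| → |θ i x (p - q)| = N →
        (|m 1 x| - η) * N ≤ |θ i (F x) (F p - F q)| := by
      intro i hmi hNi
      have h3 := hi i
      have h4 := abs_sub_abs_le_abs_sub (m i x * θ i x (p - q)) (θ i (F x) (F p - F q))
      rw [abs_sub_comm, abs_mul, hNi] at h4
      nlinarith
    rcases max_choice |θ 1 x (p - q)| |θ 2 x (p - q)| with h5 | h5
    · exact (key 1 le_rfl (by rw [hN, transSize, h5])).trans (le_max_left _ _)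
    · exact (key 2 (h.domination' x) (by rw [hN, transSize, h5])).trans (le_max_right _ _)
  refine ⟨le_trans ?_ hlow, hlow⟩
  have h3 := hi 0
  have h4 := abs_sub_abs_le_abs_sub (θ 0 (F x) (F p - F q)) (m 0 x * θ 0 x (p - q))
  rw [abs_mul] at h4
  have h5 : |m 0 x| * |θ 0 x (p - q)| ≤ |m 0 x| * N := by gcongr
  nlinarith [hdom x]

/-- Uniqueness for a merely continuous field. The endpoints `p`, `q` have equal stable coordinate,
so `p - q` lies in the transverse cone and its transverse size grows at least like the product of
`|m 1| - η`. Both endpoints approach the orbit of the common starting point like the product of `|m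
0| + η`. Domination makes the ratio of the products tend to zero, which forces `p = q`. -/
lemma exists_unique_radius (h : HypFrame F X θ m) : ∃ r > 0, ∀ (c₁ c₂ : ℝ → E3) (a₁ a₂ : ℝ → ℝ)
    (t₁ t₂ A : ℝ), (∀ s, HasDerivAt c₁ (a₁ s • X 0 (c₁ s)) s) →
    (∀ s, HasDerivAt c₂ (a₂ s • X 0 (c₂ s)) s) → (∀ s ∈ Set.uIcc 0 t₁, |a₁ s| ≤ A) →
    (∀ s ∈ Set.uIcc 0 t₂, |a₂ s| ≤ A) → A * |t₁| ≤ r → A * |t₂| ≤ r → c₁ 0 = c₂ 0 →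
    θ 0 (c₁ 0) (c₁ t₁ - c₂ t₂) = 0 → c₁ t₁ = c₂ t₂ := by
  obtain ⟨C, hC0, hC⟩ := h.bound
  obtain ⟨lam, hl0, hl1, hlam⟩ := h.contraction
  obtain ⟨η₀, hη₀, hdom⟩ := h.domination
  set η := min (η₀ / 4) (1 - lam) with hη
  have hηpos : 0 < η := lt_min (by positivity) (by linarith)
  have hη1 : ∀ v, |m 0 v| + η ≤ 1 := fun v => by
    have := min_le_right (η₀ / 4) (1 - lam); linarith [hlam v]
  have hη4 : ∀ v, |m 0 v| + 4 * η ≤ |m 1 v| := fun v => by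
    have := min_le_left (η₀ / 4) (1 - lam); linarith [hdom v]
  -- This makes the linearization error in `cone_step` equal to `η`.
  set ε := η / (C * (3 * C)) with hε
  have hεpos : 0 < ε := by positivity
  obtain ⟨r₁, hr₁, hm⟩ := Metric.uniformContinuous_iff.1 (h.uc_m 0) η hηpos
  obtain ⟨r₂, hr₂, hD⟩ := Metric.uniformContinuous_iff.1 h.uc_fderiv ε hεpos
  set r := min r₁ r₂ / 2 with hr
  have hrpos : 0 < r := by positivity
  have hm' : ∀ v w, ‖v - w‖ ≤ r → |m 0 v - m 0 w| ≤ η := fun v w hvw => by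
    have := hm (a := v) (b := w) (by
      rw [dist_eq_norm]; linarith [min_le_left r₁ r₂])
    exact this.le
  have hD' : ∀ v w, ‖v - w‖ ≤ r → ‖fderiv ℝ F v - fderiv ℝ F w‖ ≤ ε := fun v w hvw => by
    have := hD (a := v) (b := w) (by
      rw [dist_eq_norm]; linarith [min_le_right r₁ r₂])
    rw [dist_eq_norm] at this
    exact this.le
  refine ⟨r / C, by positivity, ?_⟩
  intro c₁ c₂ a₁ a₂ t₁ t₂ A hc₁ hc₂ ha₁ ha₂ hA₁ hA₂ h0 hθ
  have hA₁' : C * A * |t₁| ≤ r := by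
    rw [le_div_iff₀ hC0] at hA₁; linarith
  have hA₂' : C * A * |t₂| ≤ r := by
    rw [le_div_iff₀ hC0] at hA₂; linarith
  set x := c₁ 0 with hx
  set Q : ℕ → ℝ := fun n => ∏ k ∈ Finset.range n, (|m 0 (F^[k] x)| + η) with hQ
  have hQ0 : ∀ n, 0 ≤ Q n := fun n => Finset.prod_nonneg fun k _ => by positivity
  have hQ1 : ∀ n, Q n ≤ 1 := fun n =>
    Finset.prod_le_one (fun k _ => by positivity) fun k _ => hη1 _
  have hp : ∀ n, ‖F^[n] (c₁ t₁) - F^[n] x‖ ≤ r * Q n := fun n =>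
    (h.norm_iterate_sub_le hC0.le (fun v => (hC 0 v).1) hηpos.le hη1 hm' hc₁ ha₁ hA₁' n t₁
      Set.right_mem_uIcc).trans (mul_le_mul_of_nonneg_right hA₁' (hQ0 n))
  have hq : ∀ n, ‖F^[n] (c₂ t₂) - F^[n] x‖ ≤ r * Q n := fun n => by
    rw [h0]
    refine (h.norm_iterate_sub_le hC0.le (fun v => (hC 0 v).1) hηpos.le hη1 hm' hc₂ ha₂ hA₂' n t₂
      Set.right_mem_uIcc).trans ?_
    rw [← h0]
    exact mul_le_mul_of_nonneg_right hA₂' (hQ0 n)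
  have hpr : ∀ n, ‖F^[n] (c₁ t₁) - F^[n] x‖ ≤ r := fun n =>
    (hp n).trans (mul_le_of_le_one_right hrpos.le (hQ1 n))
  have hqr : ∀ n, ‖F^[n] (c₂ t₂) - F^[n] x‖ ≤ r := fun n =>
    (hq n).trans (mul_le_of_le_one_right hrpos.le (hQ1 n))
  set p := c₁ t₁
  set q := c₂ t₂
  set N : ℕ → ℝ := fun n => transSize θ (F^[n] x) (F^[n] p - F^[n] q) with hN
  set Ψ : ℕ → ℝ := fun n => ∏ k ∈ Finset.range n, (|m 1 (F^[k] x)| - η) with hΨ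
  have hm1 : ∀ v, 0 < |m 1 v| - η := fun v => by linarith [hη4 v, abs_nonneg (m 0 v)]
  have hΨpos : ∀ n, 0 < Ψ n := fun n => Finset.prod_pos fun k _ => hm1 _
  have hcone : ∀ n, |θ 0 (F^[n] x) (F^[n] p - F^[n] q)| ≤ N n ∧ Ψ n * N 0 ≤ N n := by
    intro n
    induction n with
    | zero =>
      refine ⟨?_, by simp [hΨ]⟩
      simp only [Function.iterate_zero, id]
      rw [hθ, abs_zero]
      exact transSize_nonneg _ _ _
    | succ n ih =>
      have := h.cone_step hC0.le hεpos.le hC hD' (η := η)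
        (by rw [hε]; apply le_of_eq; field_simp) (fun v => by linarith [hη4 v])
        (hpr n) (hqr n) ih.1
      simp only [hN, Function.iterate_succ_apply']
      refine ⟨this.1, le_trans ?_ this.2⟩
      simp only [hΨ]
      rw [Finset.prod_range_succ, mul_comm (∏ k ∈ _, _), mul_assoc]
      exact mul_le_mul_of_nonneg_left ih.2 (hm1 _).le
  -- Since `|m 1| - η ≥ |m 0| + 3 * η`, the ratio of the rates is at most `(a + η) / (a + 3 * η)`
  -- with `a = |m 0| ≤ 1`, and this increases with `a`.
  set κ := (1 + η) / (1 + 3 * η) with hκ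
  have hκ0 : 0 ≤ κ := by positivity
  have hκ1 : κ < 1 := by rw [hκ, div_lt_one (by positivity)]; linarith
  have hκm : ∀ v, |m 0 v| + η ≤ κ * (|m 1 v| - η) := fun v => by
    rw [hκ, div_mul_eq_mul_div, le_div_iff₀ (by positivity)]
    have h1 := hη4 v
    have h2 := hη1 v
    have h3 := abs_nonneg (m 0 v)
    nlinarith
  have hQΨ : ∀ n, Q n ≤ κ ^ n * Ψ n := by
    intro n
    have : κ ^ n = ∏ _k ∈ Finset.range n, κ := by simp
    rw [this, hΨ, ← Finset.prod_mul_distrib]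
    exact Finset.prod_le_prod (fun k _ => by positivity) fun k _ => hκm _
  have hNle : ∀ n, N 0 ≤ C * (2 * r) * κ ^ n := by
    intro n
    have h1 : ‖F^[n] p - F^[n] q‖ ≤ 2 * r * Q n := by
      have := norm_sub_le_norm_sub_add_norm_sub (F^[n] p) (F^[n] x) (F^[n] q)
      rw [norm_sub_rev (F^[n] x)] at this
      linarith [hp n, hq n]
    have h2 : N n ≤ C * (2 * r * Q n) := by
      have h3 : ∀ i, |θ i (F^[n] x) (F^[n] p - F^[n] q)| ≤ C * (2 * r * Q n) := fun i => by
        rw [← Real.norm_eq_abs]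
        exact ((θ i _).le_opNorm _).trans (mul_le_mul (hC i _).2 h1 (norm_nonneg _) hC0.le)
      exact max_le (h3 1) (h3 2)
    have h3 := (hcone n).2
    have h4 := hQΨ n
    refine le_of_mul_le_mul_left ?_ (hΨpos n)
    calc Ψ n * N 0 ≤ C * (2 * r * Q n) := h3.trans h2
      _ ≤ C * (2 * r * (κ ^ n * Ψ n)) := by gcongr
      _ = _ := by ring
  have hN0 : N 0 ≤ 0 := by
    have ht := (tendsto_pow_atTop_nhds_zero_of_lt_one hκ0 hκ1).const_mul (C * (2 * r))
    rw [mul_zero] at ht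
    exact ge_of_tendsto' ht hNle
  have hN0' : N 0 = transSize θ x (p - q) := by simp [hN]
  have h1 : |θ 1 x (p - q)| ≤ 0 := (le_max_left _ _).trans (hN0' ▸ hN0)
  have h2 : |θ 2 x (p - q)| ≤ 0 := (le_max_right _ _).trans (hN0' ▸ hN0)
  have h3 := h.norm_le_sum (fun i v => (hC i v).1) x (p - q)
  rw [hθ, abs_zero, le_antisymm h1 (abs_nonneg _), le_antisymm h2 (abs_nonneg _)] at h3
  simp only [add_zero, zero_mul] at h3
  exact sub_eq_zero.1 (norm_le_zero_iff.1 h3)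

end HypFrame

end ZeroOne

end

noncomputable section

namespace ZeroOne

/-! ### Existence of integral curves of a continuous field -/

/-- The curve `c` solves the equation `c' = V(c)` on `S`, with a uniform rate of approximation. -/
def IsEulerCurve (V : E3 → E3) (c : ℝ → E3) (S : Set ℝ) : Prop :=
  ∀ ε > 0, ∃ δ > 0, ∀ s ∈ S, ∀ t ∈ S, s ≤ t → t - s ≤ δ →
    ‖c t - c s - (t - s) • V (c s)‖ ≤ ε * (t - s)

/-- The points of the explicit Euler scheme with step `h`. -/
def eulerPoint (V : E3 → E3) (h : ℝ) (v : E3) : ℕ → E3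
  | 0 => v
  | j + 1 => eulerPoint V h v j + h • V (eulerPoint V h v j)

lemma norm_eulerPoint_sub_le {V : E3 → E3} {C h : ℝ} (hV : ∀ v, ‖V v‖ ≤ C) (hh : 0 ≤ h) (v : E3)
    (j i : ℕ) : ‖eulerPoint V h v (j + i) - eulerPoint V h v j‖ ≤ C * (i * h) := by
  induction i with
  | zero => simp
  | succ i ih =>
    have : eulerPoint V h v (j + (i + 1)) - eulerPoint V h v j =
        (eulerPoint V h v (j + i) - eulerPoint V h v j) + h • V (eulerPoint V h v (j + i)) := by
      rw [← add_assoc, eulerPoint]; abel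
    rw [this]
    refine (norm_add_le _ _).trans ?_
    rw [norm_smul, Real.norm_eq_abs, abs_of_nonneg hh]
    have := mul_le_mul_of_nonneg_left (hV (eulerPoint V h v (j + i))) hh
    push_cast
    linarith

lemma norm_eulerPoint_sub_sub_le {V : E3 → E3} {C h δ ε : ℝ} (hC : 0 ≤ C)
    (hV : ∀ v, ‖V v‖ ≤ C) (hh : 0 ≤ h) (hδ : ∀ v w, ‖v - w‖ ≤ δ → ‖V v - V w‖ ≤ ε) (v : E3)
    (j i : ℕ) (hi : C * (i * h) ≤ δ) :
    ‖eulerPoint V h v (j + i) - eulerPoint V h v j - (i * h) • V (eulerPoint V h v j)‖ ≤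
      ε * (i * h) := by
  induction i with
  | zero => simp
  | succ i ih =>
    have hi' : C * (i * h) ≤ δ := le_trans (by gcongr; simp) hi
    have : eulerPoint V h v (j + (i + 1)) - eulerPoint V h v j -
        ((i + 1 : ℕ) * h) • V (eulerPoint V h v j) =
        (eulerPoint V h v (j + i) - eulerPoint V h v j - (i * h) • V (eulerPoint V h v j)) +
        h • (V (eulerPoint V h v (j + i)) - V (eulerPoint V h v j)) := by
      rw [← add_assoc, eulerPoint]; push_cast; module
    rw [this]
    refine (norm_add_le _ _).trans ?_
    rw [norm_smul, Real.norm_eq_abs, abs_of_nonneg hh]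
    have h1 := hδ _ _ ((norm_eulerPoint_sub_le hV hh v j i).trans hi')
    have := mul_le_mul_of_nonneg_left h1 hh
    have := ih hi'
    push_cast
    linarith

lemma UniformContinuous.exists_le {V : E3 → E3} (hV : UniformContinuous V) {ε : ℝ} (hε : 0 < ε) :
    ∃ δ > 0, ∀ v w, ‖v - w‖ ≤ δ → ‖V v - V w‖ ≤ ε := by
  obtain ⟨δ, hδ, h⟩ := Metric.uniformContinuous_iff.1 hV ε hε
  refine ⟨δ / 2, by positivity, fun v w hvw => ?_⟩
  have := h (a := v) (b := w) (by rw [dist_eq_norm]; linarith)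
  rw [dist_eq_norm] at this
  exact this.le

lemma exists_limit_of_bounded {ι : Type*} (𝒰 : Ultrafilter ι) {u : ι → E3} {x : E3} {R : ℝ}
    (h : ∀ᶠ n in 𝒰, ‖u n - x‖ ≤ R) : ∃ y, Tendsto u 𝒰 (𝓝 y) := by
  have h1 : ((𝒰.map u : Ultrafilter E3) : Filter E3) ≤ 𝓟 (Metric.closedBall x R) := by
    rw [le_principal_iff]
    change ∀ᶠ n in (𝒰 : Filter ι), u n ∈ Metric.closedBall x R
    filter_upwards [h] with n hn
    simpa [dist_eq_norm] using hn
  obtain ⟨y, -, hy⟩ := (isCompact_closedBall x R).ultrafilter_le_nhds _ h1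
  exact ⟨y, hy⟩

/-- Euler schemes with steps tending to zero are bounded at each time, so a nonprincipal ultrafilter
gives limits at all times at once, without extracting subsequences. The integrated inequality of
`IsEulerCurve` passes to such pointwise limits, as a derivative would not. -/
lemma exists_eulerCurve {V : E3 → E3} (hV : UniformContinuous V) {C : ℝ} (hC : 0 < C)
    (hVC : ∀ v, ‖V v‖ ≤ C) (v : E3) : ∃ c : ℝ → E3, c 0 = v ∧ IsEulerCurve V c (Set.Ici 0) := by
  let h : ℕ → ℝ := fun n => 1 / ((n : ℝ) + 1)
  have hh : ∀ n, 0 < h n := fun n => by positivity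
  let c : ℕ → ℝ → E3 := fun n t => eulerPoint V (h n) v ⌊t / h n⌋₊
  let 𝒰 : Ultrafilter ℕ := hyperfilter ℕ
  have h𝒰 : (𝒰 : Filter ℕ) ≤ atTop := by rw [← Nat.cofinite_eq_atTop]; exact hyperfilter_le_cofinite
  have hh0 : Tendsto h 𝒰 (𝓝 0) := tendsto_one_div_add_atTop_nhds_zero_nat.mono_left h𝒰
  have hlim : ∀ t, ∃ y, Tendsto (fun n => c n t) 𝒰 (𝓝 y) := by
    intro t
    refine exists_limit_of_bounded 𝒰 (x := v) (R := C * |t|) (Eventually.of_forall fun n => ?_)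
    have h1 := norm_eulerPoint_sub_le hVC (hh n).le v 0 ⌊t / h n⌋₊
    rw [zero_add] at h1
    refine h1.trans (mul_le_mul_of_nonneg_left ?_ hC.le)
    rcases le_total 0 t with ht | ht
    · rw [abs_of_nonneg ht, ← le_div_iff₀ (hh n)]
      exact Nat.floor_le (div_nonneg ht (hh n).le)
    · rw [Nat.floor_of_nonpos (div_nonpos_of_nonpos_of_nonneg ht (hh n).le)]
      simp
  choose d hd using hlim
  refine ⟨d, ?_, fun ε hε => ?_⟩
  · refine tendsto_nhds_unique (hd 0) ?_
    have : (fun n => c n 0) = fun _ => v := by ext1 n; simp [c, eulerPoint]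
    rw [this]
    exact tendsto_const_nhds
  obtain ⟨δ, hδ, hVδ⟩ := UniformContinuous.exists_le hV hε
  -- Up to one extra step `h n` separates the grid times, so `t - s` and `h n` each receive half of
  -- the admissible displacement `δ`.
  refine ⟨δ / (2 * C), by positivity, fun s hs t ht hst htδ => ?_⟩
  have hlhs : Tendsto (fun n => ‖c n t - c n s - (t - s) • V (c n s)‖) 𝒰
      (𝓝 ‖d t - d s - (t - s) • V (d s)‖) :=
    (((hd t).sub (hd s)).sub ((((hV.continuous.tendsto _).comp (hd s))).const_smul _)).norm
  have hrhs : Tendsto (fun n => ε * (t - s + h n) + h n * C) 𝒰 (𝓝 (ε * (t - s))) := by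
    have := ((hh0.const_add (t - s)).const_mul ε).add (hh0.mul_const C)
    simpa using this
  have hsmall : ∀ᶠ n in (𝒰 : Filter ℕ), h n < δ / (2 * C) :=
    hh0.eventually (gt_mem_nhds (by positivity))
  refine le_of_tendsto_of_tendsto hlhs hrhs ?_
  filter_upwards [hsmall] with n hn
  have hs0 : 0 ≤ s / h n := div_nonneg hs (hh n).le
  have ht0 : 0 ≤ t / h n := div_nonneg ht (hh n).le
  obtain ⟨i, hi⟩ := Nat.exists_eq_add_of_le
    (Nat.floor_le_floor (div_le_div_of_nonneg_right hst (hh n).le))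
  have e1 := Nat.floor_le hs0
  have e2 := Nat.lt_floor_add_one (s / h n)
  have e3 := Nat.floor_le ht0
  have e4 := Nat.lt_floor_add_one (t / h n)
  rw [hi] at e3 e4
  push_cast at e3 e4
  rw [le_div_iff₀ (hh n)] at e1 e3
  rw [div_lt_iff₀ (hh n)] at e2 e4
  have f1 : i * h n ≤ t - s + h n := by nlinarith
  have f2 : t - s - h n ≤ i * h n := by nlinarith
  have f3 : C * (i * h n) ≤ δ := by
    have : i * h n ≤ δ / (2 * C) + δ / (2 * C) := by linarith
    calc C * (i * h n) ≤ C * (δ / (2 * C) + δ / (2 * C)) := by gcongr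
      _ = δ := by field_simp; ring
  have key := norm_eulerPoint_sub_sub_le hC.le hVC (hh n).le hVδ v ⌊s / h n⌋₊ i f3
  have hct : c n t = eulerPoint V (h n) v (⌊s / h n⌋₊ + i) := by simp only [c]; rw [hi]
  have hcs : c n s = eulerPoint V (h n) v ⌊s / h n⌋₊ := rfl
  rw [← hct, ← hcs] at key
  have hsplit : c n t - c n s - (t - s) • V (c n s) =
      (c n t - c n s - (i * h n) • V (c n s)) + (i * h n - (t - s)) • V (c n s) := by module
  rw [hsplit]
  refine (norm_add_le _ _).trans (add_le_add (key.trans (by gcongr)) ?_)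
  rw [norm_smul, Real.norm_eq_abs]
  refine mul_le_mul (abs_le.2 ⟨by linarith, by linarith⟩) (hVC _) (norm_nonneg _) (hh n).le

lemma IsEulerCurve.hasDerivWithinAt_right {V : E3 → E3} {c : ℝ → E3} {t : ℝ}
    (hc : IsEulerCurve V c (Set.Ici t)) : HasDerivWithinAt c (V (c t)) (Set.Ici t) t := by
  rw [hasDerivWithinAt_iff_isLittleO, Asymptotics.isLittleO_iff]
  intro ε hε
  obtain ⟨δ, hδ, h⟩ := hc ε hε
  rw [eventually_nhdsWithin_iff]
  filter_upwards [Metric.ball_mem_nhds t hδ] with s hs hst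
  rw [Metric.mem_ball, Real.dist_eq] at hs
  rw [Real.norm_eq_abs, abs_of_nonneg (sub_nonneg.2 hst)]
  exact h t Set.self_mem_Ici s hst hst ((le_abs_self _).trans hs.le)

/-- The defining inequality looks forward in time. To the left of `t`, uniform continuity of `V`
allows `V (c s)` to be replaced by `V (c t)`. -/
lemma IsEulerCurve.hasDerivAt {V : E3 → E3} (hV : UniformContinuous V) {C : ℝ} (hC : 0 < C)
    (hVC : ∀ v, ‖V v‖ ≤ C) {c : ℝ → E3} {S : Set ℝ} (hc : IsEulerCurve V c S) {t : ℝ}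
    (ht : S ∈ 𝓝 t) : HasDerivAt c (V (c t)) t := by
  rw [hasDerivAt_iff_isLittleO, Asymptotics.isLittleO_iff]
  intro ε hε
  obtain ⟨δ₀, hδ₀, hVδ⟩ := UniformContinuous.exists_le hV (half_pos hε)
  -- The bound `C` makes `c` Lipschitz with constant `2 * C` at this scale; `ε / 2` is half of the
  -- final error.
  obtain ⟨δ, hδ, h⟩ := hc (min (ε / 2) C) (by positivity)
  filter_upwards [ht, Metric.ball_mem_nhds t hδ,
    Metric.ball_mem_nhds t (show 0 < δ₀ / (2 * C) by positivity)] with s hsS hs hs'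
  rw [Metric.mem_ball, Real.dist_eq] at hs hs'
  have htS := mem_of_mem_nhds ht
  rw [Real.norm_eq_abs]
  rcases le_total t s with hst | hst
  · rw [abs_of_nonneg (sub_nonneg.2 hst)] at hs ⊢
    refine (h t htS s hsS hst hs.le).trans ?_
    have := min_le_left (ε / 2) C
    nlinarith [sub_nonneg.2 hst]
  · rw [abs_of_nonpos (sub_nonpos.2 hst)] at hs hs' ⊢
    have h1 := h s hsS t htS hst (by linarith)
    have h2 : ‖c t - c s‖ ≤ δ₀ := by
      have h3 : ‖c t - c s‖ ≤ ‖c t - c s - (t - s) • V (c s)‖ + ‖(t - s) • V (c s)‖ := by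
        simpa using norm_add_le (c t - c s - (t - s) • V (c s)) ((t - s) • V (c s))
      rw [norm_smul, Real.norm_eq_abs, abs_of_nonneg (sub_nonneg.2 hst)] at h3
      have h4 := mul_le_mul_of_nonneg_left (hVC (c s)) (sub_nonneg.2 hst)
      have h5 := mul_le_mul_of_nonneg_right (min_le_right (ε / 2) C) (sub_nonneg.2 hst)
      have h6 : (t - s) * (2 * C) ≤ δ₀ := by
        rw [lt_div_iff₀ (by positivity)] at hs'; linarith
      linarith
    have h7 := hVδ _ _ h2
    have e : c s - c t - (s - t) • V (c t) =
        -(c t - c s - (t - s) • V (c s)) + (t - s) • (V (c t) - V (c s)) := by module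
    rw [e]
    refine (norm_add_le _ _).trans ?_
    rw [norm_neg, norm_smul, Real.norm_eq_abs, abs_of_nonneg (sub_nonneg.2 hst)]
    have h8 := mul_le_mul_of_nonneg_left h7 (sub_nonneg.2 hst)
    have h9 := mul_le_mul_of_nonneg_right (min_le_left (ε / 2) C) (sub_nonneg.2 hst)
    linarith

/-- Here `δ` does not depend on the curve, so the estimate survives limits of families of integral
curves; continuity of the flow rests on this. -/
lemma isEulerCurve_of_hasDerivAt {V : E3 → E3} (hV : UniformContinuous V) {C : ℝ} (hC : 0 < C)
    (hVC : ∀ v, ‖V v‖ ≤ C) {ε : ℝ} (hε : 0 < ε) :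
    ∃ δ > 0, ∀ c : ℝ → E3, (∀ t, HasDerivAt c (V (c t)) t) → ∀ s t, |t - s| ≤ δ →
      ‖c t - c s - (t - s) • V (c s)‖ ≤ ε * |t - s| := by
  obtain ⟨δ, hδ, hVδ⟩ := UniformContinuous.exists_le hV hε
  refine ⟨δ / C, by positivity, fun c hc s t hst => ?_⟩
  have hlip : ∀ r, ‖c r - c s‖ ≤ C * ‖r - s‖ := fun r =>
    convex_univ.norm_image_sub_le_of_norm_hasDerivWithin_le
      (fun r _ => (hc r).hasDerivWithinAt) (fun r _ => hVC _) (Set.mem_univ s) (Set.mem_univ r)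
  have := (convex_uIcc s t).norm_image_sub_le_of_norm_hasDerivWithin_le
    (f := fun r => c r - (r - s) • V (c s)) (f' := fun r => V (c r) - (1 : ℝ) • V (c s)) (C := ε)
    (fun r _ => ((hc r).sub (((hasDerivAt_id r).sub_const s).smul_const _)).hasDerivWithinAt)
    (fun r hr => ?_) Set.left_mem_uIcc Set.right_mem_uIcc
  · simp only [sub_self, zero_smul, sub_zero, Real.norm_eq_abs] at this
    rwa [sub_right_comm]
  · rw [one_smul]
    refine hVδ _ _ ((hlip r).trans ?_)
    have h1 : |r - s| ≤ |t - s| := Set.abs_sub_left_of_mem_uIcc hr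
    calc C * ‖r - s‖ ≤ C * (δ / C) := by
          rw [Real.norm_eq_abs]
          exact mul_le_mul_of_nonneg_left (h1.trans hst) hC.le
      _ = δ := by field_simp

lemma exists_integralCurve {V : E3 → E3} (hV : UniformContinuous V) {C : ℝ} (hC : 0 < C)
    (hVC : ∀ v, ‖V v‖ ≤ C) (v : E3) :
    ∃ c : ℝ → E3, c 0 = v ∧ ∀ t, HasDerivAt c (V (c t)) t := by
  obtain ⟨c, hc0, hc⟩ := exists_eulerCurve hV hC hVC v
  have hVn : UniformContinuous fun v => -V v := hV.neg
  have hVCn : ∀ v, ‖-V v‖ ≤ C := fun v => by rw [norm_neg]; exact hVC v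
  obtain ⟨d, hd0, hd⟩ := exists_eulerCurve hVn hC hVCn v
  have hdneg : ∀ {t : ℝ} {s : Set ℝ}, HasDerivWithinAt d (-V (d (-t))) s (-t) →
      HasDerivWithinAt (fun t => d (-t)) (V (d (-t))) (Neg.neg ⁻¹' s) t := by
    intro t s h
    have := h.scomp t (hasDerivAt_neg t).hasDerivWithinAt (Set.mapsTo_preimage _ _)
    rw [neg_smul, one_smul, neg_neg] at this
    exact this
  -- Negative times come from a forward curve of `-V` run backwards; at `0` the two one-sided
  -- derivatives agree.
  refine ⟨fun t => if 0 ≤ t then c t else d (-t), by simp [hc0], fun t => ?_⟩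
  rcases lt_trichotomy t 0 with ht | ht | ht
  · have h1 := hd.hasDerivAt hVn hC hVCn (t := -t) (Ici_mem_nhds (by linarith))
    have h2 := hdneg (h1.hasDerivWithinAt (s := Set.univ))
    rw [Set.preimage_univ, hasDerivWithinAt_univ] at h2
    simp only [not_le.2 ht, if_false]
    refine h2.congr_of_eventuallyEq ?_
    filter_upwards [gt_mem_nhds ht] with s hs
    simp [not_le.2 hs]
  · subst ht
    simp only [le_refl, if_true, hc0]
    have h1 := hc.hasDerivWithinAt_right
    rw [hc0] at h1
    have h2 := hd.hasDerivWithinAt_right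
    have h3 := hdneg (t := 0) (s := Set.Ici 0) (by simpa using h2)
    have h4 : Neg.neg ⁻¹' Set.Ici (0 : ℝ) = Set.Iic 0 := by ext; simp
    rw [h4, neg_zero, hd0] at h3
    have h5 : HasDerivWithinAt (fun t => if 0 ≤ t then c t else d (-t)) (V v) (Set.Ici 0) 0 :=
      h1.congr (fun s hs => by simp [Set.mem_Ici.1 hs]) (by simp)
    have h6 : HasDerivWithinAt (fun t => if 0 ≤ t then c t else d (-t)) (V v) (Set.Iic 0) 0 := by
      refine h3.congr (fun s hs => ?_) (by simp [hc0, hd0])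
      rcases eq_or_lt_of_le (Set.mem_Iic.1 hs) with rfl | hs
      · simp [hc0, hd0]
      · simp [not_le.2 hs]
    have := h6.union h5
    rwa [Set.Iic_union_Ici, hasDerivWithinAt_univ] at this
  · have h1 := hc.hasDerivAt hV hC hVC (Ici_mem_nhds ht)
    simp only [ht.le, if_true]
    refine h1.congr_of_eventuallyEq ?_
    filter_upwards [lt_mem_nhds ht] with s hs
    simp [hs.le]

end ZeroOne

end

noncomputable section

namespace ZeroOne

/-! ### The flow along the contracted direction -/

namespace HypFrame

variable {F : E3 → E3} {X : Fin 3 → E3 → E3} {θ : Fin 3 → E3 → E3 →L[ℝ] ℝ} {m : Fin 3 → E3 → ℝ}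

lemma continuous_X (h : HypFrame F X θ m) (i : Fin 3) : Continuous (X i) := (h.uc_X i).continuous

lemma continuous_θ (h : HypFrame F X θ m) (i : Fin 3) : Continuous (θ i) := (h.uc_θ i).continuous

/-- The functional `ℓ`, frozen at `c t₀`, has derivative one along `γ` at `b t₀`, so the inverse
function theorem yields times `s t` with equal values of `ℓ` at `γ (s t)` and `c t`. The cone
argument then makes these points equal, and differentiating gives `s' = a = b'`. -/
lemma eventually_eq_reparam (h : HypFrame F X θ m) {γ c : ℝ → E3} {a b : ℝ → ℝ}
    (hγ : ∀ t, HasDerivAt γ (X 0 (γ t)) t) (hc : ∀ t, HasDerivAt c (a t • X 0 (c t)) t)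
    (ha : Continuous a) (hb : ∀ t, HasDerivAt b (a t) t) {t₀ : ℝ} (h0 : c t₀ = γ (b t₀)) :
    ∀ᶠ t in 𝓝 t₀, c t = γ (b t) := by
  obtain ⟨r, hr, hU⟩ := h.exists_unique_radius
  set s₀ := b t₀ with hs₀
  set ℓ := θ 0 (c t₀) with hℓ
  have hγc : Continuous γ := continuous_iff_continuousAt.2 fun t => (hγ t).continuousAt
  have hcc : Continuous c := continuous_iff_continuousAt.2 fun t => (hc t).continuousAt
  have hψ : ∀ s, HasDerivAt (fun s => ℓ (γ s)) (ℓ (X 0 (γ s))) s := fun s =>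
    ℓ.hasFDerivAt.comp_hasDerivAt s (hγ s)
  have hψc : Continuous fun s => ℓ (X 0 (γ s)) := by
    have := h.continuous_X 0
    fun_prop
  have h1 : ℓ (X 0 (γ s₀)) = 1 := by rw [← h0, hℓ, h.dual]; simp
  have hstrict : HasStrictDerivAt (fun s => ℓ (γ s)) (ℓ (X 0 (γ s₀))) s₀ :=
    hasStrictDerivAt_of_hasDerivAt_of_continuousAt (Eventually.of_forall hψ) hψc.continuousAt
  have hstrict' := hstrict.hasStrictFDerivAt_equiv (by rw [h1]; exact one_ne_zero)
  set e := HasStrictFDerivAt.toOpenPartialHomeomorph _ hstrict' with he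
  have hecoe : ∀ s, e s = ℓ (γ s) := fun s => rfl
  have hes : s₀ ∈ e.source := HasStrictFDerivAt.mem_toOpenPartialHomeomorph_source hstrict'
  set s : ℝ → ℝ := fun t => e.symm (ℓ (c t)) with hs
  have het : ℓ (c t₀) ∈ e.target := by rw [h0]; exact e.map_source hes
  have hst₀ : s t₀ = s₀ := by
    simp only [hs]; rw [h0]; exact e.left_inv hes
  have hnear : ∀ᶠ t in 𝓝 t₀, ℓ (c t) ∈ e.target :=
    (ℓ.continuous.comp hcc).continuousAt.eventually (e.open_target.mem_nhds het)
  have hscont : ContinuousAt s t₀ :=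
    (e.continuousAt_symm het).comp (f := fun t => ℓ (c t)) (ℓ.continuous.comp hcc).continuousAt
  -- One constant has to bound both `|a|` near `t₀` and the speed one of `γ`.
  set A := |a t₀| + 1 with hA
  have hA0 : 0 < A := by positivity
  have hae : ∀ᶠ t in 𝓝 t₀, |a t| < A := ha.abs.continuousAt.eventually (gt_mem_nhds (by linarith))
  obtain ⟨δ, hδ, hδa⟩ := Metric.eventually_nhds_iff.1 hae
  have hA1 : 1 ≤ A := by rw [hA]; linarith [abs_nonneg (a t₀)]
  have hs_small : ∀ᶠ t in 𝓝 t₀, |s t - s₀| < r / A := by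
    have := hscont.tendsto.eventually (Metric.ball_mem_nhds _ (div_pos hr hA0))
    rw [hst₀] at this
    filter_upwards [this] with t ht
    rwa [Real.dist_eq] at ht
  have hpos : ∀ᶠ t in 𝓝 t₀, 0 < ℓ (X 0 (c t)) := by
    have hcont : Continuous fun t => ℓ (X 0 (c t)) := by
      have := h.continuous_X 0
      fun_prop
    refine hcont.continuousAt.eventually (lt_mem_nhds ?_)
    beta_reduce
    rw [h0, h1]; exact one_pos
  have hall : ∀ᶠ t in 𝓝 t₀, c t = γ (s t) ∧ HasDerivAt s (a t) t := by
    filter_upwards [hnear, Metric.ball_mem_nhds t₀ hδ, hs_small,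
      Metric.ball_mem_nhds t₀ (div_pos hr hA0), hpos] with t htn htδ hts htr htp
    rw [Metric.mem_ball, Real.dist_eq] at htδ htr
    have hψs : ℓ (γ (s t)) = ℓ (c t) := e.right_inv htn
    have hcg : c t = γ (s t) := by
      have := hU (fun τ => c (t₀ + τ)) (fun σ => γ (s₀ + σ)) (fun τ => a (t₀ + τ)) (fun _ => 1)
        (t - t₀) (s t - s₀) A (fun τ => by
          have := (hc (t₀ + τ)).scomp τ ((hasDerivAt_id τ).const_add t₀)
          rw [one_smul] at this
          exact this)
        (fun σ => by
          have := (hγ (s₀ + σ)).scomp σ ((hasDerivAt_id σ).const_add s₀)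
          exact this)
        (fun τ hτ => by
          refine (hδa ?_).le
          rw [Real.dist_eq, add_sub_cancel_left]
          have := Set.abs_sub_left_of_mem_uIcc hτ
          simp only [sub_zero] at this
          exact this.trans_lt htδ)
        (fun σ _ => by simpa using hA1)
        (by rw [lt_div_iff₀ hA0] at htr; linarith) (by rw [lt_div_iff₀ hA0] at hts; linarith)
        (by simpa using h0) (by
          simp only [add_zero, add_sub_cancel, map_sub]
          rw [hψs, sub_self])
      simpa using this
    refine ⟨hcg, ?_⟩
    have hd : HasDerivAt e.symm (ℓ (X 0 (γ (s t))))⁻¹ (ℓ (c t)) :=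
      e.hasDerivAt_symm htn (by change ℓ (X 0 (γ (s t))) ≠ 0; rw [← hcg]; exact htp.ne') (hψ (s t))
    have hd2 : HasDerivAt (fun t => ℓ (c t)) (ℓ (a t • X 0 (c t))) t :=
      ℓ.hasFDerivAt.comp_hasDerivAt t (hc t)
    have := hd.comp t hd2
    rw [← hcg, map_smul, smul_eq_mul, mul_left_comm, inv_mul_cancel₀ htp.ne', mul_one] at this
    exact this
  obtain ⟨δ', hδ', hball⟩ := Metric.eventually_nhds_iff_ball.1 hall
  filter_upwards [Metric.ball_mem_nhds t₀ hδ'] with t ht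
  rw [(hball t ht).1]
  congr 1
  have hdiff : ∀ τ ∈ Metric.ball t₀ δ', HasDerivWithinAt (fun τ => s τ - b τ) 0
      (Metric.ball t₀ δ') τ := fun τ hτ => by
    have := ((hball τ hτ).2.sub (hb τ)).hasDerivWithinAt (s := Metric.ball t₀ δ')
    rwa [sub_self] at this
  have := (convex_ball t₀ δ').norm_image_sub_le_of_norm_hasDerivWithin_le (C := 0) hdiff
    (fun τ _ => by simp) (Metric.mem_ball_self hδ') ht
  rw [zero_mul, norm_le_zero_iff, hst₀, ← hs₀, sub_self, sub_zero] at this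
  exact sub_eq_zero.1 this

lemma eq_reparam (h : HypFrame F X θ m) {γ c : ℝ → E3} {a b : ℝ → ℝ}
    (hγ : ∀ t, HasDerivAt γ (X 0 (γ t)) t) (hc : ∀ t, HasDerivAt c (a t • X 0 (c t)) t)
    (ha : Continuous a) (hb : ∀ t, HasDerivAt b (a t) t) {t₀ : ℝ} (h0 : c t₀ = γ (b t₀)) (t : ℝ) :
    c t = γ (b t) := by
  have hγc : Continuous γ := continuous_iff_continuousAt.2 fun t => (hγ t).continuousAt
  have hcc : Continuous c := continuous_iff_continuousAt.2 fun t => (hc t).continuousAt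
  have hbc : Continuous b := continuous_iff_continuousAt.2 fun t => (hb t).continuousAt
  have hcl : IsClopen {t | c t = γ (b t)} :=
    ⟨isClosed_eq hcc (hγc.comp hbc), isOpen_iff_mem_nhds.2 fun t ht =>
      h.eventually_eq_reparam hγ hc ha hb ht⟩
  have := hcl.eq_univ ⟨t₀, h0⟩
  have ht : t ∈ {t | c t = γ (b t)} := by rw [this]; trivial
  exact ht

end HypFrame

/-- `φ` is the global continuous flow of a uniquely integrable field `V`; moreover a curve tangent
to `V` is a reparametrized orbit. -/
structure IsFlow (V : E3 → E3) (φ : ℝ → E3 → E3) : Prop where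
  zero : ∀ v, φ 0 v = v
  hasDerivAt : ∀ v t, HasDerivAt (fun t => φ t v) (V (φ t v)) t
  continuous : Continuous fun p : ℝ × E3 => φ p.1 p.2
  reparam : ∀ (c : ℝ → E3) (a b : ℝ → ℝ), (∀ t, HasDerivAt c (a t • V (c t)) t) → Continuous a →
    (∀ t, HasDerivAt b (a t) t) → ∀ t₀ t, c t = φ (b t - b t₀) (c t₀)

/-- Continuity in the initial point follows from uniqueness: an ultrafilter limit of integral curves
whose starting points tend to `v` is an integral curve from `v`, hence the chosen one. -/
lemma HypFrame.exists_flow {F : E3 → E3} {X : Fin 3 → E3 → E3} {θ : Fin 3 → E3 → E3 →L[ℝ] ℝ}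
    {m : Fin 3 → E3 → ℝ} (h : HypFrame F X θ m) : ∃ φ, IsFlow (X 0) φ := by
  obtain ⟨C, hC0, hC⟩ := h.bound
  have hVC : ∀ v, ‖X 0 v‖ ≤ C := fun v => (hC 0 v).1
  choose c hc0 hc using fun v => exists_integralCurve (h.uc_X 0) hC0 hVC v
  have huniq : ∀ d : ℝ → E3, (∀ t, HasDerivAt d (X 0 (d t)) t) → ∀ t, d t = c (d 0) t := by
    intro d hd t
    exact h.eq_reparam (a := fun _ => 1) (b := id) (hc (d 0)) (fun t => by simpa using hd t)
      continuous_const (fun t => hasDerivAt_id t) (t₀ := 0) (hc0 _).symm t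
  have hlip : ∀ v s t, ‖c v t - c v s‖ ≤ C * |t - s| := fun v s t =>
    convex_univ.norm_image_sub_le_of_norm_hasDerivWithin_le
      (fun r _ => (hc v r).hasDerivWithinAt) (fun r _ => hVC _) (Set.mem_univ s) (Set.mem_univ t)
  have hcont : ∀ t, Continuous fun v => c v t := by
    intro t
    rw [continuous_iff_continuousAt]
    intro v
    rw [continuousAt_iff_ultrafilter]
    intro 𝒢 h𝒢
    have hlim : ∀ t, ∃ y, Tendsto (fun w => c w t) 𝒢 (𝓝 y) := by
      intro t
      refine exists_limit_of_bounded 𝒢 (x := v) (R := C * |t| + 1) ?_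
      filter_upwards [h𝒢 (Metric.ball_mem_nhds v one_pos)] with w hw
      rw [mem_ball_iff_norm] at hw
      have h1 := hlip w 0 t
      rw [hc0, sub_zero] at h1
      have h2 := norm_sub_le_norm_sub_add_norm_sub (c w t) w v
      linarith
    choose d hd using hlim
    have hd0 : d 0 = v := by
      refine tendsto_nhds_unique (hd 0) ?_
      simp only [hc0]
      exact h𝒢
    have hde : IsEulerCurve (X 0) d Set.univ := by
      intro ε hε
      obtain ⟨δ, hδ, hE⟩ := isEulerCurve_of_hasDerivAt (h.uc_X 0) hC0 hVC hε
      refine ⟨δ, hδ, fun s _ t _ hst htδ => ?_⟩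
      have hlhs : Tendsto (fun w => ‖c w t - c w s - (t - s) • X 0 (c w s)‖) 𝒢
          (𝓝 ‖d t - d s - (t - s) • X 0 (d s)‖) :=
        (((hd t).sub (hd s)).sub
          (((((h.uc_X 0).continuous.tendsto _).comp (hd s))).const_smul _)).norm
      refine le_of_tendsto hlhs (Eventually.of_forall fun w => ?_)
      have := hE (c w) (hc w) s t (by rwa [abs_of_nonneg (sub_nonneg.2 hst)])
      rwa [abs_of_nonneg (sub_nonneg.2 hst)] at this
    have hds := huniq d fun t => hde.hasDerivAt (h.uc_X 0) hC0 hVC univ_mem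
    have := hds t
    rw [hd0] at this
    rw [← this]
    exact hd t
  refine ⟨fun t v => c v t, hc0, hc, ?_, ?_⟩
  · rw [continuous_iff_continuousAt]
    rintro ⟨t, v⟩
    rw [Metric.continuousAt_iff]
    intro ε hε
    obtain ⟨δ, hδ, hδc⟩ := Metric.continuousAt_iff.1 (hcont t).continuousAt (ε / 2) (half_pos hε)
    refine ⟨min δ (ε / (2 * C)), by positivity, ?_⟩
    rintro ⟨s, w⟩ hsw
    rw [Prod.dist_eq, max_lt_iff] at hsw
    have h1 := hδc (lt_of_lt_of_le hsw.2 (min_le_left _ _))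
    have h2 := hlip w t s
    have h3 : |s - t| < ε / (2 * C) := by
      rw [← Real.dist_eq]; exact lt_of_lt_of_le hsw.1 (min_le_right _ _)
    rw [lt_div_iff₀ (by positivity)] at h3
    calc dist (c w s) (c v t) ≤ dist (c w s) (c w t) + dist (c w t) (c v t) := dist_triangle _ _ _
      _ < ε / 2 + ε / 2 := by
          rw [dist_eq_norm (c w s)]
          linarith
      _ = ε := by ring
  · intro d a b hd ha hb t₀ t
    exact h.eq_reparam (b := fun t => b t - b t₀) (hc (d t₀)) hd ha
      (fun t => (hb t).sub_const _) (t₀ := t₀) (by simp [hc0]) t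

namespace IsFlow

variable {V : E3 → E3} {φ : ℝ → E3 → E3}

lemma add (hφ : IsFlow V φ) (s t : ℝ) (v : E3) : φ (s + t) v = φ s (φ t v) := by
  have := hφ.reparam (fun r => φ r v) (fun _ => 1) id
    (fun r => by simpa using hφ.hasDerivAt v r) continuous_const (fun r => hasDerivAt_id r) t (s + t)
  simpa using this

lemma neg_apply (hφ : IsFlow V φ) (t : ℝ) (v : E3) : φ (-t) (φ t v) = v := by
  rw [← hφ.add, neg_add_cancel, hφ.zero]

lemma continuous_apply (hφ : IsFlow V φ) (v : E3) : Continuous fun t => φ t v :=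
  hφ.continuous.comp (continuous_id.prodMk continuous_const)

end IsFlow

end ZeroOne

end

noncomputable section

namespace ZeroOne

/-! ### Stable leaves as orbits of a flow on the universal cover -/

/-- A lift `F` of `f` with an invariant unit frame `X` adapted to the splitting, the dual coframe
`θ`, the multipliers `m`, and the flow `φ` along the stable direction. -/
structure StableSetting (f : T3 ≃ₜ T3) (g : RiemMetric) (Es Ec Eu : T3 → Submodule ℝ E3)
    (F : E3 → E3) (X : Fin 3 → E3 → E3) (θ : Fin 3 → E3 → E3 →L[ℝ] ℝ) (m : Fin 3 → E3 → ℝ)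
    (φ : ℝ → E3 → E3) : Prop where
  lift : ∀ v, proj (F v) = f (proj v)
  unitSection : ∀ i, IsUnitSection g (splitting Es Ec Eu i) (X i)
  frame : HypFrame F X θ m
  flow : IsFlow (X 0) φ

lemma IsPartiallyHyperbolic.exists_stableSetting {f : T3 ≃ₜ T3} {g : RiemMetric}
    {Es Ec Eu : T3 → Submodule ℝ E3} (hf : IsPartiallyHyperbolic f g Es Ec Eu) :
    ∃ F X θ m φ, StableSetting f g Es Ec Eu F X θ m φ := by
  obtain ⟨F, hF, hl⟩ := hf.c2
  have hX : ∀ i, ∃ X, IsUnitSection g (splitting Es Ec Eu i) X := by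
    intro i
    fin_cases i
    · exact hf.continuous_s.exists_unitSection g
    · exact hf.continuous_c.exists_unitSection g
    · exact hf.continuous_u.exists_unitSection g
  choose X hX using hX
  have hfr := hf.hypFrame hX (hF.of_le one_le_two) hl
  obtain ⟨φ, hφ⟩ := hfr.exists_flow
  exact ⟨F, X, _, _, φ, hl, hX, hfr, hφ⟩

namespace StableSetting

variable {f : T3 ≃ₜ T3} {g : RiemMetric} {Es Ec Eu : T3 → Submodule ℝ E3} {F : E3 → E3}
  {X : Fin 3 → E3 → E3} {θ : Fin 3 → E3 → E3 →L[ℝ] ℝ} {m : Fin 3 → E3 → ℝ} {φ : ℝ → E3 → E3}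

lemma stableSection (S : StableSetting f g Es Ec Eu F X θ m φ) : IsUnitSection g Es (X 0) :=
  S.unitSection 0

/-- A lattice translation preserves `X 0` up to a constant sign, so it conjugates the flow to itself
up to reversal of time. -/
lemma flow_add_lattice (S : StableSetting f g Es Ec Eu F X θ m φ) {k : E3} (hk : proj k = 0) :
    ∃ σ : ℝ, |σ| = 1 ∧ ∀ t v, φ t (v + k) = φ (σ * t) v + k := by
  obtain ⟨σ, hσ, h⟩ := S.stableSection.exists_sign hk
  refine ⟨σ, hσ, fun t v => ?_⟩
  have := S.flow.reparam (fun t => φ (σ * t) v + k) (fun _ => 1) id (fun t => by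
    have h1 := (S.flow.hasDerivAt v (σ * t)).scomp t ((hasDerivAt_id t).const_mul σ)
    rw [mul_one] at h1
    rw [h, one_smul]
    exact h1.add_const k) continuous_const (fun t => hasDerivAt_id t) 0 t
  simpa [S.flow.zero] using this.symm

lemma leafCurve_eq (S : StableSetting f g Es Ec Eu F X θ m φ) {x y : T3} {c : ℝ → E3}
    (hc : IsLeafCurve Es x y c) : ∃ a : ℝ → ℝ, Continuous a ∧ (∀ t, deriv c t = a t • X 0 (c t)) ∧
      c 1 = φ (∫ t in (0 : ℝ)..1, a t) (c 0) := by
  have hcd : ∀ t, HasDerivAt c (deriv c t) t := fun t =>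
    (hc.contDiff.differentiable one_ne_zero t).hasDerivAt
  have hcc : Continuous (deriv c) := hc.contDiff.continuous_deriv le_rfl
  have hac : Continuous fun t => θ 0 (c t) (deriv c t) :=
    ((S.frame.continuous_θ 0).comp hc.contDiff.continuous).clm_apply hcc
  have hda : ∀ t, deriv c t = θ 0 (c t) (deriv c t) • X 0 (c t) := by
    intro t
    have := hc.tangent t
    rw [S.stableSection.span_eq] at this
    obtain ⟨b, hb⟩ := Submodule.mem_span_singleton.1 this
    rw [← hb, map_smul, S.frame.dual]
    simp
  refine ⟨_, hac, hda, ?_⟩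
  have := S.flow.reparam c (fun t => θ 0 (c t) (deriv c t))
    (fun s => ∫ t in (0 : ℝ)..s, θ 0 (c t) (deriv c t)) (fun t => by rw [← hda]; exact hcd t) hac
    (fun t => hac.integral_hasStrictDerivAt 0 t |>.hasDerivAt) 0 1
  simpa using this

lemma isLeafCurve_flow (S : StableSetting f g Es Ec Eu F X θ m φ) (t : ℝ) (v : E3) :
    IsLeafCurve Es (proj v) (proj (φ t v)) (fun s => φ (t * s) v) ∧
      ∀ s, deriv (fun s => φ (t * s) v) s = t • X 0 (φ (t * s) v) := by
  have hd : ∀ s, HasDerivAt (fun s => φ (t * s) v) (t • X 0 (φ (t * s) v)) s := fun s => by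
    have := (S.flow.hasDerivAt v (t * s)).scomp s ((hasDerivAt_id s).const_mul t)
    rwa [mul_one] at this
  have hd' := fun s => (hd s).deriv
  refine ⟨⟨?_, fun s => ?_, by simp [S.flow.zero], by simp⟩, hd'⟩
  · rw [contDiff_one_iff_deriv]
    refine ⟨fun s => (hd s).differentiableAt, ?_⟩
    rw [funext hd']
    have h1 := S.flow.continuous_apply v
    have h2 := S.frame.continuous_X 0
    fun_prop
  · rw [hd']
    exact Submodule.smul_mem _ _ (S.stableSection.mem _)

lemma proj_flow_mem_leaf (S : StableSetting f g Es Ec Eu F X θ m φ) (t : ℝ) (v : E3) :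
    proj (φ t v) ∈ leaf Es (proj v) :=
  ⟨_, (S.isLeafCurve_flow t v).1⟩

/-- The given lift may start at a lattice translate of `v`. Moving it back can reverse time, so only
the absolute value of the travel time is determined. -/
lemma leafCurve_endpoint (S : StableSetting f g Es Ec Eu F X θ m φ) {v : E3} {y : T3} {c : ℝ → E3}
    (hc : IsLeafCurve Es (proj v) y c) : ∃ (a : ℝ → ℝ) (t : ℝ), Continuous a ∧
      (∀ t, deriv c t = a t • X 0 (c t)) ∧ y = proj (φ t v) ∧ |t| = |∫ t in (0 : ℝ)..1, a t| := by
  obtain ⟨a, ha, hda, h1⟩ := S.leafCurve_eq hc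
  have hk : proj (c 0 - v) = 0 := proj_eq_iff.1 hc.source
  obtain ⟨σ, hσ, h⟩ := S.flow_add_lattice hk
  refine ⟨a, σ * ∫ t in (0 : ℝ)..1, a t, ha, hda, ?_, by rw [abs_mul, hσ, one_mul]⟩
  have := h (∫ t in (0 : ℝ)..1, a t) v
  rw [add_sub_cancel] at this
  rw [← hc.target, h1, this, proj_add_of_lattice _ hk]

lemma mem_leaf_iff (S : StableSetting f g Es Ec Eu F X θ m φ) {v : E3} {y : T3} :
    y ∈ leaf Es (proj v) ↔ ∃ t, y = proj (φ t v) := by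
  constructor
  · rintro ⟨c, hc⟩
    obtain ⟨a, t, -, -, h, -⟩ := S.leafCurve_endpoint hc
    exact ⟨t, h⟩
  · rintro ⟨t, rfl⟩
    exact S.proj_flow_mem_leaf t v

/-! ### Equivariance of the flow and absence of closed leaves -/

/-- The time change relating the flow to its image under the lift. -/
def timeChange (m : Fin 3 → E3 → ℝ) (φ : ℝ → E3 → E3) (v : E3) (t : ℝ) : ℝ :=
  ∫ s in (0 : ℝ)..t, m 0 (φ s v)

lemma hasDerivAt_timeChange (S : StableSetting f g Es Ec Eu F X θ m φ) (v : E3) (t : ℝ) :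
    HasDerivAt (timeChange m φ v) (m 0 (φ t v)) t := by
  have hc : Continuous fun t => m 0 (φ t v) :=
    (S.frame.uc_m 0).continuous.comp (S.flow.continuous_apply v)
  exact (hc.integral_hasStrictDerivAt 0 t).hasDerivAt

lemma lift_flow (S : StableSetting f g Es Ec Eu F X θ m φ) (t : ℝ) (v : E3) :
    F (φ t v) = φ (timeChange m φ v t) (F v) := by
  have hc : Continuous fun t => m 0 (φ t v) :=
    (S.frame.uc_m 0).continuous.comp (S.flow.continuous_apply v)
  have := S.flow.reparam (fun t => F (φ t v)) (fun t => m 0 (φ t v)) (timeChange m φ v)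
    (fun t => by
      have := (S.frame.hasFDerivAt (φ t v)).comp_hasDerivAt t (S.flow.hasDerivAt v t)
      rw [S.frame.fderiv_X] at this
      exact this) hc (S.hasDerivAt_timeChange v) 0 t
  simpa [timeChange, S.flow.zero] using this

/-- Rolle's theorem: the derivative `m 0` never vanishes. -/
lemma timeChange_ne_zero (S : StableSetting f g Es Ec Eu F X θ m φ) {v : E3} {t : ℝ} (ht : t ≠ 0) :
    timeChange m φ v t ≠ 0 := by
  intro h
  have h0 : timeChange m φ v 0 = 0 := by simp [timeChange]
  have hcont : Continuous (timeChange m φ v) := continuous_iff_continuousAt.2 fun t =>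
    (S.hasDerivAt_timeChange v t).continuousAt
  rcases lt_or_gt_of_ne ht with ht | ht
  · obtain ⟨s, -, hs⟩ := exists_hasDerivAt_eq_zero ht hcont.continuousOn (h.trans h0.symm)
      fun s _ => S.hasDerivAt_timeChange v s
    exact S.frame.multiplier_ne_zero _ hs
  · obtain ⟨s, -, hs⟩ := exists_hasDerivAt_eq_zero ht hcont.continuousOn (h0.trans h.symm)
      fun s _ => S.hasDerivAt_timeChange v s
    exact S.frame.multiplier_ne_zero _ hs

lemma continuous_timeChange (S : StableSetting f g Es Ec Eu F X θ m φ) :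
    Continuous fun p : E3 × ℝ => timeChange m φ p.1 p.2 := by
  have hc : Continuous (Function.uncurry fun (v : E3) (s : ℝ) => m 0 (φ s v)) :=
    (S.frame.uc_m 0).continuous.comp (S.flow.continuous.comp continuous_swap)
  exact intervalIntegral.continuous_parametric_primitive_of_continuous hc

lemma exists_iterate_lift_flow (S : StableSetting f g Es Ec Eu F X θ m φ) {r : ℝ}
    (hr : ∀ v, |m 0 v| ≤ r) (n : ℕ) (t : ℝ) (v : E3) :
    ∃ τ, F^[n] (φ t v) = φ τ (F^[n] v) ∧ |τ| ≤ r ^ n * |t| ∧ (t ≠ 0 → τ ≠ 0) := by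
  have hr0 : 0 ≤ r := (abs_nonneg _).trans (hr 0)
  induction n with
  | zero => exact ⟨t, rfl, by simp, id⟩
  | succ n ih =>
    obtain ⟨τ, h1, h2, h3⟩ := ih
    refine ⟨timeChange m φ (F^[n] v) τ, ?_, ?_, fun ht => S.timeChange_ne_zero (h3 ht)⟩
    · rw [Function.iterate_succ_apply', Function.iterate_succ_apply', h1, S.lift_flow]
    · have := intervalIntegral.norm_integral_le_of_norm_le_const (a := 0) (b := τ)
        (f := fun s => m 0 (φ s (F^[n] v))) (C := r) fun s _ => hr _
      rw [sub_zero, Real.norm_eq_abs] at this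
      refine this.trans ?_
      rw [pow_succ', mul_assoc]
      exact mul_le_mul_of_nonneg_left h2 hr0

lemma flow_euler (S : StableSetting f g Es Ec Eu F X θ m φ) {ε : ℝ} (hε : 0 < ε) :
    ∃ δ > 0, ∀ v t, |t| ≤ δ → ‖φ t v - v - t • X 0 v‖ ≤ ε * |t| := by
  obtain ⟨C, hC0, hC⟩ := S.frame.bound
  obtain ⟨δ, hδ, h⟩ := isEulerCurve_of_hasDerivAt (S.frame.uc_X 0) hC0 (fun v => (hC 0 v).1) hε
  refine ⟨δ, hδ, fun v t ht => ?_⟩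
  have := h (fun t => φ t v) (S.flow.hasDerivAt v) 0 t (by simpa using ht)
  simpa [S.flow.zero] using this

/-- Duality with `θ 0` gives `‖X 0‖ ≥ 1 / C`, so a short orbit moves by nearly `t • X 0` and cannot
close. -/
lemma exists_period_bound (S : StableSetting f g Es Ec Eu F X θ m φ) :
    ∃ δ > 0, ∀ v t, |t| ≤ δ → φ t v = v → t = 0 := by
  obtain ⟨C, hC0, hC⟩ := S.frame.bound
  obtain ⟨δ, hδ, h⟩ := S.flow_euler (ε := 1 / (2 * C)) (by positivity)
  refine ⟨δ, hδ, fun v t ht htv => ?_⟩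
  have h1 := h v t ht
  rw [htv, sub_self, zero_sub, norm_neg, norm_smul, Real.norm_eq_abs] at h1
  have h2 : 1 ≤ C * ‖X 0 v‖ := by
    have h3 := (θ 0 v).le_opNorm (X 0 v)
    rw [S.frame.dual, if_pos rfl, norm_one] at h3
    exact h3.trans (mul_le_mul_of_nonneg_right (hC 0 v).2 (norm_nonneg _))
  have h4 : |t| * (C * ‖X 0 v‖) ≤ |t| / 2 := by
    calc |t| * (C * ‖X 0 v‖) = C * (|t| * ‖X 0 v‖) := by ring
      _ ≤ C * (1 / (2 * C) * |t|) := by gcongr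
      _ = |t| / 2 := by field_simp
  have h5 := mul_le_mul_of_nonneg_left h2 (abs_nonneg t)
  have : |t| ≤ 0 := by linarith
  exact abs_eq_zero.1 (le_antisymm this (abs_nonneg _))

lemma proj_iterate_lift (S : StableSetting f g Es Ec Eu F X θ m φ) (n : ℕ) (v : E3) :
    proj (F^[n] v) = f^[n] (proj v) := by
  induction n with
  | zero => rfl
  | succ n ih => rw [Function.iterate_succ_apply', Function.iterate_succ_apply', S.lift, ih]

/-- No stable leaf is closed. Iterating `F` shrinks the period without annihilating it; once the
orbit is shorter than one, closing on the torus means closing in `ℝ³`, which short orbits cannot do.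
-/
lemma eq_zero_of_proj_flow_eq (S : StableSetting f g Es Ec Eu F X θ m φ) {v : E3} {t : ℝ}
    (h : proj (φ t v) = proj v) : t = 0 := by
  obtain ⟨δ, hδ, hper⟩ := S.exists_period_bound
  obtain ⟨δ', hδ', hE⟩ := S.flow_euler (ε := 1) one_pos
  obtain ⟨C, hC0, hC⟩ := S.frame.bound
  obtain ⟨r, hr0, hr1, hr⟩ := S.frame.contraction
  have hlim : Tendsto (fun n : ℕ => r ^ n * |t|) atTop (𝓝 0) := by
    simpa using (tendsto_pow_atTop_nhds_zero_of_lt_one hr0.le hr1).mul_const |t|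
  obtain ⟨n, hn⟩ := (hlim.eventually (gt_mem_nhds
    (show 0 < min (min δ δ') (1 / (1 + C)) by positivity))).exists
  obtain ⟨τ, h1, h2, h3⟩ := S.exists_iterate_lift_flow hr n t v
  have hτ := h2.trans_lt hn
  rw [lt_min_iff, lt_min_iff] at hτ
  by_contra ht
  refine h3 ht (hper (F^[n] v) τ hτ.1.1.le ?_)
  refine sub_eq_zero.1 (eq_zero_of_proj_eq_zero ?_ ?_)
  · rw [← h1, proj_sub, S.proj_iterate_lift, S.proj_iterate_lift, h, sub_self]
  · have h4 := hE (F^[n] v) τ hτ.1.2.le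
    have h5 : ‖φ τ (F^[n] v) - F^[n] v‖ ≤ ‖φ τ (F^[n] v) - F^[n] v - τ • X 0 (F^[n] v)‖ +
        ‖τ • X 0 (F^[n] v)‖ := by
      simpa using norm_add_le (φ τ (F^[n] v) - F^[n] v - τ • X 0 (F^[n] v)) (τ • X 0 (F^[n] v))
    rw [norm_smul, Real.norm_eq_abs] at h5
    have h6 := mul_le_mul_of_nonneg_left (hC 0 (F^[n] v)).1 (abs_nonneg τ)
    have h7 := hτ.2
    rw [lt_div_iff₀ (by positivity)] at h7
    nlinarith

lemma proj_flow_injective (S : StableSetting f g Es Ec Eu F X θ m φ) {v : E3} {s t : ℝ}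
    (h : proj (φ s v) = proj (φ t v)) : s = t := by
  have h1 : φ s v = φ (s - t) (φ t v) := by rw [← S.flow.add, sub_add_cancel]
  rw [h1] at h
  exact sub_eq_zero.1 (S.eq_zero_of_proj_flow_eq h)

/-- Leaves are injectively parametrized, so every leaf curve between these points has signed travel
time `± t`, and its length is the integral of the absolute speed. -/
lemma leafDist_eq (S : StableSetting f g Es Ec Eu F X θ m φ) (v : E3) (t : ℝ) :
    leafDist g Es (proj v) (proj (φ t v)) = |t| := by
  have hlen : ∀ (c : ℝ → E3) (a : ℝ → ℝ), (∀ t, deriv c t = a t • X 0 (c t)) →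
      curveLength g c = ∫ t in (0 : ℝ)..1, |a t| := by
    intro c a h
    unfold curveLength
    refine intervalIntegral.integral_congr fun t _ => ?_
    beta_reduce
    rw [h, g.norm_smul, S.stableSection.norm_eq_one, mul_one]
  refine IsLeast.csInf_eq ⟨⟨_, (S.isLeafCurve_flow t v).1, ?_⟩, ?_⟩
  · rw [hlen _ (fun _ => t) (S.isLeafCurve_flow t v).2]
    simp
  · rintro _ ⟨c, hc, rfl⟩
    obtain ⟨a, t', ha, hda, h1, h2⟩ := S.leafCurve_endpoint hc
    rw [S.proj_flow_injective h1, h2, hlen c a hda]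
    exact intervalIntegral.abs_integral_le_integral_abs zero_le_one

end StableSetting

end ZeroOne

end

/-! ### Discs transverse to the stable flow and their holonomies -/

noncomputable section

open Asymptotics

namespace ZeroOne

/-- The disc of the family `D` through `proj v`, lifted so that its center is `v`. -/
def discAt (D : T3 → E2 → E3) (v : E3) (p : E2) : E3 := D (proj v) p + (v - D (proj v) 0)

lemma discAt_zero (D : T3 → E2 → E3) (v : E3) : discAt D v 0 = v := by
  simp [discAt]

/-- The projection along the first vector of the frame. -/
def transProj (X : Fin 3 → E3 → E3) (θ : Fin 3 → E3 → E3 →L[ℝ] ℝ) (v : E3) : E3 →L[ℝ] E3 :=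
  ContinuousLinearMap.id ℝ E3 - (θ 0 v).smulRight (X 0 v)

lemma transProj_apply (X : Fin 3 → E3 → E3) (θ : Fin 3 → E3 → E3 →L[ℝ] ℝ) (v u : E3) :
    transProj X θ v u = u - θ 0 v u • X 0 v := rfl

/-- `A` is the transverse derivative at `v` of the flow at time `T`: up to the direction of the flow
and to first order, `v + u` is carried to `φ T v + A u`. -/
def IsTransDeriv (X : Fin 3 → E3 → E3) (θ : Fin 3 → E3 → E3 →L[ℝ] ℝ) (φ : ℝ → E3 → E3) (v : E3)
    (T : ℝ) (A : E3 →L[ℝ] E3) : Prop :=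
  (fun q : E3 × ℝ => transProj X θ (φ T v) (φ q.2 (v + q.1) - φ T v) - A q.1) =o[𝓝 (0, T)]
    fun q => ‖q.1‖ + ‖φ q.2 (v + q.1) - φ T v‖

section Disc

variable {Ec Eu : T3 → Submodule ℝ E3} {D : T3 → E2 → E3}

/-- The derivative at the center of a disc of the family. -/
abbrev discDeriv (D : T3 → E2 → E3) (v : E3) : E2 →L[ℝ] E3 := fderiv ℝ (D (proj v)) 0

lemma IsDiscFamily.hasStrictFDerivAt (hD : IsDiscFamily Ec Eu D) (v : E3) :
    HasStrictFDerivAt (discAt D v) (discDeriv D v) 0 :=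
  ((hD.contDiffAt (proj v)).hasStrictFDerivAt one_ne_zero).add_const _

lemma IsDiscFamily.proj_discAt (hD : IsDiscFamily Ec Eu D) (v : E3) (p : E2) :
    proj (discAt D v p) = proj (D (proj v) p) := by
  rw [discAt, proj_add_of_lattice]
  rw [proj_sub, hD.center, sub_self]

end Disc

namespace StableSetting

variable {f : T3 ≃ₜ T3} {g : RiemMetric} {Es Ec Eu : T3 → Submodule ℝ E3} {F : E3 → E3}
  {X : Fin 3 → E3 → E3} {θ : Fin 3 → E3 → E3 →L[ℝ] ℝ} {m : Fin 3 → E3 → ℝ} {φ : ℝ → E3 → E3}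
  {D : T3 → E2 → E3}

/-! ### Holonomies as sections of the flow -/

/-- Leafwise distance gives only the absolute value of the time, and the torus gives the lifted
endpoint only modulo the lattice. Continuity of the holonomy, with the absence of closed leaves,
settles the sign; discreteness of the lattice settles the lift. -/
lemma exists_holonomy_time (S : StableSetting f g Es Ec Eu F X θ m φ) (hD : IsDiscFamily Ec Eu D)
    {v : E3} {T : ℝ} {h : E2 → E2}
    (hh : IsHolonomy g Es (D (proj v)) (D (proj (φ T v))) h) :
    ∃ τ : E2 → ℝ, Tendsto τ (𝓝 0) (𝓝 T) ∧
      ∀ᶠ p in 𝓝 0, discAt D (φ T v) (h p) = φ (τ p) (discAt D v p) := by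
  have h1 : ∀ p, ∃ t, proj (D (proj (φ T v)) (h p)) ∈ leaf Es (proj (D (proj v) p)) →
      proj (discAt D (φ T v) (h p)) = proj (φ t (discAt D v p)) := by
    intro p
    by_cases hp : proj (D (proj (φ T v)) (h p)) ∈ leaf Es (proj (D (proj v) p))
    · rw [← hD.proj_discAt v] at hp
      obtain ⟨t, ht⟩ := S.mem_leaf_iff.1 hp
      exact ⟨t, fun _ => by rw [hD.proj_discAt, ht]⟩
    · exact ⟨0, fun h => absurd h hp⟩
  choose τ hτ using h1
  have hτ' : ∀ᶠ p in 𝓝 (0 : E2), proj (discAt D (φ T v) (h p)) = proj (φ (τ p) (discAt D v p)) := by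
    filter_upwards [hh.mem_leaf] with p hp using hτ p hp
  have habs : Tendsto (fun p => |τ p|) (𝓝 0) (𝓝 |T|) := by
    have h2 := hh.dist_tendsto
    have h3 : leafDist g Es (proj (D (proj v) 0)) (proj (D (proj (φ T v)) 0)) = |T| := by
      rw [hD.center, hD.center, S.leafDist_eq]
    rw [h3] at h2
    refine h2.congr' ?_
    filter_upwards [hτ'] with p hp
    rw [← hD.proj_discAt v, ← hD.proj_discAt (φ T v), hp, S.leafDist_eq]
  have hcv : Tendsto (discAt D v) (𝓝 0) (𝓝 v) := by
    have := (hD.hasStrictFDerivAt v).continuousAt.tendsto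
    rwa [discAt_zero] at this
  have hcw : Tendsto (fun p => discAt D (φ T v) (h p)) (𝓝 0) (𝓝 (φ T v)) := by
    have h2 := (hD.hasStrictFDerivAt (φ T v)).continuousAt.tendsto
    have h3 := hh.continuousAt.tendsto
    rw [hh.map_zero] at h3
    rw [discAt_zero] at h2
    exact h2.comp h3
  have hφ : ∀ s, ∀ 𝒢 : Filter E2, 𝒢 ≤ 𝓝 0 → Tendsto τ 𝒢 (𝓝 s) →
      Tendsto (fun p => φ (τ p) (discAt D v p)) 𝒢 (𝓝 (φ s v)) := fun s 𝒢 h𝒢 hs =>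
    (S.flow.continuous.tendsto (s, v)).comp (hs.prodMk_nhds (hcv.mono_left h𝒢))
  have hkey : ∀ s, ∀ 𝒢 : Filter E2, 𝒢.NeBot → 𝒢 ≤ 𝓝 0 → Tendsto τ 𝒢 (𝓝 s) → s = T := by
    intro s 𝒢 hne h𝒢 hs
    have e1 := (continuous_proj.tendsto _).comp (hφ s 𝒢 h𝒢 hs)
    have e2 := ((continuous_proj.tendsto _).comp hcw).mono_left h𝒢
    have e3 := tendsto_nhds_unique_of_eventuallyEq e2 e1 (hτ'.filter_mono h𝒢)
    exact (S.proj_flow_injective e3).symm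
  -- Since `|τ|` tends to `|T|`, an ultrafilter deciding the sign of `τ` leaves one candidate limit,
  -- which `hkey` identifies with `T`.
  have hτT : Tendsto τ (𝓝 0) (𝓝 T) := by
    rw [tendsto_iff_ultrafilter]
    intro 𝒢 h𝒢
    have hab := habs.mono_left h𝒢
    rcases 𝒢.em fun p => 0 ≤ τ p with hp | hp
    · have : Tendsto τ 𝒢 (𝓝 |T|) :=
        hab.congr' (by filter_upwards [hp] with p hp using abs_of_nonneg hp)
      rwa [hkey _ _ inferInstance h𝒢 this] at this
    · have : Tendsto τ 𝒢 (𝓝 (-|T|)) := hab.neg.congr' (by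
        filter_upwards [hp] with p hp
        rw [abs_of_neg (not_le.1 hp), neg_neg])
      rwa [hkey _ _ inferInstance h𝒢 this] at this
  refine ⟨τ, hτT, ?_⟩
  have hdiff := hcw.sub (hφ T _ le_rfl hτT)
  rw [sub_self] at hdiff
  filter_upwards [hτ', hdiff.eventually (Metric.ball_mem_nhds 0 one_pos)] with p hp hp1
  refine sub_eq_zero.1 (eq_zero_of_proj_eq_zero (by rw [proj_sub, hp, sub_self]) ?_)
  simpa using hp1

/-! ### Local geometry of discs -/

lemma coframe_zero_eq_zero (S : StableSetting f g Es Ec Eu F X θ m φ) {v u : E3}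
    (hu : u ∈ Ec (proj v) ⊔ Eu (proj v)) : θ 0 v u = 0 := by
  have h1 : Ec (proj v) = Submodule.span ℝ {X 1 v} := (S.unitSection 1).span_eq v
  have h2 : Eu (proj v) = Submodule.span ℝ {X 2 v} := (S.unitSection 2).span_eq v
  rw [h1, h2] at hu
  obtain ⟨a, ha, b, hb, rfl⟩ := Submodule.mem_sup.1 hu
  obtain ⟨c, rfl⟩ := Submodule.mem_span_singleton.1 ha
  obtain ⟨d, rfl⟩ := Submodule.mem_span_singleton.1 hb
  rw [map_add, map_smul, map_smul, S.frame.dual, S.frame.dual]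
  simp

lemma coframe_discDeriv (S : StableSetting f g Es Ec Eu F X θ m φ) (hD : IsDiscFamily Ec Eu D)
    (v : E3) (p : E2) : θ 0 v (discDeriv D v p) = 0 :=
  S.coframe_zero_eq_zero ((hD.tangent (proj v)).le ⟨p, rfl⟩)

lemma exists_discDeriv_eq (S : StableSetting f g Es Ec Eu F X θ m φ) (hD : IsDiscFamily Ec Eu D)
    (v : E3) {i : Fin 3} (hi : i ≠ 0) : ∃ p, discDeriv D v p = X i v := by
  have : X i v ∈ LinearMap.range (discDeriv D v).toLinearMap := by
    rw [hD.tangent]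
    fin_cases i
    · exact absurd rfl hi
    · exact Submodule.mem_sup_left ((S.unitSection 1).mem v)
    · exact Submodule.mem_sup_right ((S.unitSection 2).mem v)
  exact this

/-- The image contains `X 1 v` and `X 2 v`, so following the derivative by `(θ 1, θ 2)` gives a
surjection of a plane onto a plane. -/
lemma discDeriv_injective (S : StableSetting f g Es Ec Eu F X θ m φ) (hD : IsDiscFamily Ec Eu D)
    (v : E3) : Function.Injective (discDeriv D v) := by
  let K : E3 →ₗ[ℝ] E2 := (WithLp.linearEquiv 2 ℝ (Fin 2 → ℝ)).symm.toLinearMap.comp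
    (LinearMap.pi ![(θ 1 v).toLinearMap, (θ 2 v).toLinearMap])
  have hK0 : ∀ u, K u 0 = θ 1 v u := fun u => rfl
  have hK1 : ∀ u, K u 1 = θ 2 v u := fun u => rfl
  have hs : Function.Surjective (K.comp (discDeriv D v).toLinearMap) := by
    intro y
    obtain ⟨p₁, h₁⟩ := S.exists_discDeriv_eq hD v (i := 1) (by decide)
    obtain ⟨p₂, h₂⟩ := S.exists_discDeriv_eq hD v (i := 2) (by decide)
    refine ⟨y 0 • p₁ + y 1 • p₂, ?_⟩
    have e : (K.comp (discDeriv D v).toLinearMap) (y 0 • p₁ + y 1 • p₂) =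
        K (y 0 • X 1 v + y 1 • X 2 v) := by
      rw [← h₁, ← h₂]; simp
    rw [e]
    ext i
    fin_cases i
    · change K _ 0 = y 0
      rw [hK0, map_add, map_smul, map_smul, S.frame.dual, S.frame.dual]; simp
    · change K _ 1 = y 1
      rw [hK1, map_add, map_smul, map_smul, S.frame.dual, S.frame.dual]; simp
  have hi := LinearMap.injective_iff_surjective.2 hs
  exact Function.Injective.of_comp (f := K) hi

lemma flow_isLittleO (S : StableSetting f g Es Ec Eu F X θ m φ) (v : E3) :
    (fun q : E3 × ℝ => φ q.2 q.1 - q.1 - q.2 • X 0 v) =o[𝓝 (v, 0)] fun q => q.2 := by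
  rw [isLittleO_iff]
  intro ε hε
  obtain ⟨δ, hδ, h⟩ := S.flow_euler (half_pos hε)
  have hX : ∀ᶠ w in 𝓝 v, ‖X 0 w - X 0 v‖ < ε / 2 := by
    have := (S.frame.continuous_X 0).continuousAt (x := v)
    filter_upwards [this.eventually (Metric.ball_mem_nhds _ (half_pos hε))] with w hw
    rwa [← dist_eq_norm]
  have h1 : ∀ᶠ q : E3 × ℝ in 𝓝 (v, 0), ‖X 0 q.1 - X 0 v‖ < ε / 2 :=
    (continuous_fst.tendsto (v, (0 : ℝ))).eventually hX
  have h2 : ∀ᶠ q : E3 × ℝ in 𝓝 (v, 0), q.2 ∈ Metric.ball (0 : ℝ) δ :=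
    (continuous_snd.tendsto (v, (0 : ℝ))).eventually (Metric.ball_mem_nhds _ hδ)
  filter_upwards [h1, h2] with q hq1 hq2
  rw [Metric.mem_ball, Real.dist_eq, sub_zero] at hq2
  have e : φ q.2 q.1 - q.1 - q.2 • X 0 v =
      (φ q.2 q.1 - q.1 - q.2 • X 0 q.1) + q.2 • (X 0 q.1 - X 0 v) := by module
  rw [e]
  refine (norm_add_le _ _).trans ?_
  rw [norm_smul, Real.norm_eq_abs]
  have h3 := h q.1 q.2 hq2.le
  have h4 := mul_le_mul_of_nonneg_left hq1.le (abs_nonneg q.2)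
  linarith

lemma exists_norm_flow_sub_le (S : StableSetting f g Es Ec Eu F X θ m φ) :
    ∃ C > 0, ∀ t v, ‖φ t v - v‖ ≤ C * |t| := by
  obtain ⟨C, hC0, hC⟩ := S.frame.bound
  refine ⟨C, hC0, fun t v => ?_⟩
  have := convex_univ.norm_image_sub_le_of_norm_hasDerivWithin_le
    (fun r _ => (S.flow.hasDerivAt v r).hasDerivWithinAt) (fun r _ => (hC 0 _).1)
    (Set.mem_univ 0) (Set.mem_univ t)
  simpa [S.flow.zero] using this

/-- A chart of `ℝ³` adapted to a disc transverse to the flow. -/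
lemma exists_disc_chart (S : StableSetting f g Es Ec Eu F X θ m φ) {v : E3} {α : E2 → E3}
    {L : E2 →L[ℝ] E3} (hα : HasStrictFDerivAt α L 0) (hα0 : α 0 = v)
    (hL : Function.Injective L) (hθ : ∀ p, θ 0 v (L p) = 0) :
    ∃ (J : E3 →L[ℝ] E2) (Ψ₁ : E3 → E2) (Ψ₂ : E3 → ℝ) (δ : ℝ), (∀ q, J (L q) = q) ∧
      J (X 0 v) = 0 ∧ 0 < δ ∧ ContinuousOn Ψ₂ (Metric.ball v δ) ∧
      (∀ z ∈ Metric.ball v δ, Ψ₂ z = 0 → α (Ψ₁ z) = z) ∧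
      (fun z => Ψ₁ z - J (z - v)) =o[𝓝 v] (fun z => z - v) ∧
      (fun z => Ψ₂ z - θ 0 v (z - v)) =o[𝓝 v] (fun z => z - v) := by
  have hθX : θ 0 v (X 0 v) = 1 := by rw [S.frame.dual]; simp
  let M : E2 × ℝ →L[ℝ] E3 := L.coprod (ContinuousLinearMap.toSpanSingleton ℝ (X 0 v))
  have hM : ∀ q, M q = L q.1 + q.2 • X 0 v := fun q => by
    simp [M]
  have hMi : Function.Injective M.toLinearMap := by
    rw [← LinearMap.ker_eq_bot, LinearMap.ker_eq_bot']
    intro q hq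
    change M q = 0 at hq
    rw [hM] at hq
    have h2 : q.2 = 0 := by
      have := congrArg (θ 0 v) hq
      rw [map_add, map_smul, hθ, hθX, map_zero] at this
      simpa using this
    rw [h2, zero_smul, add_zero] at hq
    exact Prod.ext (hL (by simpa using hq)) h2
  let e : (E2 × ℝ) ≃L[ℝ] E3 :=
    (LinearEquiv.ofInjectiveOfFinrankEq M.toLinearMap hMi (by simp)).toContinuousLinearEquiv
  have heM : ∀ q, e q = L q.1 + q.2 • X 0 v := fun q => hM q
  have heM' : (e : (E2 × ℝ) →L[ℝ] E3) = M := ContinuousLinearMap.ext fun q => rfl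
  clear_value e
  have hsnd : ∀ u, (e.symm u).2 = θ 0 v u := by
    intro u
    conv_rhs => rw [← e.apply_symm_apply u, heM, map_add, map_smul, hθ, hθX]
    simp
  let J : E3 →L[ℝ] E2 := (ContinuousLinearMap.fst ℝ E2 ℝ).comp (e.symm : E3 →L[ℝ] E2 × ℝ)
  have hJ : ∀ u, J u = (e.symm u).1 := fun u => rfl
  have hJL : ∀ q, J (L q) = q := fun q => by
    rw [hJ]
    have : e.symm (L q) = (q, 0) := by rw [ContinuousLinearEquiv.symm_apply_eq, heM]; simp
    rw [this]
  have hJX : J (X 0 v) = 0 := by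
    rw [hJ]
    have : e.symm (X 0 v) = (0, 1) := by rw [ContinuousLinearEquiv.symm_apply_eq, heM]; simp
    rw [this]
  -- The disc is thickened linearly in the flow direction; the chart is the local inverse, and its
  -- second coordinate vanishes on the disc.
  let Φ : E2 × ℝ → E3 := fun q => α q.1 + q.2 • X 0 v
  have hΦ0 : Φ 0 = v := by simp [Φ, hα0]
  have hΦ : HasStrictFDerivAt Φ (e : (E2 × ℝ) →L[ℝ] E3) 0 := by
    rw [heM']
    have h1 : HasStrictFDerivAt (fun q : E2 × ℝ => α q.1)
        (L.comp (ContinuousLinearMap.fst ℝ E2 ℝ)) 0 :=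
      HasStrictFDerivAt.comp (f := Prod.fst) (0 : E2 × ℝ) hα hasStrictFDerivAt_fst
    have h2 : HasStrictFDerivAt (fun q : E2 × ℝ => q.2 • X 0 v)
        ((ContinuousLinearMap.toSpanSingleton ℝ (X 0 v)).comp (ContinuousLinearMap.snd ℝ E2 ℝ)) 0 :=
      ((ContinuousLinearMap.toSpanSingleton ℝ (X 0 v)).comp
        (ContinuousLinearMap.snd ℝ E2 ℝ)).hasStrictFDerivAt
    exact h1.add h2
  obtain ⟨H, hHsymm, hHv, hHr⟩ : ∃ H : OpenPartialHomeomorph (E2 × ℝ) E3,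
      (H.symm : E3 → E2 × ℝ) = hΦ.localInverse Φ e 0 ∧ v ∈ H.target ∧
      ∀ z ∈ H.target, Φ (H.symm z) = z := by
    refine ⟨HasStrictFDerivAt.toOpenPartialHomeomorph Φ hΦ, rfl, ?_, fun z hz => ?_⟩
    · have := HasStrictFDerivAt.image_mem_toOpenPartialHomeomorph_target hΦ
      rwa [hΦ0] at this
    · exact (HasStrictFDerivAt.toOpenPartialHomeomorph Φ hΦ).right_inv hz
  have hΨo : (fun z => H.symm z - e.symm (z - v)) =o[𝓝 v] fun z => z - v := by
    have h1 := hΦ.to_localInverse.hasFDerivAt.isLittleO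
    rw [← hHsymm, hΦ0] at h1
    have h2 : H.symm v = 0 := by
      have := hΦ.localInverse_apply_image
      rwa [hΦ0, ← hHsymm] at this
    simpa [h2] using h1
  obtain ⟨δ, hδ, hball⟩ := Metric.isOpen_iff.1 H.open_target v hHv
  refine ⟨J, fun z => (H.symm z).1, fun z => (H.symm z).2, δ, hJL, hJX, hδ, ?_, ?_, ?_, ?_⟩
  · exact continuous_snd.comp_continuousOn (H.continuousOn_symm.mono hball)
  · intro z hz h0
    have := hHr z (hball hz)
    simp only [Φ] at this
    beta_reduce at h0 ⊢
    rwa [h0, zero_smul, add_zero] at this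
  · refine IsBigO.trans_isLittleO (IsBigO.of_bound 1 (Eventually.of_forall fun z => ?_)) hΨo
    rw [one_mul]
    exact norm_fst_le (H.symm z - e.symm (z - v))
  · refine IsBigO.trans_isLittleO (IsBigO.of_bound 1 (Eventually.of_forall fun z => ?_)) hΨo
    rw [one_mul, ← hsnd]
    exact norm_snd_le (H.symm z - e.symm (z - v))

/-- Flow lines starting near a transverse level set of `Ψ` meet it, after a time controlled by the
distance to the center. -/
lemma exists_hitting_time (S : StableSetting f g Es Ec Eu F X θ m φ) {v : E3} {Ψ : E3 → ℝ} {δ₀ : ℝ}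
    (hδ₀ : 0 < δ₀) (hΨc : ContinuousOn Ψ (Metric.ball v δ₀))
    (hΨo : (fun z => Ψ z - θ 0 v (z - v)) =o[𝓝 v] (fun z => z - v)) :
    ∃ K > 0, ∀ᶠ u in 𝓝 (0 : E3), ∃ a : ℝ, |a| ≤ K * ‖u‖ ∧
      φ (-a) (v + u) ∈ Metric.ball v δ₀ ∧ Ψ (φ (-a) (v + u)) = 0 := by
  have hθX : θ 0 v (X 0 v) = 1 := by rw [S.frame.dual]; simp
  obtain ⟨C, hC0, hC⟩ := S.exists_norm_flow_sub_le
  set B := ‖θ 0 v‖ with hB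
  have hB0 : 0 ≤ B := norm_nonneg _
  -- For `|a| ≤ K * ‖u‖` the value of `Ψ` after time `-a` is `θ 0 v u - a` up to `‖u‖ / 2`, and `|θ
  -- 0 v u| ≤ B * ‖u‖`. With this `K` the values at the two ends have opposite signs.
  set K := B + 1 with hK
  have hK0 : 0 < K := by positivity
  have hmul : ∀ u (a : ℝ), |a| ≤ K * ‖u‖ → ‖φ (-a) (v + u) - v‖ ≤ (1 + C * K) * ‖u‖ := by
    intro u a ha
    have h1 := hC (-a) (v + u)
    have h2 := norm_sub_le_norm_sub_add_norm_sub (φ (-a) (v + u)) (v + u) v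
    rw [add_sub_cancel_left] at h2
    rw [abs_neg] at h1
    nlinarith
  have hε1 : 0 < 1 / (4 * (1 + C * K)) := by positivity
  obtain ⟨δ₁, hδ₁, hΨδ⟩ := Metric.eventually_nhds_iff.1 (isLittleO_iff.1 hΨo hε1)
  have hε2 : 0 < 1 / (4 * K * K) := by positivity
  obtain ⟨δ₂, hδ₂, hflow⟩ := Metric.eventually_nhds_iff.1
    (isLittleO_iff.1 (S.flow_isLittleO v) hε2)
  refine ⟨K, hK0, ?_⟩
  have hρ : 0 < min (min δ₀ δ₁) δ₂ / (1 + C * K + K) := by positivity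
  filter_upwards [Metric.ball_mem_nhds 0 hρ] with u hu
  rw [mem_ball_zero_iff, lt_div_iff₀ (by positivity)] at hu
  have hm0 : min (min δ₀ δ₁) δ₂ ≤ δ₀ := (min_le_left _ _).trans (min_le_left _ _)
  have hm1 : min (min δ₀ δ₁) δ₂ ≤ δ₁ := (min_le_left _ _).trans (min_le_right _ _)
  have hm2 : min (min δ₀ δ₁) δ₂ ≤ δ₂ := min_le_right _ _
  have hu0 := norm_nonneg u
  have hKu : 0 ≤ K * ‖u‖ := by positivity
  have hCKu : 0 ≤ C * K * ‖u‖ := by positivity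
  have hsmall : ∀ a, |a| ≤ K * ‖u‖ → ‖φ (-a) (v + u) - v‖ < min (min δ₀ δ₁) δ₂ := by
    intro a ha
    have := hmul u a ha
    nlinarith
  have htar : ∀ a, |a| ≤ K * ‖u‖ → φ (-a) (v + u) ∈ Metric.ball v δ₀ := fun a ha => by
    rw [mem_ball_iff_norm]; linarith [hsmall a ha]
  have hest : ∀ a, |a| ≤ K * ‖u‖ → |Ψ (φ (-a) (v + u)) - (θ 0 v u - a)| ≤ ‖u‖ / 2 := by
    intro a ha
    have h1 := hΨδ (y := φ (-a) (v + u)) (by rw [dist_eq_norm]; linarith [hsmall a ha])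
    have h2 : |Ψ (φ (-a) (v + u)) - θ 0 v (φ (-a) (v + u) - v)| ≤ ‖u‖ / 4 := by
      rw [Real.norm_eq_abs] at h1
      refine h1.trans ?_
      calc 1 / (4 * (1 + C * K)) * ‖φ (-a) (v + u) - v‖
          ≤ 1 / (4 * (1 + C * K)) * ((1 + C * K) * ‖u‖) := by gcongr; exact hmul u a ha
        _ = ‖u‖ / 4 := by field_simp
    have h4 := hflow (y := (v + u, -a)) (by
      rw [Prod.dist_eq, max_lt_iff, dist_eq_norm, dist_eq_norm]
      simp only [add_sub_cancel_left, sub_zero, norm_neg, Real.norm_eq_abs]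
      constructor <;> nlinarith)
    simp only [norm_neg, Real.norm_eq_abs] at h4
    have h5 : |θ 0 v (φ (-a) (v + u) - v) - (θ 0 v u - a)| ≤ ‖u‖ / 4 := by
      have e1 : θ 0 v (φ (-a) (v + u) - v) - (θ 0 v u - a) =
          θ 0 v (φ (-a) (v + u) - (v + u) - (-a) • X 0 v) := by
        simp only [map_sub, map_add, map_smul, hθX, smul_eq_mul]; ring
      rw [e1, ← Real.norm_eq_abs]
      refine ((θ 0 v).le_opNorm _).trans ?_
      calc ‖θ 0 v‖ * ‖φ (-a) (v + u) - (v + u) - (-a) • X 0 v‖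
          ≤ K * (1 / (4 * K * K) * (K * ‖u‖)) := by
            refine mul_le_mul (by rw [← hB, hK]; linarith) (h4.trans ?_) (norm_nonneg _) hK0.le
            gcongr
        _ = ‖u‖ / 4 := by field_simp
    calc _ ≤ _ := abs_sub_le _ (θ 0 v (φ (-a) (v + u) - v)) _
      _ ≤ ‖u‖ / 2 := by linarith
  have hcont : ContinuousOn (fun a => Ψ (φ (-a) (v + u)))
      (Set.Icc (-(K * ‖u‖)) (K * ‖u‖)) := by
    refine hΨc.comp ?_ ?_
    · exact ((S.flow.continuous_apply (v + u)).comp continuous_neg).continuousOn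
    · exact fun a ha => htar a (abs_le.2 ha)
  have hθu : |θ 0 v u| ≤ B * ‖u‖ := by rw [← Real.norm_eq_abs]; exact (θ 0 v).le_opNorm u
  rw [abs_le] at hθu
  have hl := hest (-(K * ‖u‖)) (by rw [abs_neg, abs_of_nonneg hKu])
  have hr := hest (K * ‖u‖) (by rw [abs_of_nonneg hKu])
  rw [abs_le] at hl hr
  have hz : (0 : ℝ) ∈ Set.Icc (Ψ (φ (-(K * ‖u‖)) (v + u))) (Ψ (φ (-(-(K * ‖u‖))) (v + u))) := by
    have hKB : K * ‖u‖ = B * ‖u‖ + ‖u‖ := by rw [hK]; ring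
    constructor <;> linarith [hl.1, hr.2, hθu.1, hθu.2]
  obtain ⟨a, ha, ha0⟩ := intermediate_value_Icc' (by linarith) hcont hz
  exact ⟨a, abs_le.2 ha, htar a (abs_le.2 ha), ha0⟩

/-- Points near the center of a disc transverse to the flow are carried to the disc by the flow. -/
lemma exists_landing (S : StableSetting f g Es Ec Eu F X θ m φ) {v : E3} {α : E2 → E3}
    {L : E2 →L[ℝ] E3} (hα : HasStrictFDerivAt α L 0) (hα0 : α 0 = v)
    (hL : Function.Injective L) (hθ : ∀ p, θ 0 v (L p) = 0) :
    ∃ (J : E3 →L[ℝ] E2) (a : E3 → ℝ) (p : E3 → E2), (∀ q, J (L q) = q) ∧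
      J (X 0 v) = 0 ∧ a =O[𝓝 0] (fun u => u) ∧ (fun u => p u - J u) =o[𝓝 0] (fun u => u) ∧
      ∀ᶠ u in 𝓝 0, α (p u) = φ (-a u) (v + u) := by
  obtain ⟨J, Ψ₁, Ψ₂, δ, hJL, hJX, hδ, hΨc, hΨ0, hΨ₁, hΨ₂⟩ := S.exists_disc_chart hα hα0 hL hθ
  obtain ⟨K, hK0, hex⟩ := S.exists_hitting_time hδ hΨc hΨ₂
  obtain ⟨C, hC0, hC⟩ := S.exists_norm_flow_sub_le
  -- The hitting times are chosen without any continuity; only their linear bound is needed.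
  obtain ⟨a, ha'⟩ : ∃ a : E3 → ℝ, ∀ᶠ u in 𝓝 (0 : E3), |a u| ≤ K * ‖u‖ ∧
      φ (-a u) (v + u) ∈ Metric.ball v δ ∧ Ψ₂ (φ (-a u) (v + u)) = 0 := hex.choice
  have haO : a =O[𝓝 0] fun u : E3 => u :=
    IsBigO.of_bound K (by filter_upwards [ha'] with u hu using hu.1)
  have ha0 : Tendsto a (𝓝 0) (𝓝 0) := haO.trans_tendsto tendsto_id
  have hzO : (fun u => φ (-a u) (v + u) - v) =O[𝓝 0] fun u : E3 => u := by
    refine IsBigO.of_bound (1 + C * K) ?_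
    filter_upwards [ha'] with u hu
    have h1 := hC (-a u) (v + u)
    have h2 := norm_sub_le_norm_sub_add_norm_sub (φ (-a u) (v + u)) (v + u) v
    rw [add_sub_cancel_left] at h2
    rw [abs_neg] at h1
    nlinarith [hu.1]
  have hz : Tendsto (fun u => φ (-a u) (v + u)) (𝓝 0) (𝓝 v) := by
    have := (hzO.trans_tendsto tendsto_id).add_const v
    simpa using this
  have hfl : (fun u => φ (-a u) (v + u) - (v + u) - (-a u) • X 0 v) =o[𝓝 0] fun u : E3 => u := by
    have ht : Tendsto (fun u => (v + u, -a u)) (𝓝 (0 : E3)) (𝓝 (v, 0)) := by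
      refine Tendsto.prodMk_nhds ?_ ?_
      · simpa using (tendsto_id (α := E3) (x := 𝓝 0)).const_add v
      · simpa using ha0.neg
    exact ((S.flow_isLittleO v).comp_tendsto ht).trans_isBigO haO.neg_left
  refine ⟨J, a, fun u => Ψ₁ (φ (-a u) (v + u)), hJL, hJX, haO, ?_, ?_⟩
  · have h1 : (fun u => Ψ₁ (φ (-a u) (v + u)) - J (φ (-a u) (v + u) - v)) =o[𝓝 0]
        fun u : E3 => u := (hΨ₁.comp_tendsto hz).trans_isBigO hzO
    have h3 : (fun u => J (φ (-a u) (v + u) - (v + u) - (-a u) • X 0 v)) =o[𝓝 0]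
        fun u : E3 => u := (J.isBigO_comp _ _).trans_isLittleO hfl
    refine (h1.add h3).congr_left fun u => ?_
    simp only [map_sub, map_add, map_smul, hJX, smul_zero, sub_zero]
    abel
  · filter_upwards [ha'] with u hu
    exact hΨ0 _ hu.2.1 hu.2.2

end StableSetting

end ZeroOne

end

noncomputable section

open Asymptotics

namespace ZeroOne

/-! ### The transverse derivative -/

lemma IsTransDeriv.comp_isLittleO {X : Fin 3 → E3 → E3} {θ : Fin 3 → E3 → E3 →L[ℝ] ℝ}
    {φ : ℝ → E3 → E3} {v : E3} {T : ℝ} {A : E3 →L[ℝ] E3} (hA : IsTransDeriv X θ φ v T A)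
    {α β : E2 → E3} {τ : E2 → ℝ} (hα : Tendsto α (𝓝 0) (𝓝 v)) (hτ : Tendsto τ (𝓝 0) (𝓝 T))
    (h : ∀ᶠ p in 𝓝 0, β p = φ (τ p) (α p)) :
    (fun p => transProj X θ (φ T v) (β p - φ T v) - A (α p - v)) =o[𝓝 0]
      fun p => ‖α p - v‖ + ‖β p - φ T v‖ := by
  have ht : Tendsto (fun p => (α p - v, τ p)) (𝓝 0) (𝓝 (0, T)) := by
    refine Tendsto.prodMk_nhds ?_ hτ
    simpa using hα.sub_const v
  refine (hA.comp_tendsto ht).congr' ?_ ?_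
  · filter_upwards [h] with p hp
    simp [hp]
  · filter_upwards [h] with p hp
    simp [hp]

lemma isBigO_norm_add_norm {Y V W Z : Type*} [NormedAddCommGroup V] [NormedAddCommGroup W]
    [NormedAddCommGroup Z] {l : Filter Y} {a : Y → V} {b : Y → W} {c : Y → Z} (ha : a =O[l] c)
    (hb : b =O[l] c) : (fun y => ‖a y‖ + ‖b y‖) =O[l] c :=
  ha.norm_left.add hb.norm_left

/-- The transverse derivative computes the derivatives of the holonomies between transversals. -/
lemma IsTransDeriv.comp_eq {X : Fin 3 → E3 → E3} {θ : Fin 3 → E3 → E3 →L[ℝ] ℝ}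
    {φ : ℝ → E3 → E3} {v : E3} {T : ℝ} {A : E3 →L[ℝ] E3} (hA : IsTransDeriv X θ φ v T A)
    {α β : E2 → E3} {τ : E2 → ℝ} {α' β' : E2 →L[ℝ] E3} (hα : HasFDerivAt α α' 0)
    (hβ : HasFDerivAt β β' 0) (hα0 : α 0 = v) (hβ0 : β 0 = φ T v) (hτ : Tendsto τ (𝓝 0) (𝓝 T))
    (h : ∀ᶠ p in 𝓝 0, β p = φ (τ p) (α p)) :
    (transProj X θ (φ T v)).comp β' = A.comp α' := by
  have hαc : Tendsto α (𝓝 0) (𝓝 v) := hα0 ▸ hα.continuousAt.tendsto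
  have h1 := hA.comp_isLittleO hαc hτ h
  have h2 : (fun p => α p - v) =O[𝓝 0] fun p : E2 => p := by
    simpa [hα0] using hα.isBigO_sub
  have h3 : (fun p => β p - φ T v) =O[𝓝 0] fun p : E2 => p := by
    simpa [hβ0] using hβ.isBigO_sub
  have h4 := h1.trans_isBigO (isBigO_norm_add_norm h2 h3)
  have h5 : HasFDerivAt (fun p => transProj X θ (φ T v) (β p - φ T v) - A (α p - v))
      (0 : E2 →L[ℝ] E3) 0 := by
    rw [hasFDerivAt_iff_isLittleO]
    simpa [hα0, hβ0] using h4
  have h6 : HasFDerivAt (fun p => transProj X θ (φ T v) (β p - φ T v) - A (α p - v))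
      ((transProj X θ (φ T v)).comp β' - A.comp α') 0 :=
    ((transProj X θ (φ T v)).hasFDerivAt.comp 0 (hβ.sub_const _)).sub
      (A.hasFDerivAt.comp 0 (hα.sub_const _))
  exact sub_eq_zero.1 (h6.unique h5)

namespace StableSetting

variable {f : T3 ≃ₜ T3} {g : RiemMetric} {Es Ec Eu : T3 → Submodule ℝ E3} {F : E3 → E3}
  {X : Fin 3 → E3 → E3} {θ : Fin 3 → E3 → E3 →L[ℝ] ℝ} {m : Fin 3 → E3 → ℝ} {φ : ℝ → E3 → E3}
  {D : T3 → E2 → E3}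

lemma transProj_self (S : StableSetting f g Es Ec Eu F X θ m φ) (v : E3) :
    transProj X θ v (X 0 v) = 0 := by
  rw [transProj_apply, S.frame.dual]; simp

lemma transProj_discDeriv (S : StableSetting f g Es Ec Eu F X θ m φ) (hD : IsDiscFamily Ec Eu D)
    (v : E3) (p : E2) : transProj X θ v (discDeriv D v p) = discDeriv D v p := by
  rw [transProj_apply, S.coframe_discDeriv hD, zero_smul, sub_zero]

/-- For short times the flow moves by `q.2 • X 0 v` up to `o(q.2)`, and `transProj` kills the main
term. The time is itself controlled by the displacement, because `θ 0` reads it off. -/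
lemma isTransDeriv_zero (S : StableSetting f g Es Ec Eu F X θ m φ) (v : E3) :
    IsTransDeriv X θ φ v 0 (transProj X θ v) := by
  unfold IsTransDeriv
  rw [S.flow.zero]
  have ht : Tendsto (fun q : E3 × ℝ => (v + q.1, q.2)) (𝓝 (0, 0)) (𝓝 (v, 0)) := by
    have : Continuous fun q : E3 × ℝ => (v + q.1, q.2) := by fun_prop
    simpa using this.tendsto (0, 0)
  have h1 := (S.flow_isLittleO v).comp_tendsto ht
  simp only [Function.comp_def] at h1
  have h2 : (fun q : E3 × ℝ => q.2) =O[𝓝 (0, 0)]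
      fun q => ‖q.1‖ + ‖φ q.2 (v + q.1) - v‖ := by
    have h3 : (fun q : E3 × ℝ => q.2 - θ 0 v (φ q.2 (v + q.1) - (v + q.1))) =o[𝓝 (0, 0)]
        fun q => q.2 := by
      refine (((θ 0 v).isBigO_comp _ _).trans_isLittleO h1).neg_left.congr_left fun q => ?_
      simp only [map_sub, map_smul, S.frame.dual, if_true, smul_eq_mul]
      ring
    have h4 : (fun q : E3 × ℝ => q.2) =O[𝓝 (0, 0)]
        fun q => θ 0 v (φ q.2 (v + q.1) - (v + q.1)) := by
      have h5 := h3.right_isBigO_sub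
      simpa using h5
    refine h4.trans (((θ 0 v).isBigO_comp _ _).trans (IsBigO.of_bound 1 ?_))
    refine Eventually.of_forall fun q => ?_
    rw [one_mul, Real.norm_eq_abs, abs_of_nonneg (by positivity)]
    have e : φ q.2 (v + q.1) - (v + q.1) = (φ q.2 (v + q.1) - v) - q.1 := by abel
    rw [e]
    linarith [norm_sub_le (φ q.2 (v + q.1) - v) q.1]
  refine ((((transProj X θ v).isBigO_comp _ _).trans_isLittleO h1).trans_isBigO h2).congr_left
    fun q => ?_
  simp only [map_sub, map_smul, S.transProj_self, map_add]
  simp only [smul_zero, sub_zero]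
  abel

/-- A point `v + u` is slid along the flow to the first disc, carried by the holonomy to the second,
and slid for a short remaining time. Modulo the flow direction the slides do not count, which leaves
`A = L ∘ h' ∘ J`, with `J` the linear projection to disc parameters. -/
lemma exists_isTransDeriv_of_holonomy (S : StableSetting f g Es Ec Eu F X θ m φ)
    (hD : IsDiscFamily Ec Eu D) {v : E3} {T : ℝ} {h : E2 → E2} {h' : E2 →L[ℝ] E2} {τ : E2 → ℝ}
    (hh : HasFDerivAt h h' 0) (h0 : h 0 = 0) (hτ : Tendsto τ (𝓝 0) (𝓝 T))
    (hτh : ∀ᶠ p in 𝓝 0, discAt D (φ T v) (h p) = φ (τ p) (discAt D v p)) :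
    ∃ A, IsTransDeriv X θ φ v T A ∧ A (X 0 v) = 0 := by
  set w := φ T v with hw
  set L := discDeriv D w with hL
  obtain ⟨J, a, p, hJL, hJX, haO, hpJ, hland⟩ := S.exists_landing (hD.hasStrictFDerivAt v)
    (discAt_zero D v) (S.discDeriv_injective hD v) (S.coframe_discDeriv hD v)
  refine ⟨(L.comp h').comp J, ?_, by simp [hJX]⟩
  have ha0 : Tendsto a (𝓝 0) (𝓝 0) := haO.trans_tendsto tendsto_id
  have hpO : p =O[𝓝 0] fun u : E3 => u := by
    have := hpJ.isBigO.add (J.isBigO_id (𝓝 0))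
    simpa using this
  have hp0 : Tendsto p (𝓝 0) (𝓝 0) := hpO.trans_tendsto tendsto_id
  have hψ : HasFDerivAt (fun q => discAt D w (h q)) (L.comp h') 0 := by
    have h1 := (hD.hasStrictFDerivAt w).hasFDerivAt
    rw [← h0] at h1
    exact h1.comp 0 hh
  have hψ0 : discAt D w (h 0) = w := by rw [h0, discAt_zero]
  have hψo : (fun u => discAt D w (h (p u)) - w - L (h' (p u))) =o[𝓝 0] fun u : E3 => u := by
    have h1 := hψ.isLittleO
    simp only [hψ0, sub_zero] at h1
    exact (h1.comp_tendsto hp0).trans_isBigO hpO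
  have hψc : Tendsto (fun u => discAt D w (h (p u))) (𝓝 0) (𝓝 w) := by
    have h1 := hψ.continuousAt.tendsto
    rw [hψ0] at h1
    exact h1.comp hp0
  have hfst : Tendsto (fun q : E3 × ℝ => q.1) (𝓝 (0, T)) (𝓝 0) := continuous_fst.tendsto (0, T)
  have hsnd : Tendsto (fun q : E3 × ℝ => q.2) (𝓝 (0, T)) (𝓝 T) := continuous_snd.tendsto (0, T)
  -- The remaining time after landing on the second disc.
  set b : E3 × ℝ → ℝ := fun q => q.2 + a q.1 - τ (p q.1) with hb
  have hb0 : Tendsto b (𝓝 (0, T)) (𝓝 0) := by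
    have := (hsnd.add (ha0.comp hfst)).sub ((hτ.comp hp0).comp hfst)
    simpa using this
  have hev : ∀ᶠ q : E3 × ℝ in 𝓝 (0, T), φ q.2 (v + q.1) = φ (b q) (discAt D w (h (p q.1))) := by
    filter_upwards [hfst.eventually hland, (hp0.comp hfst).eventually hτh] with q hq1 hq2
    rw [Function.comp_apply] at hq2
    rw [hq2, hq1, ← S.flow.add, ← S.flow.add, hb]
    congr 1
    ring
  set G : E3 × ℝ → ℝ := fun q => ‖q.1‖ + ‖φ q.2 (v + q.1) - w‖ with hG
  have hfG : (fun q : E3 × ℝ => q.1) =O[𝓝 (0, T)] G := by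
    refine IsBigO.of_bound 1 (Eventually.of_forall fun q => ?_)
    rw [one_mul, Real.norm_eq_abs, abs_of_nonneg (by positivity)]
    simp [hG]
  have huG : (fun q : E3 × ℝ => φ q.2 (v + q.1) - w) =O[𝓝 (0, T)] G := by
    refine IsBigO.of_bound 1 (Eventually.of_forall fun q => ?_)
    rw [one_mul, Real.norm_eq_abs, abs_of_nonneg (by positivity)]
    simp [hG]
  have e2 : (fun q : E3 × ℝ => discAt D w (h (p q.1)) - w - L (h' (p q.1))) =o[𝓝 (0, T)] G :=
    (hψo.comp_tendsto hfst).trans_isBigO hfG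
  have e1 : (fun q : E3 × ℝ => φ q.2 (v + q.1) - discAt D w (h (p q.1)) - b q • X 0 w)
      =o[𝓝 (0, T)] b := by
    have ht : Tendsto (fun q : E3 × ℝ => (discAt D w (h (p q.1)), b q)) (𝓝 (0, T)) (𝓝 (w, 0)) :=
      (hψc.comp hfst).prodMk_nhds hb0
    refine ((S.flow_isLittleO w).comp_tendsto ht).congr' ?_ (EventuallyEq.refl _ _)
    filter_upwards [hev] with q hq
    simp [hq]
  have hbG : b =O[𝓝 (0, T)] G := by
    have h1 : (fun q : E3 × ℝ => b q - θ 0 w (φ q.2 (v + q.1) - discAt D w (h (p q.1))))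
        =o[𝓝 (0, T)] b := by
      refine (((θ 0 w).isBigO_comp _ _).trans_isLittleO e1).neg_left.congr_left fun q => ?_
      simp only [map_sub, map_smul, S.frame.dual, if_true, smul_eq_mul]
      ring
    have h2 : b =O[𝓝 (0, T)] fun q => θ 0 w (φ q.2 (v + q.1) - discAt D w (h (p q.1))) := by
      have h3 := h1.right_isBigO_sub
      simpa using h3
    refine h2.trans (((θ 0 w).isBigO_comp _ _).trans ?_)
    have h4 : (fun q : E3 × ℝ => L (h' (p q.1))) =O[𝓝 (0, T)] G :=
      ((L.comp h').isBigO_comp _ _).trans ((hpO.comp_tendsto hfst).trans hfG)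
    refine (huG.sub (e2.isBigO.add h4)).congr_left fun q => ?_
    abel
  have e3 : (fun q : E3 × ℝ => L (h' (p q.1 - J q.1))) =o[𝓝 (0, T)] G :=
    ((L.comp h').isBigO_comp _ _).trans_isLittleO ((hpJ.comp_tendsto hfst).trans_isBigO hfG)
  have e4 := ((transProj X θ w).isBigO_comp _ _).trans_isLittleO (e1.trans_isBigO hbG)
  have e5 := ((transProj X θ w).isBigO_comp _ _).trans_isLittleO e2
  refine ((e4.add e5).add e3).congr_left fun q => ?_
  have hLt : ∀ r, transProj X θ w (L r) = L r := S.transProj_discDeriv hD w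
  simp only [map_sub, map_smul, S.transProj_self, hLt, smul_zero, sub_zero,
    ContinuousLinearMap.comp_apply]
  abel

/-- Every holonomy, known to be merely continuous, has the derivative prescribed by the transverse
derivative. -/
lemma hasFDerivAt_holonomy (S : StableSetting f g Es Ec Eu F X θ m φ)
    (hD : IsDiscFamily Ec Eu D) {v : E3} {T : ℝ} {A : E3 →L[ℝ] E3}
    (hA : IsTransDeriv X θ φ v T A) {h : E2 → E2}
    (hh : IsHolonomy g Es (D (proj v)) (D (proj (φ T v))) h) :
    ∃ h' : E2 →L[ℝ] E2, HasFDerivAt h h' 0 ∧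
      ∀ p, discDeriv D (φ T v) (h' p) = A (discDeriv D v p) := by
  obtain ⟨τ, hτ, hτh⟩ := S.exists_holonomy_time hD hh
  set w := φ T v with hw
  set L := discDeriv D w with hL
  obtain ⟨J, -, -, hJL, -⟩ := S.exists_landing (hD.hasStrictFDerivAt w)
    (discAt_zero D w) (S.discDeriv_injective hD w) (S.coframe_discDeriv hD w)
  have hαd := (hD.hasStrictFDerivAt v).hasFDerivAt
  have hψd := (hD.hasStrictFDerivAt w).hasFDerivAt
  have hαc : Tendsto (discAt D v) (𝓝 0) (𝓝 v) := by
    have := hαd.continuousAt.tendsto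
    rwa [discAt_zero] at this
  have hhc : Tendsto h (𝓝 0) (𝓝 0) := by
    have := hh.continuousAt.tendsto
    rwa [hh.map_zero] at this
  have h1 := hA.comp_isLittleO hαc hτ hτh
  rw [← hw] at h1
  set G : E2 → ℝ := fun p => ‖p‖ + ‖h p‖ with hG
  have hpG : (fun p : E2 => p) =O[𝓝 0] G := by
    refine IsBigO.of_bound 1 (Eventually.of_forall fun q => ?_)
    rw [one_mul, Real.norm_eq_abs, abs_of_nonneg (by positivity)]
    simp [hG]
  have hhG : h =O[𝓝 0] G := by
    refine IsBigO.of_bound 1 (Eventually.of_forall fun q => ?_)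
    rw [one_mul, Real.norm_eq_abs, abs_of_nonneg (by positivity)]
    simp [hG]
  have hα1 : (fun p => discAt D v p - v - discDeriv D v p) =o[𝓝 0] G := by
    have := hαd.isLittleO
    simp only [discAt_zero, sub_zero] at this
    exact this.trans_isBigO hpG
  have hψ1 : (fun p => discAt D w (h p) - w - L (h p)) =o[𝓝 0] G := by
    have := hψd.isLittleO
    simp only [discAt_zero, sub_zero] at this
    exact (this.comp_tendsto hhc).trans_isBigO hhG
  have hα2 : (fun p => discAt D v p - v) =O[𝓝 0] G := by
    have := hα1.isBigO.add (((discDeriv D v).isBigO_comp _ _).trans hpG)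
    simpa using this
  have hψ2 : (fun p => discAt D w (h p) - w) =O[𝓝 0] G := by
    have := hψ1.isBigO.add ((L.isBigO_comp _ _).trans hhG)
    simpa using this
  have h2 := h1.trans_isBigO (isBigO_norm_add_norm hα2 hψ2)
  have h3 : (fun p => L (h p) - A (discDeriv D v p)) =o[𝓝 0] G := by
    have e1 := ((transProj X θ w).isBigO_comp _ _).trans_isLittleO hψ1
    have e2 := (A.isBigO_comp _ _).trans_isLittleO hα1
    refine ((h2.sub e1).add e2).congr_left fun p => ?_
    have hLt : ∀ r, transProj X θ w (L r) = L r := S.transProj_discDeriv hD w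
    simp only [map_sub, hLt]
    abel
  have h4 : (fun p => h p - J (A (discDeriv D v p))) =o[𝓝 0] G := by
    refine ((J.isBigO_comp _ _).trans_isLittleO h3).congr_left fun p => ?_
    rw [map_sub, hJL]
  set h' : E2 →L[ℝ] E2 := (J.comp A).comp (discDeriv D v) with hh'
  -- The error so far is relative to `‖p‖ + ‖h p‖`. Absorbing half of `‖h p‖` on the left gives `h =
  -- O(p)`, and the same estimate then becomes differentiability.
  have h5 : h =O[𝓝 0] fun p : E2 => p := by
    have h6 : ∀ᶠ p in 𝓝 (0 : E2), ‖h p - h' p‖ ≤ 1 / 2 * ‖G p‖ :=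
      (isLittleO_iff.1 h4) (by norm_num)
    refine IsBigO.of_bound (2 * ‖h'‖ + 1) ?_
    filter_upwards [h6] with p hp
    rw [Real.norm_eq_abs, abs_of_nonneg (by positivity)] at hp
    simp only [hG] at hp
    have h7 := norm_sub_norm_le (h p) (h' p)
    have h8 := h'.le_opNorm p
    linarith
  have h6 : HasFDerivAt h h' 0 := by
    rw [hasFDerivAt_iff_isLittleO]
    have := h4.trans_isBigO (isBigO_norm_add_norm (isBigO_refl (fun p : E2 => p) _) h5)
    simp only [hh.map_zero, sub_zero]
    exact this
  refine ⟨h', h6, fun p => ?_⟩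
  have hβ : HasFDerivAt (fun q => discAt D w (h q)) (L.comp h') 0 := by
    have h1 := hψd
    rw [← hh.map_zero] at h1
    exact h1.comp 0 h6
  have := hA.comp_eq hαd hβ (discAt_zero D v) (by rw [hh.map_zero, discAt_zero]) hτ hτh
  have h7 := congrArg (fun B : E2 →L[ℝ] E3 => B p) this
  simp only [ContinuousLinearMap.comp_apply] at h7
  rw [← h7]
  exact (S.transProj_discDeriv hD w (h' p)).symm

lemma exists_isTransDeriv (S : StableSetting f g Es Ec Eu F X θ m φ)
    (hD : IsDiscFamily Ec Eu D) (hH : HasC1Holonomies g Es D) (v : E3) (T : ℝ) :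
    ∃ A, IsTransDeriv X θ φ v T A ∧ A (X 0 v) = 0 := by
  obtain ⟨h, hh, hc⟩ := hH (proj v) (proj (φ T v)) (S.proj_flow_mem_leaf T v)
  obtain ⟨τ, hτ, hτh⟩ := S.exists_holonomy_time hD hh
  exact S.exists_isTransDeriv_of_holonomy hD (hc.differentiableAt one_ne_zero).hasFDerivAt
    hh.map_zero hτ hτh

end StableSetting

end ZeroOne

end

noncomputable section

open Asymptotics

namespace ZeroOne

/-! ### Angles between lines -/

lemma RiemMetric.norm_sq (g : RiemMetric) (x : T3) (a : E3) : g.norm x a ^ 2 = g.inner x a a :=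
  Real.sq_sqrt (g.inner_self_nonneg x a)

lemma RiemMetric.norm_nonneg (g : RiemMetric) (x : T3) (a : E3) : 0 ≤ g.norm x a := Real.sqrt_nonneg _

lemma RiemMetric.abs_inner_lt (g : RiemMetric) (x : T3) {a b : E3} (hb : b ≠ 0)
    (h : ∀ c : ℝ, a ≠ c • b) : |g.inner x a b| < g.norm x a * g.norm x b := by
  refine abs_lt_of_sq_lt_sq ?_ (mul_nonneg (g.norm_nonneg x a) (g.norm_nonneg x b))
  rw [mul_pow, g.norm_sq, g.norm_sq]
  have hbb := g.pos x b hb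
  have h1 := g.pos x (a - (g.inner x a b / g.inner x b b) • b)
    (sub_ne_zero.2 (h (g.inner x a b / g.inner x b b)))
  simp only [map_sub, map_smul, sub_apply, smul_apply, smul_eq_mul] at h1
  rw [g.symm x b a] at h1
  have h2 : g.inner x a a - g.inner x a b / g.inner x b b * g.inner x a b -
      (g.inner x a b / g.inner x b b * g.inner x a b - g.inner x a b / g.inner x b b *
        (g.inner x a b / g.inner x b b * g.inner x b b)) =
      (g.inner x a a * g.inner x b b - g.inner x a b ^ 2) / g.inner x b b := by
    field_simp; ring
  have h3 : 0 < (g.inner x a a * g.inner x b b - g.inner x a b ^ 2) / g.inner x b b := by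
    rw [← h2]; linarith
  have h4 := (div_pos_iff_of_pos_right hbb).1 h3
  linarith

/-- Rescaling the vectors changes the cosine at most by a sign. For distinct lines its absolute
value `k` is below one by strict Cauchy–Schwarz, so the infimum is at least `arccos k > 0`. -/
lemma RiemMetric.lineAngle_eq_zero_iff (g : RiemMetric) (x : T3) {a b : E3} (ha : a ≠ 0)
    (hb : b ≠ 0) :
    g.lineAngle x (Submodule.span ℝ {a}) (Submodule.span ℝ {b}) = 0 ↔ ∃ c : ℝ, a = c • b := by
  have hna := g.norm_pos x ha
  have hnb := g.norm_pos x hb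
  constructor
  · intro h0
    by_contra! h
    have hlt := g.abs_inner_lt x hb h
    set k := |g.inner x a b| / (g.norm x a * g.norm x b) with hk
    have hk1 : k < 1 := by rw [hk, div_lt_one (by positivity)]; exact hlt
    have hpos : 0 < Real.arccos k := Real.arccos_pos.2 hk1
    have hle : Real.arccos k ≤ g.lineAngle x (Submodule.span ℝ {a}) (Submodule.span ℝ {b}) := by
      refine le_csInf ⟨_, a, Submodule.mem_span_singleton_self a, b,
        Submodule.mem_span_singleton_self b, ha, hb, rfl⟩ ?_
      rintro _ ⟨v, hv, w, hw, hv0, hw0, rfl⟩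
      obtain ⟨s, rfl⟩ := Submodule.mem_span_singleton.1 hv
      obtain ⟨t, rfl⟩ := Submodule.mem_span_singleton.1 hw
      have hs : s ≠ 0 := by rintro rfl; simp at hv0
      have ht : t ≠ 0 := by rintro rfl; simp at hw0
      refine Real.arccos_le_arccos ?_
      have hs' := abs_pos.2 hs
      have ht' := abs_pos.2 ht
      rw [g.norm_smul, g.norm_smul, hk, div_le_div_iff₀ (by positivity) (by positivity)]
      simp only [map_smul, smul_apply, smul_eq_mul]
      have h5 : s * (t * g.inner x a b) ≤ |s| * (|t| * |g.inner x a b|) := by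
        rw [← abs_mul, ← abs_mul]; exact le_abs_self _
      calc _ ≤ |s| * (|t| * |g.inner x a b|) * (g.norm x a * g.norm x b) := by
            rw [← mul_left_comm s t] at *
            gcongr
        _ = _ := by ring
    linarith
  · rintro ⟨c, rfl⟩
    have hc : c ≠ 0 := by rintro rfl; simp at ha
    have hlow : ∀ r ∈ {θ : ℝ | ∃ v ∈ Submodule.span ℝ {c • b}, ∃ w ∈ Submodule.span ℝ {b},
        v ≠ 0 ∧ w ≠ 0 ∧ θ = Real.arccos (g.inner x v w / (g.norm x v * g.norm x w))}, 0 ≤ r := by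
      rintro _ ⟨v, -, w, -, -, -, rfl⟩
      exact Real.arccos_nonneg _
    refine IsLeast.csInf_eq ⟨⟨b, ?_, b, Submodule.mem_span_singleton_self b, hb, hb, ?_⟩, hlow⟩
    · rw [Submodule.span_singleton_smul_eq (IsUnit.mk0 c hc)]
      exact Submodule.mem_span_singleton_self b
    · rw [← sq, g.norm_sq, div_self (g.pos x b hb).ne', Real.arccos_one]

namespace StableSetting

variable {f : T3 ≃ₜ T3} {g : RiemMetric} {Es Ec Eu : T3 → Submodule ℝ E3} {F : E3 → E3}
  {X : Fin 3 → E3 → E3} {θ : Fin 3 → E3 → E3 →L[ℝ] ℝ} {m : Fin 3 → E3 → ℝ} {φ : ℝ → E3 → E3}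
  {D : T3 → E2 → E3}

/-! ### Composition and equivariance of transverse derivatives -/

/-- The composed holonomies form a section of the flow at time `τ₂ ∘ h₁ + τ₁`, to which
`IsTransDeriv.comp_eq` applies; no regularity of a direct holonomy is needed. -/
lemma transDeriv_comp (S : StableSetting f g Es Ec Eu F X θ m φ)
    (hD : IsDiscFamily Ec Eu D) (hH : HasC1Holonomies g Es D) {v : E3} {s t : ℝ}
    {A B C : E3 →L[ℝ] E3} (hA : IsTransDeriv X θ φ v t A) (hB : IsTransDeriv X θ φ (φ t v) s B)
    (hC : IsTransDeriv X θ φ v (s + t) C) {i : Fin 3} (hi : i ≠ 0) :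
    C (X i v) = B (A (X i v)) := by
  obtain ⟨h₁, hh₁, -⟩ := hH (proj v) (proj (φ t v)) (S.proj_flow_mem_leaf t v)
  obtain ⟨h₂, hh₂, -⟩ := hH (proj (φ t v)) (proj (φ s (φ t v))) (S.proj_flow_mem_leaf s _)
  obtain ⟨h₁', hd₁, hL₁⟩ := S.hasFDerivAt_holonomy hD hA hh₁
  obtain ⟨h₂', hd₂, hL₂⟩ := S.hasFDerivAt_holonomy hD hB hh₂
  obtain ⟨τ₁, hτ₁, he₁⟩ := S.exists_holonomy_time hD hh₁
  obtain ⟨τ₂, hτ₂, he₂⟩ := S.exists_holonomy_time hD hh₂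
  have hh₁c : Tendsto h₁ (𝓝 0) (𝓝 0) := by
    have := hh₁.continuousAt.tendsto
    rwa [hh₁.map_zero] at this
  set z := φ s (φ t v) with hz
  have hβ : HasFDerivAt (fun q => discAt D z (h₂ (h₁ q)))
      ((discDeriv D z).comp (h₂'.comp h₁')) 0 := by
    have e1 := (hD.hasStrictFDerivAt z).hasFDerivAt
    have e2 : HasFDerivAt (fun q => h₂ (h₁ q)) (h₂'.comp h₁') 0 := by
      rw [← hh₁.map_zero] at hd₂
      exact hd₂.comp 0 hd₁
    have e3 : h₂ (h₁ 0) = 0 := by rw [hh₁.map_zero, hh₂.map_zero]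
    rw [← e3] at e1
    exact e1.comp 0 e2
  have key := hC.comp_eq (τ := fun q => τ₂ (h₁ q) + τ₁ q)
    (hD.hasStrictFDerivAt v).hasFDerivAt hβ (discAt_zero D v)
    (by rw [hh₁.map_zero, hh₂.map_zero, discAt_zero, S.flow.add])
    ((hτ₂.comp hh₁c).add hτ₁) (by
      filter_upwards [he₁, hh₁c.eventually he₂] with q hq₁ hq₂
      rw [hq₂, hq₁, S.flow.add])
  obtain ⟨p, hp⟩ := S.exists_discDeriv_eq hD v hi
  have h7 := congrArg (fun B : E2 →L[ℝ] E3 => B p) key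
  simp only [ContinuousLinearMap.comp_apply] at h7
  rw [hp, S.flow.add, ← hz, S.transProj_discDeriv hD, hL₂, hL₁, hp] at h7
  exact h7.symm

lemma transDeriv_inverse (S : StableSetting f g Es Ec Eu F X θ m φ)
    (hD : IsDiscFamily Ec Eu D) (hH : HasC1Holonomies g Es D) {v : E3} {t : ℝ}
    {A B : E3 →L[ℝ] E3} (hA : IsTransDeriv X θ φ v t A)
    (hB : IsTransDeriv X θ φ (φ t v) (-t) B) {i : Fin 3} (hi : i ≠ 0) :
    B (A (X i v)) = X i v := by
  have h0 := S.isTransDeriv_zero v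
  rw [← neg_add_cancel t] at h0
  rw [← S.transDeriv_comp hD hH hA hB h0 hi, transProj_apply, S.frame.dual, if_neg hi.symm,
    zero_smul, sub_zero]

lemma coframe_transDeriv (S : StableSetting f g Es Ec Eu F X θ m φ)
    (hD : IsDiscFamily Ec Eu D) (hH : HasC1Holonomies g Es D) {v : E3} {t : ℝ}
    {A : E3 →L[ℝ] E3} (hA : IsTransDeriv X θ φ v t A) {i : Fin 3} (hi : i ≠ 0) :
    θ 0 (φ t v) (A (X i v)) = 0 := by
  obtain ⟨h, hh, -⟩ := hH (proj v) (proj (φ t v)) (S.proj_flow_mem_leaf t v)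
  obtain ⟨h', -, hL⟩ := S.hasFDerivAt_holonomy hD hA hh
  obtain ⟨p, hp⟩ := S.exists_discDeriv_eq hD v hi
  rw [← hp, ← hL]
  exact S.coframe_discDeriv hD _ _

/-- The images under `F` of the discs and of the holonomy again form sections of the flow, with
changed time. They need not belong to the family `D`, but `IsTransDeriv.comp_eq` accepts any
sections. -/
lemma transDeriv_equivariant (S : StableSetting f g Es Ec Eu F X θ m φ)
    (hD : IsDiscFamily Ec Eu D) (hH : HasC1Holonomies g Es D) {v : E3} {t : ℝ}
    {A B : E3 →L[ℝ] E3} (hA : IsTransDeriv X θ φ v t A)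
    (hB : IsTransDeriv X θ φ (F v) (timeChange m φ v t) B) :
    m 2 v * θ 1 (F (φ t v)) (B (X 2 (F v))) = m 1 (φ t v) * θ 1 (φ t v) (A (X 2 v)) := by
  obtain ⟨h, hh, -⟩ := hH (proj v) (proj (φ t v)) (S.proj_flow_mem_leaf t v)
  obtain ⟨h', hd, hL⟩ := S.hasFDerivAt_holonomy hD hA hh
  obtain ⟨τ, hτ, he⟩ := S.exists_holonomy_time hD hh
  have hα : HasFDerivAt (fun q => F (discAt D v q)) ((fderiv ℝ F v).comp (discDeriv D v)) 0 := by
    have e1 := S.frame.hasFDerivAt v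
    have e2 := (hD.hasStrictFDerivAt v).hasFDerivAt
    have e3 := discAt_zero D v
    exact HasFDerivAt.comp (0 : E2) (by rw [e3]; exact e1) e2
  have hβ : HasFDerivAt (fun q => F (discAt D (φ t v) (h q)))
      ((fderiv ℝ F (φ t v)).comp ((discDeriv D (φ t v)).comp h')) 0 := by
    have e1 := S.frame.hasFDerivAt (φ t v)
    have e2 : HasFDerivAt (fun q => discAt D (φ t v) (h q))
        ((discDeriv D (φ t v)).comp h') 0 := by
      have e0 := (hD.hasStrictFDerivAt (φ t v)).hasFDerivAt
      rw [← hh.map_zero] at e0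
      exact e0.comp 0 hd
    exact HasFDerivAt.comp (0 : E2) (by rw [hh.map_zero, discAt_zero]; exact e1) e2
  have hτ' : Tendsto (fun q => timeChange m φ (discAt D v q) (τ q)) (𝓝 0)
      (𝓝 (timeChange m φ v t)) := by
    have e1 : Tendsto (discAt D v) (𝓝 0) (𝓝 v) := by
      have := (hD.hasStrictFDerivAt v).continuousAt.tendsto
      rwa [discAt_zero] at this
    exact (S.continuous_timeChange.tendsto (v, t)).comp (e1.prodMk_nhds hτ)
  have key := hB.comp_eq hα hβ (by rw [discAt_zero])
    (by rw [hh.map_zero, discAt_zero, S.lift_flow]) hτ' (by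
      filter_upwards [he] with q hq
      rw [hq, S.lift_flow])
  obtain ⟨p, hp⟩ := S.exists_discDeriv_eq hD v (i := 2) (by decide)
  have h7 := congrArg (fun B : E2 →L[ℝ] E3 => θ 1 (F (φ t v)) (B p)) key
  simp only [ContinuousLinearMap.comp_apply] at h7
  rw [hp, hL, hp, ← S.lift_flow, transProj_apply, map_sub, map_smul, S.frame.dual,
    S.frame.coframe_fderiv, S.frame.fderiv_X, map_smul, map_smul] at h7
  simpa using h7.symm

/-! ### Vanishing of the angle -/

lemma eq_smul_of_coframe (S : StableSetting f g Es Ec Eu F X θ m φ) {v u : E3}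
    (h0 : θ 0 v u = 0) (h1 : θ 1 v u = 0) : u = θ 2 v u • X 2 v := by
  conv_lhs => rw [← S.frame.sum_eq v u]
  rw [Fin.sum_univ_three, h0, h1]
  simp

lemma transDeriv_ne_zero (S : StableSetting f g Es Ec Eu F X θ m φ)
    (hD : IsDiscFamily Ec Eu D) (hH : HasC1Holonomies g Es D) {v : E3} {t : ℝ}
    {A : E3 →L[ℝ] E3} (hA : IsTransDeriv X θ φ v t A) : A (X 2 v) ≠ 0 := by
  intro h0
  obtain ⟨B, hB, -⟩ := S.exists_isTransDeriv hD hH (φ t v) (-t)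
  have := S.transDeriv_inverse hD hH hA hB (i := 2) (by decide)
  rw [h0, map_zero] at this
  exact (S.unitSection 2).ne_zero v this.symm

/-- The holonomy in `alpha` is selected by `Classical.epsilon` and is known only to be continuous;
`hasFDerivAt_holonomy` gives its derivative nevertheless. -/
lemma alpha_eq_zero_iff (S : StableSetting f g Es Ec Eu F X θ m φ)
    (hD : IsDiscFamily Ec Eu D) (hH : HasC1Holonomies g Es D) {v : E3} {t : ℝ}
    {A : E3 →L[ℝ] E3} (hA : IsTransDeriv X θ φ v t A) :
    alpha g Es Eu D (proj v) (proj (φ t v)) = 0 ↔ θ 1 (φ t v) (A (X 2 v)) = 0 := by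
  have hh : IsHolonomy g Es (D (proj v)) (D (proj (φ t v)))
      (holonomy g Es D (proj v) (proj (φ t v))) := by
    obtain ⟨h, hh, -⟩ := hH (proj v) (proj (φ t v)) (S.proj_flow_mem_leaf t v)
    exact Classical.epsilon_spec (p := IsHolonomy g Es (D (proj v)) (D (proj (φ t v)))) ⟨h, hh⟩
  obtain ⟨h', hd, hL⟩ := S.hasFDerivAt_holonomy hD hA hh
  have hEu : ∀ w, Eu (proj w) = Submodule.span ℝ {X 2 w} := fun w => (S.unitSection 2).span_eq w
  have himg : holonomyImage g Es D (proj v) (proj (φ t v)) (Eu (proj v)) =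
      Submodule.span ℝ {A (X 2 v)} := by
    rw [holonomyImage, hd.fderiv]
    ext u
    rw [Submodule.mem_map, Submodule.mem_span_singleton]
    constructor
    · rintro ⟨p, hp, rfl⟩
      rw [Submodule.mem_comap, hEu] at hp
      obtain ⟨c, hc⟩ := Submodule.mem_span_singleton.1 hp
      refine ⟨c, ?_⟩
      change _ = discDeriv D (φ t v) (h' p)
      rw [hL, ← map_smul, hc]
      rfl
    · rintro ⟨c, rfl⟩
      obtain ⟨p, hp⟩ := S.exists_discDeriv_eq hD v (i := 2) (by decide)
      refine ⟨c • p, ?_, ?_⟩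
      · rw [Submodule.mem_comap, hEu, Submodule.mem_span_singleton]
        exact ⟨c, by rw [← hp]; exact (map_smul (discDeriv D v) c p).symm⟩
      · change discDeriv D (φ t v) (h' (c • p)) = _
        rw [hL, map_smul, map_smul, hp]
  rw [alpha, himg, hEu, g.lineAngle_eq_zero_iff _ (S.transDeriv_ne_zero hD hH hA)
    ((S.unitSection 2).ne_zero _)]
  constructor
  · rintro ⟨c, hc⟩
    rw [hc, map_smul, S.frame.dual]
    simp
  · intro h1
    exact ⟨_, S.eq_smul_of_coframe (S.coframe_transDeriv hD hH hA (by decide)) h1⟩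

/-- Points of the same leaf are related if the holonomy between them preserves the direction `Eu`. -/
def angleRel (g : RiemMetric) (Es Eu : T3 → Submodule ℝ E3) (D : T3 → E2 → E3) (x y : T3) : Prop :=
  y ∈ leaf Es x ∧ alpha g Es Eu D x y = 0

lemma angleRel_symm (S : StableSetting f g Es Ec Eu F X θ m φ)
    (hD : IsDiscFamily Ec Eu D) (hH : HasC1Holonomies g Es D) {x y : T3}
    (h : angleRel g Es Eu D x y) : angleRel g Es Eu D y x := by
  obtain ⟨hl, h0⟩ := h
  obtain ⟨v, rfl⟩ := proj_surjective x
  obtain ⟨t, rfl⟩ := S.mem_leaf_iff.1 hl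
  obtain ⟨A, hA, -⟩ := S.exists_isTransDeriv hD hH v t
  obtain ⟨B, hB, -⟩ := S.exists_isTransDeriv hD hH (φ t v) (-t)
  have hback := S.flow.neg_apply t v
  have e1 := S.proj_flow_mem_leaf (-t) (φ t v)
  have e2 := S.alpha_eq_zero_iff hD hH hB
  rw [hback] at e1 e2
  refine ⟨e1, e2.2 ?_⟩
  have h1 := (S.alpha_eq_zero_iff hD hH hA).1 h0
  have h2 := S.eq_smul_of_coframe (S.coframe_transDeriv hD hH hA (i := 2) (by decide)) h1
  have h3 := S.transDeriv_inverse hD hH hA hB (i := 2) (by decide)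
  rw [h2, map_smul] at h3
  have h4 := congrArg (θ 1 v) h3
  rw [map_smul, S.frame.dual, smul_eq_mul, if_neg (by decide)] at h4
  refine (mul_eq_zero.1 h4).resolve_left fun hc => ?_
  rw [hc, zero_smul] at h2
  exact S.transDeriv_ne_zero hD hH hA h2

lemma angleRel_trans (S : StableSetting f g Es Ec Eu F X θ m φ)
    (hD : IsDiscFamily Ec Eu D) (hH : HasC1Holonomies g Es D) {x y z : T3}
    (h : angleRel g Es Eu D x y) (h' : angleRel g Es Eu D y z) : angleRel g Es Eu D x z := by
  obtain ⟨hl, h0⟩ := h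
  obtain ⟨hl', h0'⟩ := h'
  obtain ⟨v, rfl⟩ := proj_surjective x
  obtain ⟨t, rfl⟩ := S.mem_leaf_iff.1 hl
  obtain ⟨s, rfl⟩ := S.mem_leaf_iff.1 hl'
  obtain ⟨A, hA, -⟩ := S.exists_isTransDeriv hD hH v t
  obtain ⟨B, hB, -⟩ := S.exists_isTransDeriv hD hH (φ t v) s
  obtain ⟨C, hC, -⟩ := S.exists_isTransDeriv hD hH v (s + t)
  have e1 := S.proj_flow_mem_leaf (s + t) v
  have e2 := S.alpha_eq_zero_iff hD hH hC
  rw [S.flow.add] at e1 e2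
  refine ⟨e1, e2.2 ?_⟩
  have h1 := (S.alpha_eq_zero_iff hD hH hA).1 h0
  have h2 := S.eq_smul_of_coframe (S.coframe_transDeriv hD hH hA (i := 2) (by decide)) h1
  rw [S.transDeriv_comp hD hH hA hB hC (by decide), h2, map_smul, map_smul,
    (S.alpha_eq_zero_iff hD hH hB).1 h0', smul_zero]

lemma multiplier_one_ne_zero (S : StableSetting f g Es Ec Eu F X θ m φ) (v : E3) : m 1 v ≠ 0 := by
  obtain ⟨η, hη, h⟩ := S.frame.domination
  have := h v
  exact abs_pos.1 (by linarith [abs_nonneg (m 0 v)])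

lemma multiplier_two_ne_zero (S : StableSetting f g Es Ec Eu F X θ m φ) (v : E3) : m 2 v ≠ 0 :=
  abs_pos.1 ((abs_pos.2 (S.multiplier_one_ne_zero v)).trans_le (S.frame.domination' v))

lemma angleRel_map (S : StableSetting f g Es Ec Eu F X θ m φ)
    (hD : IsDiscFamily Ec Eu D) (hH : HasC1Holonomies g Es D) {x y : T3}
    (hl : y ∈ leaf Es x) : angleRel g Es Eu D (f x) (f y) ↔ angleRel g Es Eu D x y := by
  obtain ⟨v, rfl⟩ := proj_surjective x
  obtain ⟨t, rfl⟩ := S.mem_leaf_iff.1 hl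
  obtain ⟨A, hA, -⟩ := S.exists_isTransDeriv hD hH v t
  obtain ⟨B, hB, -⟩ := S.exists_isTransDeriv hD hH (F v) (timeChange m φ v t)
  have e1 := S.proj_flow_mem_leaf (timeChange m φ v t) (F v)
  have e2 := S.alpha_eq_zero_iff hD hH hB
  rw [← S.lift_flow] at e1 e2
  have e3 := S.transDeriv_equivariant hD hH hA hB
  have m1 := S.multiplier_one_ne_zero (φ t v)
  have m2 := S.multiplier_two_ne_zero v
  rw [S.lift, S.lift] at e1 e2
  rw [angleRel, angleRel, e2, S.alpha_eq_zero_iff hD hH hA]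
  refine and_congr (iff_of_true e1 hl) ⟨fun h => ?_, fun h => ?_⟩
  · rw [h, mul_zero] at e3
    exact (mul_eq_zero.1 e3.symm).resolve_left m1
  · rw [h, mul_zero] at e3
    exact (mul_eq_zero.1 e3).resolve_left m2

end StableSetting

end ZeroOne

end

noncomputable section

open Asymptotics

namespace ZeroOne

namespace StableSetting

variable {f : T3 ≃ₜ T3} {g : RiemMetric} {Es Ec Eu : T3 → Submodule ℝ E3} {F : E3 → E3}
  {X : Fin 3 → E3 → E3} {θ : Fin 3 → E3 → E3 →L[ℝ] ℝ} {m : Fin 3 → E3 → ℝ} {φ : ℝ → E3 → E3}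
  {D : T3 → E2 → E3}

/-! ### Measurability of the angle relation -/

/-- The points `(v, T)` such that, near `v`, the flow at times close to `T` distorts the center
coordinate by at most the factor `K`, up to an error term. -/
def distortionSet (θ : Fin 3 → E3 → E3 →L[ℝ] ℝ) (φ : ℝ → E3 → E3) (K n N : ℕ) : Set (E3 × ℝ) :=
  {p | ∀ q : E3 × ℝ, ‖q‖ ≤ 1 / (N + 1 : ℝ) →
    |θ 1 (φ p.2 p.1) (φ (p.2 + q.2) (p.1 + q.1) - φ p.2 p.1)| ≤ K * |θ 1 p.1 q.1| +
      1 / (n + 1 : ℝ) * (‖q.1‖ + ‖φ (p.2 + q.2) (p.1 + q.1) - φ p.2 p.1‖)}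

lemma isClosed_distortionSet (S : StableSetting f g Es Ec Eu F X θ m φ) (K n N : ℕ) :
    IsClosed (distortionSet θ φ K n N) := by
  have hθ := S.frame.continuous_θ 1
  have hφ : ∀ {Y : Type} [TopologicalSpace Y] {a : Y → ℝ} {b : Y → E3}, Continuous a → Continuous b →
      Continuous fun y => φ (a y) (b y) := fun ha hb => S.flow.continuous.comp (ha.prodMk hb)
  have hw : Continuous fun p : E3 × ℝ => φ p.2 p.1 := hφ continuous_snd continuous_fst
  simp only [distortionSet, Set.ofPred_forall]
  refine isClosed_iInter fun q => isClosed_iInter fun _ => ?_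
  have hw' : Continuous fun p : E3 × ℝ => φ (p.2 + q.2) (p.1 + q.1) - φ p.2 p.1 :=
    (hφ (by fun_prop) (by fun_prop)).sub hw
  refine isClosed_le ?_ ?_
  · exact ((hθ.comp hw).clm_apply hw').abs
  · have h1 : Continuous fun p : E3 × ℝ => θ 1 p.1 q.1 :=
      (hθ.comp continuous_fst).clm_apply continuous_const
    exact (continuous_const.mul h1.abs).add
      (continuous_const.mul (continuous_const.add hw'.norm))

lemma coframe_transProj (S : StableSetting f g Es Ec Eu F X θ m φ) (w u : E3) :
    θ 1 w (transProj X θ w u) = θ 1 w u := by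
  rw [transProj_apply, map_sub, map_smul, S.frame.dual]
  simp

/-- If `A` kills `X 0` and the center component of `A (X 2 v)` is zero, then `θ 1 ∘ A` is a multiple
of `θ 1`; `K` bounds the factor. -/
lemma exists_distortion_of_transDeriv (S : StableSetting f g Es Ec Eu F X θ m φ) {v : E3} {T : ℝ}
    {A : E3 →L[ℝ] E3} (hA : IsTransDeriv X θ φ v T A) (h0 : A (X 0 v) = 0)
    (h2 : θ 1 (φ T v) (A (X 2 v)) = 0) :
    ∃ K : ℕ, ∀ n : ℕ, ∃ N : ℕ, (v, T) ∈ distortionSet θ φ K n N := by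
  set w := φ T v with hw
  obtain ⟨K, hK⟩ := exists_nat_ge |θ 1 w (A (X 1 v))|
  refine ⟨K, fun n => ?_⟩
  have hAu : ∀ u, θ 1 w (A u) = θ 1 v u * θ 1 w (A (X 1 v)) := by
    intro u
    conv_lhs => rw [← S.frame.sum_eq v u]
    rw [Fin.sum_univ_three]
    simp [h0, h2]
  have hc : (0 : ℝ) < 1 / (n + 1 : ℝ) / (‖θ 1 w‖ + 1) := by positivity
  have hev := IsLittleO.def hA hc
  obtain ⟨δ, hδ, hball⟩ := Metric.eventually_nhds_iff.1 hev
  obtain ⟨N, hN⟩ := exists_nat_one_div_lt hδ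
  refine ⟨N, fun q hq => ?_⟩
  have h3 := hball (y := (q.1, T + q.2)) (by
    rw [dist_eq_norm]
    have : (q.1, T + q.2) - ((0 : E3), T) = q := by ext <;> simp
    rw [this]
    exact hq.trans_lt hN)
  simp only [← hw] at h3 ⊢
  set u' := φ (T + q.2) (v + q.1) - w
  rw [Real.norm_of_nonneg (by positivity)] at h3
  have h4 : θ 1 w u' = θ 1 w (transProj X θ w u' - A q.1) + θ 1 v q.1 * θ 1 w (A (X 1 v)) := by
    rw [map_sub (θ 1 w) _ (A q.1), S.coframe_transProj, hAu]; ring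
  have h5 : |θ 1 w (transProj X θ w u' - A q.1)| ≤ 1 / (n + 1 : ℝ) * (‖q.1‖ + ‖u'‖) := by
    have e1 := (θ 1 w).le_opNorm (transProj X θ w u' - A q.1)
    rw [Real.norm_eq_abs] at e1
    refine e1.trans ((mul_le_mul_of_nonneg_left h3 (norm_nonneg _)).trans ?_)
    have e2 : ‖θ 1 w‖ / (‖θ 1 w‖ + 1) ≤ 1 := by
      rw [div_le_one (by positivity)]; linarith
    calc _ = ‖θ 1 w‖ / (‖θ 1 w‖ + 1) * (1 / (n + 1 : ℝ) * (‖q.1‖ + ‖u'‖)) := by ring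
      _ ≤ 1 * (1 / (n + 1 : ℝ) * (‖q.1‖ + ‖u'‖)) := by gcongr
      _ = _ := one_mul _
  rw [h4]
  refine (abs_add_le _ _).trans ?_
  rw [abs_mul]
  have h6 : |θ 1 v q.1| * |θ 1 w (A (X 1 v))| ≤ K * |θ 1 v q.1| := by
    rw [mul_comm]; gcongr
  linarith

/-- Tested along a curve in the disc tangent to `X 2 v`: its initial center coordinate is `o(r)`, so
the distortion bound makes the final one `o(r)` too. -/
lemma transDeriv_eq_zero_of_distortion (S : StableSetting f g Es Ec Eu F X θ m φ)
    (hD : IsDiscFamily Ec Eu D) (hH : HasC1Holonomies g Es D) {v : E3} {T : ℝ}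
    {A : E3 →L[ℝ] E3} (hA : IsTransDeriv X θ φ v T A) {K : ℕ}
    (hK : ∀ n : ℕ, ∃ N : ℕ, (v, T) ∈ distortionSet θ φ K n N) :
    θ 1 (φ T v) (A (X 2 v)) = 0 := by
  obtain ⟨h, hh, -⟩ := hH (proj v) (proj (φ T v)) (S.proj_flow_mem_leaf T v)
  obtain ⟨h', hd, hL⟩ := S.hasFDerivAt_holonomy hD hA hh
  obtain ⟨τ, hτ, he⟩ := S.exists_holonomy_time hD hh
  obtain ⟨p, hp⟩ := S.exists_discDeriv_eq hD v (i := 2) (by decide)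
  set w := φ T v with hw
  have hα : HasFDerivAt (fun q => discAt D v q - v) (discDeriv D v) 0 :=
    (hD.hasStrictFDerivAt v).hasFDerivAt.sub_const v
  have hβ : HasFDerivAt (fun q => discAt D w (h q) - w) ((discDeriv D w).comp h') 0 := by
    have e0 := (hD.hasStrictFDerivAt w).hasFDerivAt
    rw [← hh.map_zero] at e0
    exact (e0.comp 0 hd).sub_const w
  have hr : HasDerivAt (fun r : ℝ => r • p) p 0 := by
    simpa using (hasDerivAt_id (0 : ℝ)).smul_const p
  have hr0 : Tendsto (fun r : ℝ => r • p) (𝓝 0) (𝓝 0) := by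
    simpa using hr.continuousAt.tendsto
  set a : ℝ → E3 := fun r => discAt D v (r • p) - v with ha
  set b : ℝ → E3 := fun r => discAt D w (h (r • p)) - w with hb
  have ha' : HasDerivAt a (X 2 v) 0 := by
    rw [← zero_smul ℝ p] at hα
    rw [← hp]
    exact hα.comp_hasDerivAt 0 hr
  have hb' : HasDerivAt b (A (X 2 v)) 0 := by
    rw [← zero_smul ℝ p] at hβ
    rw [← hp, ← hL]
    exact hβ.comp_hasDerivAt 0 hr
  have ha0 : a 0 = 0 := by simp [ha, discAt_zero]
  have hb0 : b 0 = 0 := by simp [hb, hh.map_zero, discAt_zero]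
  have hsum : (fun r => ‖a r‖ + ‖b r‖) =O[𝓝 0] fun r : ℝ => r := by
    refine isBigO_norm_add_norm ?_ ?_
    · simpa [ha0] using ha'.isBigO_sub
    · simpa [hb0] using hb'.isBigO_sub
  have hcoord : (fun r => θ 1 v (a r)) =o[𝓝 0] fun r : ℝ => r := by
    have e1 : HasDerivAt (fun r => θ 1 v (a r)) (θ 1 v (X 2 v)) 0 :=
      (θ 1 v).hasFDerivAt.comp_hasDerivAt 0 ha'
    rw [S.frame.dual, if_neg (by decide), hasDerivAt_iff_isLittleO] at e1
    simpa [ha0] using e1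
  have hmax : (fun r => max 0 (|θ 1 w (b r)| - K * |θ 1 v (a r)|)) =o[𝓝 0]
      fun r => ‖a r‖ + ‖b r‖ := by
    refine IsLittleO.of_bound fun c hc => ?_
    obtain ⟨n, hn⟩ := exists_nat_one_div_lt hc
    obtain ⟨N, hN⟩ := hK n
    have e1 : Tendsto (fun r => (a r, τ (r • p) - T)) (𝓝 0) (𝓝 (0, 0)) := by
      refine Tendsto.prodMk_nhds ?_ ?_
      · simpa [ha0] using ha'.continuousAt.tendsto
      · simpa using (hτ.comp hr0).sub_const T
    have e2 : ∀ᶠ r in 𝓝 0, ‖(a r, τ (r • p) - T)‖ < 1 / (N + 1 : ℝ) := by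
      have := e1.norm
      rw [Prod.mk_zero_zero, norm_zero] at this
      exact this.eventually (gt_mem_nhds (by positivity))
    filter_upwards [e2, hr0.eventually he] with r hr1 hr2
    have e3 := hN _ hr1.le
    have e4 : φ (T + (τ (r • p) - T)) (v + a r) - φ T v = b r := by
      simp only [ha, hb, add_sub_cancel, hr2, ← hw]
    simp only [e4] at e3
    rw [Real.norm_of_nonneg (le_max_left _ _), Real.norm_of_nonneg (by positivity)]
    refine max_le (by positivity) ?_
    have e5 : 1 / (n + 1 : ℝ) * (‖a r‖ + ‖b r‖) ≤ c * (‖a r‖ + ‖b r‖) := by gcongr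
    linarith
  have hb2 : (fun r => θ 1 w (b r)) =o[𝓝 0] fun r : ℝ => r := by
    have e1 := (hmax.trans_isBigO hsum).add ((hcoord.abs_left).const_mul_left (K : ℝ))
    refine IsBigO.trans_isLittleO (IsBigO.of_bound 1 (Eventually.of_forall fun r => ?_)) e1
    rw [one_mul, Real.norm_eq_abs, Real.norm_eq_abs]
    refine le_trans ?_ (le_abs_self _)
    linarith [le_max_right 0 (|θ 1 w (b r)| - K * |θ 1 v (a r)|)]
  have e1 : HasDerivAt (fun r => θ 1 w (b r)) (θ 1 w (A (X 2 v))) 0 :=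
    (θ 1 w).hasFDerivAt.comp_hasDerivAt 0 hb'
  have e2 : HasDerivAt (fun r => θ 1 w (b r)) 0 0 := by
    rw [hasDerivAt_iff_isLittleO]
    simpa [hb0] using hb2
  exact e1.unique e2

/-- Neither the discs nor `A` need vary measurably. The condition is therefore rewritten with the
continuous data `φ` and `θ` alone, as "for some `K`, for all errors, at some scale", with closed
sets inside. -/
lemma measurableSet_lifted_angle (S : StableSetting f g Es Ec Eu F X θ m φ)
    (hD : IsDiscFamily Ec Eu D) (hH : HasC1Holonomies g Es D) :
    MeasurableSet {p : E3 × ℝ | alpha g Es Eu D (proj p.1) (proj (φ p.2 p.1)) = 0} := by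
  have : {p : E3 × ℝ | alpha g Es Eu D (proj p.1) (proj (φ p.2 p.1)) = 0} =
      ⋃ K, ⋂ n, ⋃ N, distortionSet θ φ K n N := by
    ext ⟨v, T⟩
    simp only [Set.mem_ofPred_eq, Set.mem_iUnion, Set.mem_iInter]
    obtain ⟨A, hA, h0⟩ := S.exists_isTransDeriv hD hH v T
    rw [S.alpha_eq_zero_iff hD hH hA]
    exact ⟨S.exists_distortion_of_transDeriv hA h0,
      fun ⟨K, hK⟩ => S.transDeriv_eq_zero_of_distortion hD hH hA hK⟩
  rw [this]
  exact .iUnion fun K => .iInter fun n => .iUnion fun N =>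
    (S.isClosed_distortionSet K n N).measurableSet

/-- A fundamental domain of the covering of the torus. -/
def unitCube : Set E3 := {v | ∀ i, v i ∈ Set.Ico (0 : ℝ) 1}

lemma measurableSet_unitCube : MeasurableSet unitCube := by
  simp only [unitCube, Set.ofPred_forall]
  refine .iInter fun i => ?_
  have h : Continuous fun v : E3 => v i := by fun_prop
  exact h.measurable measurableSet_Ico

lemma proj_injOn_unitCube : Set.InjOn proj unitCube := by
  intro v hv w hw h
  have : Fact (0 < (1 : ℝ)) := ⟨one_pos⟩
  ext i
  have hi := congrFun h i
  exact (AddCircle.coe_eq_coe_iff_of_mem_Ico (p := 1) (a := 0) (by simpa using hv i)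
    (by simpa using hw i)).1 hi

lemma exists_mem_unitCube (x : T3) : ∃ v ∈ unitCube, proj v = x := by
  have : Fact (0 < (1 : ℝ)) := ⟨one_pos⟩
  have h : ∀ i, ∃ r : ℝ, r ∈ Set.Ico (0 : ℝ) 1 ∧ (r : UnitAddCircle) = x i := fun i => by
    have := (AddCircle.equivIco (1 : ℝ) 0 (x i)).2
    exact ⟨_, ⟨this.1, this.2.trans_eq (zero_add 1)⟩, AddCircle.coe_equivIco⟩
  choose r hr hx using h
  exact ⟨WithLp.toLp 2 r, fun i => hr i, funext fun i => hx i⟩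

/-- By the Lusin–Souslin theorem an injective continuous image of a Borel set is Borel. Injectivity
comes from the fundamental domain in the first coordinate and the absence of closed leaves in the
second. -/
lemma measurableSet_angleRel (S : StableSetting f g Es Ec Eu F X θ m φ)
    (hD : IsDiscFamily Ec Eu D) (hH : HasC1Holonomies g Es D) :
    MeasurableSet {q : T3 × T3 | angleRel g Es Eu D q.1 q.2} := by
  set ι : E3 × ℝ → T3 × T3 := fun p => (proj p.1, proj (φ p.2 p.1)) with hι
  have hιc : Continuous ι := (continuous_proj.comp continuous_fst).prodMk
    (continuous_proj.comp (S.flow.continuous.comp (continuous_snd.prodMk continuous_fst)))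
  have himg : {q : T3 × T3 | angleRel g Es Eu D q.1 q.2} = ι '' (unitCube ×ˢ Set.univ ∩
      {p : E3 × ℝ | alpha g Es Eu D (proj p.1) (proj (φ p.2 p.1)) = 0}) := by
    ext ⟨x, y⟩
    constructor
    · rintro ⟨hl, h0⟩
      obtain ⟨v, hv, rfl⟩ := exists_mem_unitCube x
      obtain ⟨t, rfl⟩ := S.mem_leaf_iff.1 hl
      exact ⟨(v, t), ⟨⟨hv, trivial⟩, h0⟩, rfl⟩
    · rintro ⟨⟨v, t⟩, ⟨-, h0⟩, h⟩
      obtain ⟨rfl, rfl⟩ := Prod.mk.inj h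
      exact ⟨S.proj_flow_mem_leaf t v, h0⟩
  rw [himg]
  refine MeasurableSet.image_of_continuousOn_injOn ((measurableSet_unitCube.prod .univ).inter
    (S.measurableSet_lifted_angle hD hH)) hιc.continuousOn ?_
  rintro ⟨v, s⟩ ⟨⟨hv, -⟩, -⟩ ⟨w, t⟩ ⟨⟨hw, -⟩, -⟩ h
  obtain ⟨h1, h2⟩ := Prod.mk.inj h
  obtain rfl := proj_injOn_unitCube hv hw h1
  exact Prod.ext rfl (S.proj_flow_injective h2)

end StableSetting

end ZeroOne

end

/-! ### Disintegrations and the abstract zero-one law -/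

noncomputable section

open ProbabilityTheory
open scoped ENNReal

namespace ZeroOne

/-! ### Disintegrations along a measurable map -/

/-- `κ` is a disintegration of `μ` along the fibres of `Q`. -/
def IsDisintegration {Ω Y : Type*} [MeasurableSpace Ω] [MeasurableSpace Y] (μ : Measure Ω)
    (Q : Ω → Y) (κ : Kernel Y Ω) : Prop :=
  ∀ Φ : Y × Ω → ℝ≥0∞, Measurable Φ →
    ∫⁻ x, Φ (Q x, x) ∂μ = ∫⁻ x, ∫⁻ z, Φ (Q x, z) ∂κ (Q x) ∂μ

section Disintegration

variable {Ω Y : Type*} [MeasurableSpace Ω] [MeasurableSpace Y] {μ : Measure Ω} {Q : Ω → Y}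
  {κ : Kernel Y Ω}

lemma exists_isDisintegration [StandardBorelSpace Ω] [Nonempty Ω] (μ : Measure Ω)
    [IsFiniteMeasure μ] {Q : Ω → Y} (hQ : Measurable Q) :
    ∃ κ : Kernel Y Ω, IsMarkovKernel κ ∧ IsDisintegration μ Q κ := by
  refine ⟨condDistrib id Q μ, inferInstance, fun Φ hΦ => ?_⟩
  have h := compProd_map_condDistrib (μ := μ) (X := Q) (Y := id) (mβ := ‹_›) aemeasurable_id
  have h1 := congrArg (fun ρ => ∫⁻ p, Φ p ∂ρ) h
  rw [Measure.lintegral_compProd hΦ, lintegral_map hΦ (hQ.prodMk measurable_id), lintegral_map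
    (Measurable.lintegral_kernel_prod_right (f := fun a b => Φ (a, b)) hΦ) hQ] at h1
  exact h1.symm

namespace IsDisintegration

/-- Both sides integrate over two independent points of a common fibre, so the two points are
exchangeable. -/
lemma lintegral_swap [IsMarkovKernel κ] (h : IsDisintegration μ Q κ)
    {Ψ : Ω → Ω → ℝ≥0∞} (hΨ : Measurable (Function.uncurry Ψ)) :
    ∫⁻ x, ∫⁻ y, Ψ x y ∂κ (Q x) ∂μ = ∫⁻ x, ∫⁻ y, Ψ y x ∂κ (Q x) ∂μ := by
  have e1 : Measurable fun p : Y × Ω => ∫⁻ y, Ψ p.2 y ∂κ p.1 := by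
    refine Measurable.lintegral_kernel_prod_right (κ := κ.comap Prod.fst measurable_fst)
      (f := fun (p : Y × Ω) y => Ψ p.2 y) ?_
    exact hΨ.comp ((measurable_snd.comp measurable_fst).prodMk measurable_snd)
  have e2 : Measurable fun p : Y × Ω => ∫⁻ y, Ψ y p.2 ∂κ p.1 := by
    refine Measurable.lintegral_kernel_prod_right (κ := κ.comap Prod.fst measurable_fst)
      (f := fun (p : Y × Ω) y => Ψ y p.2) ?_
    exact hΨ.comp (measurable_snd.prodMk (measurable_snd.comp measurable_fst))
  rw [h _ e1, h _ e2]
  refine lintegral_congr fun x => ?_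
  exact lintegral_lintegral_swap (μ := κ (Q x)) (ν := κ (Q x)) hΨ.aemeasurable

lemma ae_ae_mem [IsMarkovKernel κ] (h : IsDisintegration μ Q κ) (hQ : Measurable Q)
    {T : Set (Y × Ω)} (hT : MeasurableSet T) (hx : ∀ᵐ x ∂μ, (Q x, x) ∈ T) :
    ∀ᵐ x ∂μ, ∀ᵐ y ∂κ (Q x), (Q x, y) ∈ T := by
  have hm : Measurable (Tᶜ.indicator (1 : Y × Ω → ℝ≥0∞)) := measurable_one.indicator hT.compl
  have h1 := h _ hm
  have h2 : ∫⁻ x, Tᶜ.indicator (1 : Y × Ω → ℝ≥0∞) (Q x, x) ∂μ = 0 := by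
    refine lintegral_eq_zero_of_ae_eq_zero ?_
    filter_upwards [hx] with x hx
    exact Set.indicator_of_notMem (by simpa using hx) _
  have h0 : Measurable fun x => ∫⁻ z, Tᶜ.indicator (1 : Y × Ω → ℝ≥0∞) (Q x, z) ∂κ (Q x) :=
    (Measurable.lintegral_kernel_prod_right (κ := κ)
      (f := fun y z => Tᶜ.indicator (1 : Y × Ω → ℝ≥0∞) (y, z)) hm).comp hQ
  rw [h2, eq_comm, lintegral_eq_zero_iff h0] at h1
  filter_upwards [h1] with x h3
  have h4 : ∫⁻ z, Tᶜ.indicator (1 : Y × Ω → ℝ≥0∞) (Q x, z) ∂κ (Q x) = 0 := h3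
  rw [lintegral_eq_zero_iff (by fun_prop)] at h4
  filter_upwards [h4] with z hz
  by_contra hc
  rw [Set.indicator_of_mem (by simpa using hc)] at hz
  simp at hz

lemma ae_fiber [MeasurableEq Y] [IsMarkovKernel κ] (h : IsDisintegration μ Q κ)
    (hQ : Measurable Q) : ∀ᵐ x ∂μ, ∀ᵐ y ∂κ (Q x), Q y = Q x :=
  h.ae_ae_mem hQ (T := {p : Y × Ω | Q p.2 = p.1})
    (measurableSet_eq_fun (hQ.comp measurable_snd) measurable_fst) (ae_of_all _ fun _ => rfl)

lemma ae_ae [IsMarkovKernel κ] (h : IsDisintegration μ Q κ) (hQ : Measurable Q) {p : Ω → Prop}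
    (hp : ∀ᵐ x ∂μ, p x) : ∀ᵐ x ∂μ, ∀ᵐ y ∂κ (Q x), p y := by
  obtain ⟨N, hN, hNm, hN0⟩ := exists_measurable_superset_of_null hp
  have h1 := h.ae_ae_mem hQ (T := {q : Y × Ω | q.2 ∉ N})
    (measurable_snd hNm.compl) (measure_eq_zero_iff_ae_notMem.1 hN0)
  filter_upwards [h1] with x hx
  filter_upwards [hx] with y hy
  by_contra hc
  exact hy (hN hc)

/-- With `a = f ^ n` and `b = f ^ (-n)`: the conditional measures along `f ^ n ξ` are the images
under `f ^ n` of those along `ξ`. -/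
lemma map (h : IsDisintegration μ Q κ) {a b : Ω → Ω} (ha : Measurable a)
    (hb : MeasurePreserving b μ μ) (hba : ∀ x, a (b x) = x) (hQ : Measurable Q) [IsMarkovKernel κ] :
    IsDisintegration μ (Q ∘ b) (κ.map a) := by
  intro Φ hΦ
  have e1 : Measurable fun p : Y × Ω => Φ (p.1, a p.2) :=
    hΦ.comp (measurable_fst.prodMk (ha.comp measurable_snd))
  have e2 : Measurable fun x => Φ (Q x, a x) := e1.comp (hQ.prodMk measurable_id)
  have e3 : Measurable fun x => ∫⁻ z, Φ (Q x, a z) ∂κ (Q x) :=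
    (Measurable.lintegral_kernel_prod_right (κ := κ) (f := fun y z => Φ (y, a z)) e1).comp hQ
  have h1 := h _ e1
  simp only at h1
  rw [← hb.lintegral_comp e2, ← hb.lintegral_comp e3] at h1
  simp only [hba] at h1
  simp only [Function.comp_apply]
  rw [h1]
  refine lintegral_congr fun x => ?_
  rw [Kernel.map_apply _ ha, lintegral_map (f := fun z => Φ (Q (b x), z)) (by fun_prop) ha]

/-- Disintegrating along `Q` and then along the finer map `P` changes nothing. -/
lemma lintegral_tower [IsMarkovKernel κ] (h : IsDisintegration μ Q κ) {P : Ω → Y}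
    (hP : Measurable P) {η : Kernel Y Ω} [IsMarkovKernel η] (hη : IsDisintegration μ P η) {s : Y → Y}
    (hs : Measurable s) (hsP : ∀ x, Q x = s (P x)) {Ψ : Ω × Y × Ω → ℝ≥0∞} (hΨ : Measurable Ψ) :
    ∫⁻ x, ∫⁻ y, Ψ (x, P y, y) ∂κ (Q x) ∂μ =
      ∫⁻ x, ∫⁻ y, ∫⁻ z, Ψ (x, P y, z) ∂η (P y) ∂κ (Q x) ∂μ := by
  have m1 : Measurable fun p : Ω × Y => ∫⁻ z, Ψ (p.1, p.2, z) ∂η p.2 :=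
    Measurable.lintegral_kernel_prod_right (κ := η.comap Prod.snd measurable_snd)
      (f := fun (p : Ω × Y) z => Ψ (p.1, p.2, z)) (by unfold Function.uncurry; fun_prop)
  have m2 : Measurable fun p : Y × Ω => ∫⁻ x, Ψ (x, p.1, p.2) ∂κ (s p.1) :=
    Measurable.lintegral_kernel_prod_right
      (κ := κ.comap (fun p : Y × Ω => s p.1) (hs.comp measurable_fst))
      (f := fun (p : Y × Ω) x => Ψ (x, p.1, p.2)) (by unfold Function.uncurry; fun_prop)
  -- The swap makes `y` the base variable. As `κ (Q y)` is a function of `P y`, the disintegration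
  -- along `P` applies, and Tonelli's theorem reorders the inner integrals.
  rw [h.lintegral_swap (Ψ := fun x y => Ψ (x, P y, y)) (by unfold Function.uncurry; fun_prop),
    h.lintegral_swap (Ψ := fun x y => ∫⁻ z, Ψ (x, P y, z) ∂η (P y))
      (m1.comp (measurable_fst.prodMk (hP.comp measurable_snd)))]
  have e1 := hη _ m2
  simp only [← hsP] at e1
  rw [e1]
  refine lintegral_congr fun y => ?_
  refine lintegral_lintegral_swap (f := fun z x => Ψ (x, P y, z)) (Measurable.aemeasurable ?_)
  unfold Function.uncurry
  fun_prop

end IsDisintegration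

end Disintegration

end ZeroOne

end

noncomputable section

open ProbabilityTheory
open scoped ENNReal

namespace ZeroOne

/-! ### Conditional expectations on the fibred square -/

section FibredSquare

variable {Ω Y : Type*} [MeasurableSpace Ω] [MeasurableSpace Y] {μ : Measure Ω} {Q : Ω → Y}
  {κ : Kernel Y Ω}

/-- The σ-algebra on the square of a space generated by the first coordinate and by `P` applied to
the second one. -/
abbrev fibreAlgebra (P : Ω → Y) : MeasurableSpace (Ω × Ω) :=
  MeasurableSpace.comap (fun p : Ω × Ω => (p.1, P p.2)) inferInstance

lemma fibreAlgebra_le {P : Ω → Y} (hP : Measurable P) :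
    fibreAlgebra P ≤ (inferInstance : MeasurableSpace (Ω × Ω)) :=
  (measurable_fst.prodMk (hP.comp measurable_snd)).comap_le

lemma measurable_fibreAlgebra {P : Ω → Y} {Z : Type*} [MeasurableSpace Z] {u : Ω × Y → Z}
    (hu : Measurable u) : Measurable[fibreAlgebra P] fun p : Ω × Ω => u (p.1, P p.2) :=
  hu.comp (comap_measurable _)

lemma measurable_prodMk_pi {A B : Type*} {mA : MeasurableSpace A} [MeasurableSpace B] {a : A → B}
    {b : ℕ → A → Y} (ha : Measurable a) (hb : ∀ n, Measurable (b n)) :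
    Measurable fun p => (a p, fun n => b n p) :=
  ha.prodMk (measurable_pi_lambda _ hb)

lemma fibreAlgebra_mono {P P' : Ω → Y} {s : Y → Y} (hs : Measurable s) (h : ∀ x, P x = s (P' x)) :
    fibreAlgebra P ≤ fibreAlgebra P' := by
  refine Measurable.comap_le ?_
  simp only [h]
  exact measurable_fibreAlgebra (P := P') (u := fun q => (q.1, s q.2))
    (measurable_fst.prodMk (hs.comp measurable_snd))

/-- Sets of `fibreAlgebra P` are conditions on `(x, P y)`. By `lintegral_tower`, resampling `y` from
`η` within its `P`-fibre does not change integrals over them. -/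
lemma IsDisintegration.condExp_fibre [IsProbabilityMeasure μ] [IsMarkovKernel κ]
    (h : IsDisintegration μ Q κ) (hQ : Measurable Q) {P : Ω → Y}
    (hP : Measurable P) {η : Kernel Y Ω} [IsMarkovKernel η] (hη : IsDisintegration μ P η) {s : Y → Y}
    (hs : Measurable s) (hsP : ∀ x, Q x = s (P x)) {R : Set (Ω × Ω)} (hR : MeasurableSet R) :
    (fun p : Ω × Ω => (η (P p.2) {z | (p.1, z) ∈ R}).toReal) =ᵐ[μ ⊗ₘ κ.comap Q hQ]
      (μ ⊗ₘ κ.comap Q hQ)[R.indicator (1 : Ω × Ω → ℝ) | fibreAlgebra P] := by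
  set ν := μ ⊗ₘ κ.comap Q hQ with hν
  have hm : Measurable fun q : Ω × Y => η q.2 {z | (q.1, z) ∈ R} :=
    Kernel.measurable_kernel_prodMk_left (κ := η.comap Prod.snd measurable_snd)
      (t := {r : (Ω × Y) × Ω | (r.1.1, r.2) ∈ R})
      (hR.preimage ((measurable_fst.comp measurable_fst).prodMk measurable_snd))
  have hmF := (measurable_fibreAlgebra (P := P) hm).ennreal_toReal
  have hm' : Measurable fun p : Ω × Ω => η (P p.2) {z | (p.1, z) ∈ R} :=
    hm.comp (measurable_fst.prodMk (hP.comp measurable_snd))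
  have hKint : Integrable (fun p : Ω × Ω => (η (P p.2) {z | (p.1, z) ∈ R}).toReal) ν := by
    refine Integrable.of_bound hm'.ennreal_toReal.aestronglyMeasurable 1 (ae_of_all _ fun p => ?_)
    rw [Real.norm_of_nonneg ENNReal.toReal_nonneg]
    exact ENNReal.toReal_le_of_le_ofReal zero_le_one (by simpa using prob_le_one)
  refine ae_eq_condExp_of_forall_setIntegral_eq (fibreAlgebra_le hP)
    ((integrable_const (1 : ℝ)).indicator hR) (fun _ _ _ => hKint.integrableOn) ?_
    hmF.aestronglyMeasurable
  rintro S ⟨T, hT, rfl⟩ -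
  set S := (fun p : Ω × Ω => (p.1, P p.2)) ⁻¹' T with hSdef
  have hS : MeasurableSet S := fibreAlgebra_le hP _ ⟨T, hT, rfl⟩
  have key : ∫⁻ p in S, η (P p.2) {z | (p.1, z) ∈ R} ∂ν = ν (R ∩ S) := by
    have hΨ : Measurable fun q : Ω × Y × Ω => T.indicator (1 : Ω × Y → ℝ≥0∞) (q.1, q.2.1) *
        R.indicator (1 : Ω × Ω → ℝ≥0∞) (q.1, q.2.2) := by
      refine Measurable.mul ?_ ?_
      · exact (measurable_one.indicator hT).comp
          (measurable_fst.prodMk (measurable_fst.comp measurable_snd))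
      · exact (measurable_one.indicator hR).comp
          (measurable_fst.prodMk (measurable_snd.comp measurable_snd))
    have h1 := h.lintegral_tower hP hη hs hsP hΨ
    rw [← lintegral_indicator hS, ← lintegral_indicator_one (hR.inter hS), hν,
      Measure.lintegral_compProd (hm'.indicator hS),
      Measure.lintegral_compProd (measurable_one.indicator (hR.inter hS))]
    refine Eq.trans ?_ (h1.symm.trans ?_)
    · refine lintegral_congr fun x => lintegral_congr fun y => ?_
      dsimp only
      rw [lintegral_const_mul (f := fun z => R.indicator (1 : Ω × Ω → ℝ≥0∞) (x, z)) _
        ((measurable_one.indicator hR).comp (measurable_const.prodMk measurable_id))]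
      have e1 : ∫⁻ z, R.indicator (1 : Ω × Ω → ℝ≥0∞) (x, z) ∂η (P y) = η (P y) {z | (x, z) ∈ R} := by
        have e2 : MeasurableSet {z | (x, z) ∈ R} :=
          hR.preimage (measurable_const.prodMk measurable_id)
        exact lintegral_indicator_one e2
      rw [e1]
      by_cases hxy : (x, P y) ∈ T
      · rw [Set.indicator_of_mem (show (x, y) ∈ S from hxy), Set.indicator_of_mem hxy]
        simp
      · rw [Set.indicator_of_notMem (show (x, y) ∉ S from hxy), Set.indicator_of_notMem hxy]
        simp
    · refine lintegral_congr fun x => lintegral_congr fun y => ?_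
      rw [Set.inter_comm, Set.inter_indicator_one]
      rfl
  rw [integral_toReal hm'.aemeasurable.restrict (ae_of_all _ fun p => measure_lt_top _ _), key,
    integral_indicator_one hR, Measure.real, Measure.restrict_apply hR]

/-- Lévy's upward theorem. Off a null set the codes `P n` separate points, so `J` is injective
there; by Lusin–Souslin `R` then agrees almost everywhere with a set of the limit σ-algebra. -/
lemma tendsto_condExp_fibre [StandardBorelSpace Ω] [StandardBorelSpace Y] {ν : Measure (Ω × Ω)}
    [IsFiniteMeasure ν] {P : ℕ → Ω → Y} (hP : ∀ n, Measurable (P n)) {s : Y → Y} (hs : Measurable s)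
    (hsP : ∀ n x, P n x = s (P (n + 1) x)) {N : Set Ω} (hNm : MeasurableSet N)
    (hN : ν (Prod.snd ⁻¹' N) = 0)
    (hgen : ∀ x ∉ N, ∀ y ∉ N, (∀ n, P n x = P n y) → x = y)
    {R : Set (Ω × Ω)} (hR : MeasurableSet R) :
    ∀ᵐ p ∂ν, p ∈ R →
      Tendsto (fun n => (ν[R.indicator (1 : Ω × Ω → ℝ) | fibreAlgebra (P n)]) p) atTop (𝓝 1) := by
  let ℱ : Filtration ℕ (inferInstance : MeasurableSpace (Ω × Ω)) :=
    { seq := fun n => fibreAlgebra (P n)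
      mono' := monotone_nat_of_le_succ fun n => fibreAlgebra_mono hs (hsP n)
      le' := fun n => fibreAlgebra_le (hP n) }
  let J : Ω × Ω → Ω × (ℕ → Y) := fun p => (p.1, fun n => P n p.2)
  have hJ : Measurable J := measurable_fst.prodMk (measurable_pi_lambda _ fun n =>
    (hP n).comp measurable_snd)
  have hJF : Measurable[⨆ n, ℱ n] J := by
    refine measurable_prodMk_pi ?_ fun n => ?_
    · exact (measurable_fibreAlgebra (P := P 0) (u := Prod.fst) measurable_fst).mono
        (le_iSup (fun n => ℱ n) 0) le_rfl
    · exact (measurable_fibreAlgebra (P := P n) (u := Prod.snd) measurable_snd).mono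
        (le_iSup (fun n => ℱ n) n) le_rfl
  have hN' : MeasurableSet (Prod.snd ⁻¹' Nᶜ : Set (Ω × Ω)) := measurable_snd hNm.compl
  have hinj : Set.InjOn J (Prod.snd ⁻¹' Nᶜ) := by
    rintro ⟨x, y⟩ hy ⟨x', y'⟩ hy' he
    obtain ⟨h1, h2⟩ := Prod.mk.inj he
    exact Prod.ext h1 (hgen y hy y' hy' fun n => congrFun h2 n)
  set W := J '' (R ∩ Prod.snd ⁻¹' Nᶜ) with hW
  have hWm : MeasurableSet W := (hR.inter hN').image_of_measurable_injOn hJ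
    (hinj.mono Set.inter_subset_right)
  have hmem : ∀ p : Ω × Ω, p.2 ∉ N → (p ∈ J ⁻¹' W ↔ p ∈ R) := by
    intro p hp
    constructor
    · rintro ⟨p', ⟨hp'R, hp'N⟩, he⟩
      rwa [← hinj hp'N hp he]
    · exact fun hpR => ⟨p, ⟨hpR, hp⟩, rfl⟩
  have hNae : ∀ᵐ p ∂ν, p.2 ∉ N := measure_eq_zero_iff_ae_notMem.1 hN
  have hae : R.indicator (1 : Ω × Ω → ℝ) =ᵐ[ν] (J ⁻¹' W).indicator 1 := by
    filter_upwards [hNae] with p hp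
    by_cases hpR : p ∈ R
    · rw [Set.indicator_of_mem hpR, Set.indicator_of_mem ((hmem p hp).2 hpR)]
    · rw [Set.indicator_of_notMem hpR, Set.indicator_of_notMem (mt (hmem p hp).1 hpR)]
  have hlevy := Integrable.tendsto_ae_condExp (ℱ := ℱ)
    (((integrable_const (1 : ℝ)).indicator (hJ hWm) : Integrable _ ν))
    (stronglyMeasurable_one.indicator (hJF hWm))
  have hall := ae_all_iff.2 fun n => condExp_congr_ae (m := fibreAlgebra (P n)) hae
  filter_upwards [hNae, hlevy, hall] with p hp h1 h2 hpR
  have h3 : (J ⁻¹' W).indicator (fun _ => (1 : ℝ)) p = 1 :=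
    Set.indicator_of_mem ((hmem p hp).2 hpR) _
  rw [h3] at h1
  refine h1.congr fun n => ?_
  exact (h2 n).symm

end FibredSquare

end ZeroOne

end

noncomputable section

open ProbabilityTheory
open scoped ENNReal

namespace ZeroOne

/-! ### The zero-one law for invariant relations on expanding fibres -/

section ZeroOneLaw

variable {Ω Y : Type*} [MeasurableSpace Ω] [MeasurableSpace Y] {μ : Measure Ω} {Q : Ω → Y}
  {κ : Kernel Y Ω}

lemma IsDisintegration.ae_swap [IsMarkovKernel κ] (h : IsDisintegration μ Q κ) (hQ : Measurable Q)
    {T : Set (Ω × Ω)} (hT : MeasurableSet T) (hx : ∀ᵐ x ∂μ, ∀ᵐ y ∂κ (Q x), (x, y) ∈ T) :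
    ∀ᵐ x ∂μ, ∀ᵐ y ∂κ (Q x), (y, x) ∈ T := by
  have hm : Measurable (Tᶜ.indicator (1 : Ω × Ω → ℝ≥0∞)) := measurable_one.indicator hT.compl
  have h1 := h.lintegral_swap (Ψ := fun x y => Tᶜ.indicator (1 : Ω × Ω → ℝ≥0∞) (x, y)) hm
  have h2 : ∫⁻ x, ∫⁻ y, Tᶜ.indicator (1 : Ω × Ω → ℝ≥0∞) (x, y) ∂κ (Q x) ∂μ = 0 := by
    refine lintegral_eq_zero_of_ae_eq_zero ?_
    filter_upwards [hx] with x hx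
    refine lintegral_eq_zero_of_ae_eq_zero ?_
    filter_upwards [hx] with y hy
    exact Set.indicator_of_notMem (by simpa using hy) _
  have h0 : Measurable fun x => ∫⁻ y, Tᶜ.indicator (1 : Ω × Ω → ℝ≥0∞) (y, x) ∂κ (Q x) :=
    Measurable.lintegral_kernel_prod_right (κ := κ.comap Q hQ)
      (f := fun x y => Tᶜ.indicator (1 : Ω × Ω → ℝ≥0∞) (y, x)) (hm.comp measurable_swap)
  rw [h2, eq_comm, lintegral_eq_zero_iff h0] at h1
  filter_upwards [h1] with x h3
  have h4 : ∫⁻ y, Tᶜ.indicator (1 : Ω × Ω → ℝ≥0∞) (y, x) ∂κ (Q x) = 0 := h3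
  rw [lintegral_eq_zero_iff (by fun_prop)] at h4
  filter_upwards [h4] with z hz
  by_contra hc
  rw [Set.indicator_of_mem (by simpa using hc)] at hz
  simp at hz

lemma IsDisintegration.ae_compProd_snd [IsProbabilityMeasure μ] [IsMarkovKernel κ]
    (h : IsDisintegration μ Q κ) (hQ : Measurable Q) {p : Ω → Prop} (hp : ∀ᵐ x ∂μ, p x) :
    ∀ᵐ q ∂(μ ⊗ₘ κ.comap Q hQ), p q.2 := by
  obtain ⟨N, hN, hNm, hN0⟩ := exists_measurable_superset_of_null hp
  have h1 : ∀ᵐ q ∂(μ ⊗ₘ κ.comap Q hQ), q.2 ∉ N :=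
    (Measure.ae_compProd_iff (measurable_snd hNm.compl)).2
      (h.ae_ae hQ (measure_eq_zero_iff_ae_notMem.1 hN0))
  filter_upwards [h1] with q hq
  by_contra hc
  exact hq (hN hc)

/-- A function that tends to one along the backward orbit of almost every point where it does not
vanish is almost everywhere zero, or almost everywhere one. -/
lemma ae_eq_one_or_zero_of_tendsto [IsProbabilityMeasure μ] (f : Ω ≃ᵐ Ω) (hf : Ergodic f μ)
    {K : Ω → ℝ} (hKm : Measurable K) (hK0 : ∀ x, 0 ≤ K x) (hK1 : ∀ x, K x ≤ 1)
    (h : ∀ᵐ x ∂μ, K x ≠ 0 → Tendsto (fun n => K (f.symm^[n] x)) atTop (𝓝 1)) :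
    (∀ᵐ x ∂μ, K x = 1) ∨ ∀ᵐ x ∂μ, K x = 0 := by
  have hfs : MeasurePreserving f.symm μ μ := hf.toMeasurePreserving.symm f
  set G := {x | Tendsto (fun n => K (f.symm^[n] x)) atTop (𝓝 1)} with hG
  have hGm : MeasurableSet G :=
    measurableSet_tendsto (𝓝 1) fun n => hKm.comp (f.symm.measurable.iterate n)
  have hGinv : f ⁻¹' G = G := by
    ext x
    have e1 : ∀ n, K (f.symm^[n + 1] (f x)) = K (f.symm^[n] x) := fun n => by
      rw [Function.iterate_succ_apply, f.symm_apply_apply]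
    change Tendsto (fun n => K (f.symm^[n] (f x))) atTop (𝓝 1) ↔ _
    rw [← tendsto_add_atTop_iff_nat 1]
    simp only [e1]
    rfl
  rcases hf.toPreErgodic.ae_empty_or_univ hGm hGinv with h0 | h1
  · right
    filter_upwards [h, h0] with x hx hx0
    by_contra hc
    have : x ∈ G := hx hc
    exact (Eq.mp hx0 this : x ∈ (∅ : Set Ω))
  · left
    -- The integrals of `K ∘ f ^ (-n)` tend to one but do not depend on `n`, so `K ≤ 1` has integral
    -- one.
    have hlim : Tendsto (fun n => ∫ x, K (f.symm^[n] x) ∂μ) atTop (𝓝 (∫ _, (1 : ℝ) ∂μ)) := by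
      refine tendsto_integral_of_dominated_convergence (fun _ => 1)
        (fun n => (hKm.comp (f.symm.measurable.iterate n)).aestronglyMeasurable)
        (integrable_const 1) (fun n => ae_of_all _ fun x => ?_) ?_
      · rw [Real.norm_of_nonneg (hK0 _)]
        exact hK1 _
      · filter_upwards [h1] with x hx
        exact (Eq.mpr hx trivial : x ∈ G)
    have hconst : ∀ n, ∫ x, K (f.symm^[n] x) ∂μ = ∫ x, K x ∂μ := fun n => by
      have e1 := integral_map (μ := μ) (hfs.iterate n).measurable.aemeasurable (f := K)
        hKm.aestronglyMeasurable
      rw [(hfs.iterate n).map_eq] at e1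
      exact e1.symm
    simp only [hconst] at hlim
    have heq := tendsto_nhds_unique tendsto_const_nhds hlim
    have hKi : Integrable K μ := Integrable.of_bound hKm.aestronglyMeasurable 1
      (ae_of_all _ fun x => by rw [Real.norm_of_nonneg (hK0 x)]; exact hK1 x)
    exact (integral_eq_iff_of_ae_le hKi (integrable_const 1) (ae_of_all _ hK1)).1 heq

/-- The conditional probability of `R` given `x` and the level-`n` fibre of `y` tends to one on `R`.
When `R x y` holds, symmetry and transitivity replace the class of `x` by that of `y`, and
invariance pulls the mass back by `f ^ n` to the point `f ^ (-n) y`. -/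
lemma IsDisintegration.ae_tendsto_of_related [StandardBorelSpace Ω] [StandardBorelSpace Y]
    [IsProbabilityMeasure μ] [IsMarkovKernel κ] (h : IsDisintegration μ Q κ) (hQ : Measurable Q)
    (f : Ω ≃ᵐ Ω) (hf : MeasurePreserving f μ μ) {s : Y → Y} (hs : Measurable s)
    (hQs : ∀ x, Q (f x) = s (Q x))
    (hgen : ∃ N, μ N = 0 ∧ ∀ x ∉ N, ∀ y ∉ N,
      (∀ n, Q (f.symm^[n] x) = Q (f.symm^[n] y)) → x = y)
    {L R : Ω → Ω → Prop} (hR : MeasurableSet {p : Ω × Ω | R p.1 p.2})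
    (hsymm : ∀ {x y}, R x y → R y x) (htrans : ∀ {x y z}, R x y → R y z → R x z)
    (hL : ∀ᵐ x ∂μ, ∀ᵐ y ∂κ (Q x), L x y)
    (hLR : ∀ n x y, L x y → (R (f^[n] x) (f^[n] y) ↔ R x y)) :
    ∀ᵐ p ∂(μ ⊗ₘ κ.comap Q hQ), R p.1 p.2 →
      Tendsto (fun n => (κ (Q (f.symm^[n] p.2)) {y | R (f.symm^[n] p.2) y}).toReal) atTop (𝓝 1) := by
  have hfs : MeasurePreserving f.symm μ μ := hf.symm f
  have hP : ∀ n, Measurable fun x => Q (f.symm^[n] x) := fun n =>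
    hQ.comp (f.symm.measurable.iterate n)
  have hright : ∀ n x, f^[n] (f.symm^[n] x) = x := fun n =>
    Function.RightInverse.iterate f.apply_symm_apply n
  have hPs : ∀ n x, Q (f.symm^[n] x) = s (Q (f.symm^[n + 1] x)) := fun n x => by
    rw [← hQs, Function.iterate_succ_apply', f.apply_symm_apply]
  have hPQ : ∀ n x, Q x = s^[n] (Q (f.symm^[n] x)) := by
    intro n
    induction n with
    | zero => intro x; rfl
    | succ n ih => intro x; rw [Function.iterate_succ_apply, ← hPs, ih x]
  have hη : ∀ n, IsDisintegration μ (fun x => Q (f.symm^[n] x)) (κ.map f^[n]) := fun n =>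
    h.map (f.measurable.iterate n) (hfs.iterate n) (hright n) hQ
  have hηM : ∀ n, IsMarkovKernel (κ.map f^[n]) := fun n =>
    Kernel.IsMarkovKernel.map _ (f.measurable.iterate n)
  obtain ⟨N₀, hN₀, hN₀gen⟩ := hgen
  obtain ⟨N, hNN, hNm, hN⟩ := exists_measurable_superset_of_null hN₀
  have hsnd : (μ ⊗ₘ κ.comap Q hQ) (Prod.snd ⁻¹' N) = 0 := measure_eq_zero_iff_ae_notMem.2
    (h.ae_compProd_snd hQ (measure_eq_zero_iff_ae_notMem.1 hN))
  have hlevy := tendsto_condExp_fibre hP hs hPs hNm hsnd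
    (fun x hx y hy => hN₀gen x (fun hc => hx (hNN hc)) y (fun hc => hy (hNN hc))) hR
  have hcond := ae_all_iff.2 fun n =>
    h.condExp_fibre hQ (hP n) (hη n) (hs.iterate n) (hPQ n) hR
  have hLn : ∀ᵐ y ∂μ, ∀ n, ∀ᵐ z ∂κ (Q (f.symm^[n] y)), L (f.symm^[n] y) z :=
    ae_all_iff.2 fun n => (hfs.iterate n).quasiMeasurePreserving.ae hL
  filter_upwards [hlevy, hcond, h.ae_compProd_snd hQ hLn] with p h1 h2 h3 hpR
  refine (h1 hpR).congr fun n => ?_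
  have e0 : MeasurableSet {z | R p.1 z} :=
    hR.preimage (measurable_const.prodMk measurable_id)
  rw [← h2 n, Kernel.map_apply' _ (f.measurable.iterate n) _ e0]
  refine congrArg ENNReal.toReal (measure_congr ?_)
  filter_upwards [h3 n] with z hz
  have e1 := hLR n _ _ hz
  rw [hright] at e1
  refine propext (Iff.trans ⟨fun h4 => ?_, fun h4 => ?_⟩ e1)
  · exact htrans (hsymm hpR) h4
  · exact htrans hpR h4

/-- The hypothesis concerns second coordinates of related pairs. By exchangeability, a typical point
whose class has positive mass occurs as such a coordinate. -/
lemma IsDisintegration.ae_mem_of_related [IsProbabilityMeasure μ] [IsMarkovKernel κ]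
    (h : IsDisintegration μ Q κ) (hQ : Measurable Q) {R : Ω → Ω → Prop}
    (hR : MeasurableSet {p : Ω × Ω | R p.1 p.2}) (hsymm : ∀ {x y}, R x y → R y x) {G : Set Ω}
    (hG : MeasurableSet G) (hRG : ∀ᵐ p ∂(μ ⊗ₘ κ.comap Q hQ), R p.1 p.2 → p.2 ∈ G) :
    ∀ᵐ x ∂μ, κ (Q x) {y | R x y} ≠ 0 → x ∈ G := by
  have hT : MeasurableSet {p : Ω × Ω | R p.1 p.2 → p.2 ∈ G} := by
    have : {p : Ω × Ω | R p.1 p.2 → p.2 ∈ G} = {p : Ω × Ω | R p.1 p.2}ᶜ ∪ Prod.snd ⁻¹' G := by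
      ext p
      exact imp_iff_not_or
    rw [this]
    exact hR.compl.union (measurable_snd hG)
  have h1 := Measure.ae_ae_of_ae_compProd hRG
  simp only [Kernel.comap_apply] at h1
  filter_upwards [h.ae_swap hQ hT h1] with x hx hKx
  by_contra hc
  refine hKx (measure_eq_zero_iff_ae_notMem.2 ?_)
  filter_upwards [hx] with y hy hxy
  have h2 : R x y := hxy
  have h3 : R y x → x ∈ G := hy
  exact hc (h3 (hsymm h2))

theorem ae_one_or_zero_of_invariant_relation [StandardBorelSpace Ω] [StandardBorelSpace Y]
    [IsProbabilityMeasure μ] [IsMarkovKernel κ] (h : IsDisintegration μ Q κ) (hQ : Measurable Q)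
    (f : Ω ≃ᵐ Ω) (hf : Ergodic f μ) {s : Y → Y} (hs : Measurable s) (hQs : ∀ x, Q (f x) = s (Q x))
    (hgen : ∃ N, μ N = 0 ∧ ∀ x ∉ N, ∀ y ∉ N,
      (∀ n, Q (f.symm^[n] x) = Q (f.symm^[n] y)) → x = y)
    {L R : Ω → Ω → Prop} (hR : MeasurableSet {p : Ω × Ω | R p.1 p.2})
    (hsymm : ∀ {x y}, R x y → R y x) (htrans : ∀ {x y z}, R x y → R y z → R x z)
    (hL : ∀ᵐ x ∂μ, ∀ᵐ y ∂κ (Q x), L x y)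
    (hLR : ∀ n x y, L x y → (R (f^[n] x) (f^[n] y) ↔ R x y)) :
    (∀ᵐ x ∂μ, κ (Q x) {y | R x y} = 1) ∨ ∀ᵐ x ∂μ, κ (Q x) {y | R x y} = 0 := by
  have hKm : Measurable fun x => κ (Q x) {y | R x y} :=
    Kernel.measurable_kernel_prodMk_left (κ := κ.comap Q hQ) hR
  have hconv := h.ae_tendsto_of_related hQ f hf.toMeasurePreserving hs hQs hgen hR hsymm htrans
    hL hLR
  have hG : MeasurableSet {x | Tendsto (fun n => (κ (Q (f.symm^[n] x))
      {y | R (f.symm^[n] x) y}).toReal) atTop (𝓝 1)} :=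
    measurableSet_tendsto (𝓝 1) fun n => hKm.ennreal_toReal.comp (f.symm.measurable.iterate n)
  have hdich : ∀ᵐ x ∂μ, (κ (Q x) {y | R x y}).toReal ≠ 0 → Tendsto (fun n =>
      (κ (Q (f.symm^[n] x)) {y | R (f.symm^[n] x) y}).toReal) atTop (𝓝 1) := by
    filter_upwards [h.ae_mem_of_related hQ hR hsymm hG hconv] with x hx hKx
    exact hx fun h0 => hKx (by rw [h0, ENNReal.toReal_zero])
  have hle : ∀ x, κ (Q x) {y | R x y} ≤ 1 := fun x => prob_le_one
  rcases ae_eq_one_or_zero_of_tendsto f hf hKm.ennreal_toReal (fun x => ENNReal.toReal_nonneg)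
    (fun x => ENNReal.toReal_le_of_le_ofReal zero_le_one (by simpa using hle x)) hdich with h1 | h0
  · left
    filter_upwards [h1] with x hx
    exact (ENNReal.toReal_eq_one_iff _).1 hx
  · right
    filter_upwards [h0] with x hx
    exact ((ENNReal.toReal_eq_zero_iff _).1 hx).resolve_right (measure_ne_top _ _)

end ZeroOneLaw

end ZeroOne

end

noncomputable section

open ProbabilityTheory
open scoped ENNReal

namespace ZeroOne

/-! ### Uniqueness of systems of conditional measures -/

/-- A countable generating algebra needs only countably many exceptional null sets and determines a
probability measure. -/
lemma ae_eq_of_forall_ae_apply_eq {Ω : Type*} [mΩ : MeasurableSpace Ω]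
    [MeasurableSpace.CountablyGenerated Ω] {μ : Measure Ω} {ρ ρ' : Ω → Measure Ω}
    (hρ : ∀ᵐ x ∂μ, IsProbabilityMeasure (ρ x)) (hρ' : ∀ᵐ x ∂μ, IsProbabilityMeasure (ρ' x))
    (h : ∀ A, MeasurableSet A → ∀ᵐ x ∂μ, ρ x A = ρ' x A) : ∀ᵐ x ∂μ, ρ x = ρ' x := by
  set C := generateSetAlgebra (MeasurableSpace.countableGeneratingSet Ω) with hC
  have hCc : C.Countable :=
    countable_generateSetAlgebra MeasurableSpace.countable_countableGeneratingSet
  have hgen : mΩ = MeasurableSpace.generateFrom C := by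
    rw [hC, generateFrom_generateSetAlgebra_eq, MeasurableSpace.generateFrom_countableGeneratingSet]
  have hpi : IsPiSystem C := fun s hs t ht _ =>
    isSetAlgebra_generateSetAlgebra.inter_mem hs ht
  have hall : ∀ᵐ x ∂μ, ∀ A ∈ C, ρ x A = ρ' x A := by
    exact (ae_ball_iff hCc).2 fun A hA =>
      h A (hgen.ge A (MeasurableSpace.measurableSet_generateFrom hA))
  filter_upwards [hρ, hρ', hall] with x h1 h2 h3
  exact ext_of_generate_finite C hgen hpi h3 (by rw [measure_univ, measure_univ])

namespace IsConditionalSystem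

variable {μ : Measure T3} {ξ : Setoid T3} {μs : T3 → Measure T3}

lemma ae_null (h : IsConditionalSystem μ ξ μs) {N : Set T3} (hN : μ N = 0) :
    ∀ᵐ x ∂μ, μs x N = 0 := by
  obtain ⟨M, hNM, hMm, hM⟩ := exists_measurable_superset_of_null hN
  have h1 := h.disintegration M hMm
  rw [hM, eq_comm, lintegral_eq_zero_iff' (h.aemeasurable M hMm)] at h1
  filter_upwards [h1] with x hx
  exact measure_mono_null hNM hx

lemma ae_atom (h : IsConditionalSystem μ ξ μs) (hξ : IsMeasurablePartition ξ) :
    ∀ᵐ x ∂μ, ∀ᵐ y ∂μs x, y ∈ atom ξ x := by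
  obtain ⟨k, q, hq, hqξ⟩ := hξ
  have hm : ∀ x, MeasurableSet (atom ξ x) := by
    intro x
    have : atom ξ x = ⋂ n, q n ⁻¹' {q n x} := by
      ext y
      simp only [Set.mem_iInter, Set.mem_preimage, Set.mem_singleton_iff]
      exact (hqξ x y).trans (forall_congr' fun n => eq_comm)
    rw [this]
    exact .iInter fun n => hq n (measurableSet_singleton _)
  filter_upwards [h.isProbability, h.atom_full] with x h1 h2
  exact (mem_ae_iff_prob_eq_one (hm x)).2 h2

variable {Y : Type*} [MeasurableSpace Y] {Q : T3 → Y} {κ : Kernel Y T3} [IsMarkovKernel κ]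

lemma ae_apply_eq [MeasurableEq Y] [IsProbabilityMeasure μ] (h : IsConditionalSystem μ ξ μs)
    (hξ : IsMeasurablePartition ξ) (hQ : Measurable Q)
    (hQξ : ∀ x y, Q x = Q y → ξ x y) (hξQ : ∃ N, μ N = 0 ∧ ∀ x ∉ N, ∀ y ∉ N, ξ x y → Q x = Q y)
    (hκ : IsDisintegration μ Q κ) {A : Set T3} (hA : MeasurableSet A) :
    ∀ᵐ x ∂μ, μs x A = κ (Q x) A := by
  have hfib : ∀ᵐ x ∂μ, ∀ᵐ y ∂μs x, Q y = Q x := by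
    obtain ⟨N, hN, hNQ⟩ := hξQ
    filter_upwards [h.ae_atom hξ, h.ae_null hN, measure_eq_zero_iff_ae_notMem.1 hN] with x h1 h2 h3
    filter_upwards [h1, measure_eq_zero_iff_ae_notMem.1 h2] with y h4 h5
    exact (hNQ x h3 y h5 h4).symm
  have hae := h.aemeasurable A hA
  -- Averaging a measurable version over the fibres of `Q` gives a Borel function of `Q x`. By
  -- constancy on atoms it still equals `μs x A` almost everywhere, so comparing integrals over the
  -- sets `Q ⁻¹' T` suffices.
  have hp : Measurable fun q => ∫⁻ y, hae.mk _ y ∂κ q := hae.measurable_mk.lintegral_kernel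
  have hpQ : ∀ᵐ x ∂μ, ∫⁻ y, hae.mk _ y ∂κ (Q x) = μs x A := by
    obtain ⟨N, hN, hconst⟩ := h.const_on_atoms
    have hN' := measure_eq_zero_iff_ae_notMem.1 hN
    filter_upwards [hN', hκ.ae_fiber hQ, hκ.ae_ae hQ hN', hκ.ae_ae hQ hae.ae_eq_mk] with x h1 h2 h3 h4
    have h5 : ∀ᵐ y ∂κ (Q x), hae.mk _ y = μs x A := by
      filter_upwards [h2, h3, h4] with y h6 h7 h8
      rw [← h8, hconst x h1 y h7 (hQξ x y h6.symm)]
    rw [lintegral_congr_ae h5, lintegral_const, measure_univ, mul_one]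
  have hκA : Measurable fun q => κ q A := κ.measurable_coe hA
  have key : (fun q => ∫⁻ y, hae.mk _ y ∂κ q) =ᵐ[μ.map Q] fun q => κ q A := by
    have : IsProbabilityMeasure (μ.map Q) := Measure.isProbabilityMeasure_map hQ.aemeasurable
    refine ae_eq_of_forall_setLIntegral_eq_of_sigmaFinite hp hκA fun T hT _ => ?_
    have hQT := hQ hT
    rw [setLIntegral_map hT hp hQ, setLIntegral_map hT hκA hQ]
    have e1 : ∫⁻ x in Q ⁻¹' T, ∫⁻ y, hae.mk _ y ∂κ (Q x) ∂μ = μ (A ∩ Q ⁻¹' T) := by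
      rw [h.disintegration _ (hA.inter hQT), ← lintegral_indicator hQT]
      refine lintegral_congr_ae ?_
      filter_upwards [hpQ, hfib] with x h1 h2
      by_cases hx : Q x ∈ T
      · rw [Set.indicator_of_mem (by exact hx), h1]
        refine measure_congr ?_
        filter_upwards [h2] with y hy
        have : y ∈ Q ⁻¹' T := by rw [Set.mem_preimage, hy]; exact hx
        exact propext ⟨fun h3 => ⟨h3, this⟩, fun h3 => h3.1⟩
      · rw [Set.indicator_of_notMem (by exact hx), eq_comm, measure_eq_zero_iff_ae_notMem]
        filter_upwards [h2] with y hy h3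
        have h4 : Q y ∈ T := h3.2
        rw [hy] at h4
        exact hx h4
    have e2 : ∫⁻ x in Q ⁻¹' T, κ (Q x) A ∂μ = μ (A ∩ Q ⁻¹' T) := by
      have h1 := hκ ((T ×ˢ A).indicator 1) (measurable_one.indicator (hT.prod hA))
      have h2 : ∀ x y, (T ×ˢ A).indicator (1 : Y × T3 → ℝ≥0∞) (Q x, y) =
          (Q ⁻¹' T).indicator 1 x * A.indicator 1 y := by
        intro x y
        by_cases hx : Q x ∈ T <;> by_cases hy : y ∈ A <;> simp [Set.indicator, hx, hy]
      simp only [h2] at h1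
      rw [← lintegral_indicator_one (hA.inter hQT), ← lintegral_indicator hQT]
      refine Eq.trans (lintegral_congr fun x => ?_) (h1.symm.trans (lintegral_congr fun x => ?_))
      · rw [lintegral_const_mul _ (measurable_one.indicator hA), lintegral_indicator_one hA]
        by_cases hx : x ∈ Q ⁻¹' T
        · simp [Set.indicator_of_mem hx]
        · simp [Set.indicator_of_notMem hx]
      · rw [Set.inter_comm, Set.inter_indicator_one]
        rfl
    rw [e1, e2]
  filter_upwards [hpQ, ae_of_ae_map hQ.aemeasurable key] with x h1 h2
  rw [← h1, h2]

lemma ae_eq [MeasurableEq Y] [IsProbabilityMeasure μ] (h : IsConditionalSystem μ ξ μs)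
    (hξ : IsMeasurablePartition ξ) (hQ : Measurable Q)
    (hQξ : ∀ x y, Q x = Q y → ξ x y) (hξQ : ∃ N, μ N = 0 ∧ ∀ x ∉ N, ∀ y ∉ N, ξ x y → Q x = Q y)
    (hκ : IsDisintegration μ Q κ) : ∀ᵐ x ∂μ, μs x = κ (Q x) :=
  ae_eq_of_forall_ae_apply_eq h.isProbability (ae_of_all _ fun _ => inferInstance)
    fun _ hA => h.ae_apply_eq hξ hQ hQξ hξQ hκ hA

end IsConditionalSystem

/-! ### Coding of a decreasing partition -/

/-- A decreasing measurable partition is, up to a null set, given by the fibres of a factor map onto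
a one-sided shift. -/
lemma IsMeasurablePartition.exists_coding {f : T3 ≃ₜ T3} {μ : Measure T3}
    (hf : MeasurePreserving f μ μ) {ξ : Setoid T3} (hξ : IsMeasurablePartition ξ)
    (hdec : ∃ N : Set T3, μ N = 0 ∧ ∀ x ∉ N, f '' atom ξ (f.symm x) \ N ⊆ atom ξ x) :
    ∃ (Q : T3 → ℕ → ℕ → ℕ) (s : (ℕ → ℕ → ℕ) → ℕ → ℕ → ℕ), Measurable Q ∧ Measurable s ∧
      (∀ x, Q (f x) = s (Q x)) ∧ (∀ x y, Q x = Q y → ξ x y) ∧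
      ∃ N, μ N = 0 ∧ ∀ x ∉ N, ∀ y ∉ N, ξ x y → Q x = Q y := by
  obtain ⟨k, q, hq, hqξ⟩ := hξ
  obtain ⟨N, hN, hdec⟩ := hdec
  -- The code records the labels along the forward orbit, and `s` shifts the time index `i`. Future
  -- labels add nothing modulo null sets, because points in one atom of `ξ` have images in one atom.
  -- Labels are taken in `ℕ` so that all the finite partitions share one alphabet.
  refine ⟨fun x j i => (q j (f^[i] x) : ℕ), fun y j i => y j (i + 1), ?_, ?_, fun x => rfl,
    fun x y h => ?_, ⋃ i, f^[i] ⁻¹' N, ?_, fun x hx y hy hxy => ?_⟩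
  · refine measurable_pi_lambda _ fun j => measurable_pi_lambda _ fun i => ?_
    exact (measurable_of_countable (fun a : Fin (k j) => (a : ℕ))).comp
      ((hq j).comp (hf.measurable.iterate i))
  · refine measurable_pi_lambda _ fun j => measurable_pi_lambda _ fun i => ?_
    exact (measurable_pi_apply (i + 1)).comp (measurable_pi_apply j)
  · exact (hqξ x y).2 fun j => Fin.ext (congrFun (congrFun h j) 0)
  · exact measure_iUnion_null fun i => (hf.iterate i).quasiMeasurePreserving.preimage_null hN
  · simp only [Set.mem_iUnion, Set.mem_preimage, not_exists] at hx hy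
    have hrel : ∀ i, ξ (f^[i] x) (f^[i] y) := by
      intro i
      induction i with
      | zero => exact hxy
      | succ i ih =>
        have h1 := @hdec (f^[i + 1] x) (hx (i + 1)) (f^[i + 1] y) ⟨⟨f^[i] y, ?_, ?_⟩, hy (i + 1)⟩
        · exact h1
        · rw [Function.iterate_succ_apply', f.symm_apply_apply]
          exact ih
        · rw [Function.iterate_succ_apply']
    funext j i
    exact congrArg Fin.val ((hqξ _ _).1 (hrel i) j)

end ZeroOne

end

noncomputable section

open ProbabilityTheory

namespace ZeroOne

/-! ### The angle relation along orbits and the main theorem -/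

namespace StableSetting

variable {f : T3 ≃ₜ T3} {g : RiemMetric} {Es Ec Eu : T3 → Submodule ℝ E3} {F : E3 → E3}
  {X : Fin 3 → E3 → E3} {θ : Fin 3 → E3 → E3 →L[ℝ] ℝ} {m : Fin 3 → E3 → ℝ} {φ : ℝ → E3 → E3}
  {D : T3 → E2 → E3}

lemma map_mem_leaf (S : StableSetting f g Es Ec Eu F X θ m φ) {x y : T3} (h : y ∈ leaf Es x) :
    f y ∈ leaf Es (f x) := by
  obtain ⟨v, rfl⟩ := proj_surjective x
  obtain ⟨t, rfl⟩ := S.mem_leaf_iff.1 h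
  rw [← S.lift, ← S.lift, S.lift_flow]
  exact S.proj_flow_mem_leaf _ _

lemma angleRel_iterate (S : StableSetting f g Es Ec Eu F X θ m φ)
    (hD : IsDiscFamily Ec Eu D) (hH : HasC1Holonomies g Es D) (n : ℕ) (x y : T3)
    (hl : y ∈ leaf Es x) :
    angleRel g Es Eu D (f^[n] x) (f^[n] y) ↔ angleRel g Es Eu D x y := by
  induction n generalizing x y with
  | zero => exact Iff.rfl
  | succ n ih =>
    rw [Function.iterate_succ_apply, Function.iterate_succ_apply, ih _ _ (S.map_mem_leaf hl),
      S.angleRel_map hD hH hl]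

end StableSetting

lemma IsSubordinate.ae_one_or_zero {f : T3 ≃ₜ T3} {g : RiemMetric} {Es Ec Eu : T3 → Submodule ℝ E3}
    (hf : IsPartiallyHyperbolic f g Es Ec Eu) {D : T3 → E2 → E3} (hD : IsDiscFamily Ec Eu D)
    (hH : HasC1Holonomies g Es D) {μ : Measure T3} [IsProbabilityMeasure μ] (hμ : Ergodic f μ)
    {ξ : Setoid T3} (hξ : IsSubordinate f g Es μ ξ) {μs : T3 → Measure T3}
    (hμs : IsConditionalSystem μ ξ μs) :
    (∀ᵐ x ∂μ, μs x {y | y ∈ atom ξ x ∧ alpha g Es Eu D x y = 0} = 1) ∨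
      ∀ᵐ x ∂μ, μs x {y | y ∈ atom ξ x ∧ alpha g Es Eu D x y = 0} = 0 := by
  obtain ⟨F, X, θ, m, φ, S⟩ := hf.exists_stableSetting
  obtain ⟨Q, s, hQ, hs, hQs, hQξ, hξQ⟩ :=
    hξ.measurable.exists_coding hμ.toMeasurePreserving hξ.decreasing
  obtain ⟨κ, hκM, hκ⟩ := exists_isDisintegration μ hQ
  have hμκ := hμs.ae_eq hξ.measurable hQ hQξ hξQ hκ
  have hatom := hμs.ae_atom hξ.measurable
  have hset : ∀ᵐ x ∂μ, μs x {y | y ∈ atom ξ x ∧ alpha g Es Eu D x y = 0} =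
      κ (Q x) {y | StableSetting.angleRel g Es Eu D x y} := by
    filter_upwards [hμκ, hatom, hξ.subset_leaf] with x h1 h2 h3
    rw [← h1]
    refine measure_congr ?_
    filter_upwards [h2] with y hy
    exact propext ⟨fun h => ⟨h3 h.1, h.2⟩, fun h => ⟨hy, h.2⟩⟩
  have hL : ∀ᵐ x ∂μ, ∀ᵐ y ∂κ (Q x), y ∈ leaf Es x := by
    filter_upwards [hμκ, hatom, hξ.subset_leaf] with x h1 h2 h3
    rw [← h1]
    exact h2.mono fun y hy => h3 hy
  have hgen : ∃ N, μ N = 0 ∧ ∀ x ∉ N, ∀ y ∉ N,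
      (∀ n, Q (f.toMeasurableEquiv.symm^[n] x) = Q (f.toMeasurableEquiv.symm^[n] y)) → x = y := by
    obtain ⟨N, hN, hgen⟩ := hξ.generating
    refine ⟨N, hN, fun x hx y hy h => ?_⟩
    have h1 := @hgen x hx y ⟨Set.mem_iInter.2 fun n => ⟨f.symm^[n] y, hQξ _ _ (h n), ?_⟩, hy⟩
    · exact h1.symm
    · exact Function.RightInverse.iterate f.apply_symm_apply n y
  rcases ae_one_or_zero_of_invariant_relation hκ hQ f.toMeasurableEquiv hμ hs hQs hgen
    (S.measurableSet_angleRel hD hH) (S.angleRel_symm hD hH) (S.angleRel_trans hD hH) hL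
    (S.angleRel_iterate hD hH) with h | h
  · left
    filter_upwards [h, hset] with x h1 h2
    rw [h2, h1]
  · right
    filter_upwards [h, hset] with x h1 h2
    rw [h2, h1]

end ZeroOne

end

open MeasureTheory ZeroOne in
theorem theoremB (f : T3 ≃ₜ T3) (g : RiemMetric) (Es Ec Eu : T3 → Submodule ℝ E3)
    (hf : IsPartiallyHyperbolic f g Es Ec Eu)
    (D : T3 → E2 → E3) (hD : IsDiscFamily Ec Eu D) (hH : HasC1Holonomies g Es D)
    (μ : Measure T3) [IsProbabilityMeasure μ] (hμ : Ergodic f μ)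
    (ξ : Setoid T3) (hξ : IsSubordinate f g Es μ ξ)
    (μs : T3 → Measure T3) (hμs : IsConditionalSystem μ ξ μs) :
    Xor (∀ᵐ x ∂μ, μs x {y | y ∈ atom ξ x ∧ alpha g Es Eu D x y = 0} = 1)
      (∀ᵐ x ∂μ, μs x {y | y ∈ atom ξ x ∧ alpha g Es Eu D x y = 0} = 0) := by
  have hnot : ¬((∀ᵐ x ∂μ, μs x {y | y ∈ atom ξ x ∧ alpha g Es Eu D x y = 0} = 1) ∧
      ∀ᵐ x ∂μ, μs x {y | y ∈ atom ξ x ∧ alpha g Es Eu D x y = 0} = 0) := by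
    rintro ⟨h1, h0⟩
    obtain ⟨x, hx1, hx0⟩ := (h1.and h0).exists
    rw [hx1] at hx0
    exact one_ne_zero hx0
  exact (xor_iff_or_and_not_and _ _).2 ⟨IsSubordinate.ae_one_or_zero hf hD hH hμ hξ hμs, hnot⟩
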